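/- Let $a,b\in\mathbb R$ with $a>-1$, $b>-1$, and $\alpha:=a+b>-1$. There are unique sequences of real polynomials $(p_j)_{j\ge 0}$, $(q_j)_{j\ge 0}$ with $\deg p_j=\deg q_j=j$, with equal and positive leading coefficients of $p_j$ and $q_j$, and $$\int_0^\infty\!\!\int_0^\infty \frac{x^a y^b e^{-x-y}}{x+y}\,p_\ell(x)\,q_m(y)\,dx\,dy=\delta_{\ell m}$$ (the Cauchy–Laguerre biorthogonal polynomials). For $n\in\mathbb N$ and $x,y>0$ let $$K^{(n)}_{00}(x,y)=\sum_{j=0}^{n-1}p_j(x)q_j(y),\qquad K^{(n)}_{01}(x,y)=\int_0^\infty K^{(n)}_{00}(x,y')\frac{y'^b e^{-y'}}{y+y'}dy',\qquad K^{(n)}_{10}(x,y)=\int_0^\infty K^{(n)}_{00}(x',y)\frac{x'^a e^{-x'}}{x+x'}dx',$$ $$K^{(n)}_{11}(x,y)=\int_0^\infty\!\!\int_0^\infty K^{(n)}_{00}(x',y')\frac{x'^a e^{-x'}}{x+x'}\frac{y'^b e^{-y'}}{y+y'}\,dx'\,dy'-\frac1{x+y},$$ and $$H^{(n)}_{00}=x^a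 y^b e^{-x-y}K^{(n)}_{00},\quad H^{(n)}_{01}=x^a e^{-x}K^{(n)}_{01},\quad H^{(n)}_{10}=y^b e^{-y}K^{(n)}_{10},\quad H^{(n)}_{11}=K^{(n)}_{11}$$ (the correlation kernels of the Cauchy–Laguerre two-matrix model). For $c\in\{a,b\}$ and $z>0$ let $$G_{c,n}(z)=\int_\gamma\frac{du}{2\pi i}\,\frac{z^{-u}}{\Gamma(c+1-u)}\,\frac{\Gamma(u)\Gamma(n+\alpha+1-u)}{\Gamma(n+u)\Gamma(\alpha-u+1)},\qquad \widetilde G_{c,n}(z)=\int_\gamma\frac{du}{2\pi i}\,\frac{\Gamma(u-c)\Gamma(u)\Gamma(n+\alpha+1-u)}{\Gamma(\alpha+1-u)\Gamma(n+u)}\,z^{-u},$$ $$H_{c,n}(z)=\int_\gamma\frac{du}{2\pi i}\,\frac{\Gamma(u+c)\Gamma(n+\alpha-c+1-u)}{\Gamma(1-u)\Gamma(c+n+u)\Gamma(\alpha-c-u+1)}\,z^{-u},\qquad \widetilde H_{c,n}(z)=\int_\gamma\frac{du}{2\pi i}\,\frac{\Gamma(u)\Gamma(u+c)\Gamma(n+\alpha-c+1-u)}{\Gamma(\alpha-c+1-u)\Gamma(c+n+u)}\,z^{-u},$$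 where $\gamma$ is a broken line $-\infty-i\eta\to\sigma-i\eta\to\sigma+i\eta\to-\infty+i\eta$ ($\sigma\in\mathbb R$, $\eta>0$) that has all the poles of the numerator factors $\Gamma(\beta+u)$ inside and all those of the numerator factors $\Gamma(\beta-u)$ outside. Such $\gamma$ exist, the integrals converge absolutely and do not depend on the choice of $\gamma$, and, in terms of Meijer G-functions, $$G_{c,n}(z)=G^{1,1}_{2,3}\left(\left.{-\alpha-n,\;n\atop 0,-c,-\alpha}\;\right|z\right),\qquad \widetilde G_{c,n}(z)=G^{2,1}_{2,3}\left(\left.{-\alpha-n,\;n\atop 0,-c,-\alpha}\;\right|z\right),\qquad H_{c,n}(z)=z^cG_{c,n}(z),\qquad \widetilde H_{c,n}(z)=z^c\widetilde G_{c,n}(z).$$ Then, for all $n\in\mathbb N$ and all $x,y>0$, with all integrals (those that define the kernels, and those below) absolutely convergent, $$K^{(n)}_{00}(x,y)=\int_0^1 t^\alpha G_{a,n}(tx)G_{b,n}(ty)\,dt,\qquad K^{(n)}_{01}(x,y)=y^be^{y}\int_0^1 t^\alpha G_{a,n}(tx)\widetilde G_{b,n}(ty)\,dt,$$ $$K^{(n)}_{10}(x,y)=x^ae^{x}\int_0^1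 t^\alpha \widetilde G_{a,n}(tx)G_{b,n}(ty)\,dt,\qquad K^{(n)}_{11}(x,y)=x^ay^be^{x+y}\int_0^1 t^\alpha\widetilde G_{a,n}(tx)\widetilde G_{b,n}(ty)\,dt-\frac{e^{x+y}}{x+y},$$ and $$H^{(n)}_{01}(x,y)=e^{-x+y}\int_0^1H_{a,n}(tx)\widetilde H_{b,n}(ty)\,dt,\qquad H^{(n)}_{00}(x,y)=e^{-x-y}\int_0^1H_{a,n}(tx)H_{b,n}(ty)\,dt,$$ $$H^{(n)}_{11}(x,y)=e^{x+y}\int_0^1\widetilde H_{a,n}(tx)\widetilde H_{b,n}(ty)\,dt-\frac{e^{x+y}}{x+y},\qquad H^{(n)}_{10}(x,y)=e^{x-y}\int_0^1\widetilde H_{a,n}(tx)H_{b,n}(ty)\,dt.$$ -/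

import Mathlib

open MeasureTheory Set Polynomial

noncomputable section

namespace CauchyLaguerre

/-! ### Mellin–Barnes loop integrals -/

/-- The contour that comes from `-∞ - i η`, runs along the horizontal line to `σ - i η`, goes up to
`σ + i η`, and returns along the horizontal line to `-∞ + i η`. -/
structure Loop where
  σ : ℝ
  η : ℝ
  η_pos : 0 < η

/-- The open region enclosed by the contour. -/
def Loop.inside (γ : Loop) : Set ℂ := {u | u.re < γ.σ ∧ |u.im| < γ.η}

/-- The points that lie strictly outside the contour. -/
def Loop.outside (γ : Loop) : Set ℂ := {u | γ.σ < u.re ∨ γ.η < |u.im|}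

/-- All the poles `u = -β - k` of `Γ (β + u)`, for `β ∈ L`, are inside the contour and all the poles
`u = β + k` of `Γ (β - u)`, for `β ∈ R`, are outside. -/
def Loop.Separates (γ : Loop) (L R : Set ℝ) : Prop :=
  (∀ β ∈ L, ∀ k : ℕ, (-(β : ℂ) - k) ∈ γ.inside) ∧ (∀ β ∈ R, ∀ k : ℕ, ((β : ℂ) + k) ∈ γ.outside)

/-- Absolute convergence of the integral of `f` along the contour. -/
def Loop.Converges (γ : Loop) (f : ℂ → ℂ) : Prop :=
  IntegrableOn (fun s : ℝ => f (s - Complex.I * γ.η)) (Iic γ.σ) ∧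
  IntervalIntegrable (fun s : ℝ => f (γ.σ + Complex.I * s)) volume (-γ.η) γ.η ∧
  IntegrableOn (fun s : ℝ => f (s + Complex.I * γ.η)) (Iic γ.σ)

/-- `∫_γ f(u) du / (2πi)`. -/
def Loop.integral (γ : Loop) (f : ℂ → ℂ) : ℂ :=
  ((∫ s : ℝ in Iic γ.σ, f (s - Complex.I * γ.η)) +
    Complex.I * (∫ s : ℝ in (-γ.η)..γ.η, f (γ.σ + Complex.I * s)) -
    (∫ s : ℝ in Iic γ.σ, f (s + Complex.I * γ.η))) / (2 * Real.pi * Complex.I)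

/-- The integral `∫_γ f(u) du / (2πi)`, over a contour `γ` that separates the poles of the
`Γ (β + u)`, `β ∈ L`, from those of the `Γ (β - u)`, `β ∈ R`, is well defined and equal to `v`: there
is such a contour, and along each of them the integral converges absolutely with value `v`. -/
def HasMellinBarnes (L R : Set ℝ) (f : ℂ → ℂ) (v : ℂ) : Prop :=
  (∃ γ : Loop, γ.Separates L R) ∧
    ∀ γ : Loop, γ.Separates L R → γ.Converges f ∧ γ.integral f = v

open Classical in
/-- The value of the integral `∫_γ f(u) du / (2πi)` of `HasMellinBarnes` (and `0` if it is not well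
defined). -/
def mellinBarnes (L R : Set ℝ) (f : ℂ → ℂ) : ℂ :=
  if h : ∃ v, HasMellinBarnes L R f v then h.choose else 0

/-- The Meijer function `G^{m,n}_{p,q}(a₁,…,a_p; b₁,…,b_q | z)` for `p ≤ q` and real parameters such
that the poles of the `Γ(b_j + u)` lie to the left of those of the `Γ(1 - a_j - u)`. -/
def meijerG (m n : ℕ) {p q : ℕ} (a : Fin p → ℝ) (b : Fin q → ℝ) (z : ℂ) : ℂ :=
  mellinBarnes {β | ∃ j : Fin q, (j : ℕ) < m ∧ b j = β} {β | ∃ j : Fin p, (j : ℕ) < n ∧ 1 - a j = β}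
    fun u =>
      ((∏ j : Fin q with j.val < m, Complex.Gamma (b j + u)) *
          ∏ j : Fin p with j.val < n, Complex.Gamma (1 - a j - u)) /
        ((∏ j : Fin q with m ≤ j.val, Complex.Gamma (1 - b j - u)) *
          ∏ j : Fin p with n ≤ j.val, Complex.Gamma (a j + u)) * z ^ (-u)

/-! ### The functions `G_{c,n}`, `G̃_{c,n}`, `H_{c,n}`, `H̃_{c,n}` -/

/-- The integrand of `G_{c,n}(z)`. -/
def gIntegrand (α c : ℝ) (n : ℕ) (z u : ℂ) : ℂ :=
  z ^ (-u) / Complex.Gamma (c + 1 - u) *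
    (Complex.Gamma u * Complex.Gamma (n + α + 1 - u) /
      (Complex.Gamma (n + u) * Complex.Gamma (α - u + 1)))

/-- `G_{c,n}(z)`. -/
def gFun (α c : ℝ) (n : ℕ) (z : ℂ) : ℂ :=
  mellinBarnes {0} {n + α + 1} (gIntegrand α c n z)

/-- The integrand of `G̃_{c,n}(z)`. -/
def gTildeIntegrand (α c : ℝ) (n : ℕ) (z u : ℂ) : ℂ :=
  Complex.Gamma (u - c) * Complex.Gamma u * Complex.Gamma (n + α + 1 - u) /
    (Complex.Gamma (α + 1 - u) * Complex.Gamma (n + u)) * z ^ (-u)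

/-- `G̃_{c,n}(z)`. -/
def gTilde (α c : ℝ) (n : ℕ) (z : ℂ) : ℂ :=
  mellinBarnes {-c, 0} {n + α + 1} (gTildeIntegrand α c n z)

/-- The integrand of `H_{c,n}(z)`. -/
def hIntegrand (α c : ℝ) (n : ℕ) (z u : ℂ) : ℂ :=
  Complex.Gamma (u + c) * Complex.Gamma (n + α - c + 1 - u) /
    (Complex.Gamma (1 - u) * Complex.Gamma (c + n + u) * Complex.Gamma (α - c - u + 1)) * z ^ (-u)

/-- `H_{c,n}(z)`. -/
def hFun (α c : ℝ) (n : ℕ) (z : ℂ) : ℂ :=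
  mellinBarnes {c} {n + α - c + 1} (hIntegrand α c n z)

/-- The integrand of `H̃_{c,n}(z)`. -/
def hTildeIntegrand (α c : ℝ) (n : ℕ) (z u : ℂ) : ℂ :=
  Complex.Gamma u * Complex.Gamma (u + c) * Complex.Gamma (n + α - c + 1 - u) /
    (Complex.Gamma (α - c + 1 - u) * Complex.Gamma (c + n + u)) * z ^ (-u)

/-- `H̃_{c,n}(z)`. -/
def hTilde (α c : ℝ) (n : ℕ) (z : ℂ) : ℂ :=
  mellinBarnes {0, c} {n + α - c + 1} (hTildeIntegrand α c n z)

/-! ### Cauchy–Laguerre biorthogonal polynomials and the kernels -/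

/-- `p`, `q` are the Cauchy biorthogonal polynomials of the weights `x^a e^{-x}`, `y^b e^{-y}`:
`deg p_n = deg q_n = n`, the leading coefficients of `p_n`, `q_n` are equal and positive, and
`∬ x^a y^b e^{-x-y} / (x+y) p_l(x) q_m(y) dx dy = δ_{lm}` over the positive quadrant. -/
def IsCauchyBiorthonormal (a b : ℝ) (p q : ℕ → ℝ[X]) : Prop :=
  (∀ n, (p n).natDegree = n ∧ (q n).natDegree = n ∧
    (p n).leadingCoeff = (q n).leadingCoeff ∧ 0 < (p n).leadingCoeff) ∧
  ∀ l m,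
    IntegrableOn (fun z : ℝ × ℝ => z.1 ^ a * z.2 ^ b * Real.exp (-z.1 - z.2) / (z.1 + z.2) *
      (p l).eval z.1 * (q m).eval z.2) (Ioi 0 ×ˢ Ioi 0) ∧
    ∫ z : ℝ × ℝ in Ioi 0 ×ˢ Ioi 0, z.1 ^ a * z.2 ^ b * Real.exp (-z.1 - z.2) / (z.1 + z.2) *
      (p l).eval z.1 * (q m).eval z.2 = if l = m then 1 else 0

/-- `K₀₀(x,y) = ∑_{j<n} p_j(x) q_j(y)`. -/
def K00 (p q : ℕ → ℝ[X]) (n : ℕ) (x y : ℝ) : ℝ :=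
  ∑ j ∈ Finset.range n, (p j).eval x * (q j).eval y

/-- The integrand of `K₀₁(x,y)`, a function of `y'`. -/
def k01Integrand (b : ℝ) (p q : ℕ → ℝ[X]) (n : ℕ) (x y y' : ℝ) : ℝ :=
  K00 p q n x y' * (y' ^ b * Real.exp (-y') / (y + y'))

/-- `K₀₁(x,y)`. -/
def K01 (b : ℝ) (p q : ℕ → ℝ[X]) (n : ℕ) (x y : ℝ) : ℝ :=
  ∫ y' in Ioi 0, k01Integrand b p q n x y y'

/-- The integrand of `K₁₀(x,y)`, a function of `x'`. -/
def k10Integrand (a : ℝ) (p q : ℕ → ℝ[X]) (n : ℕ) (x y x' : ℝ) : ℝ :=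
  K00 p q n x' y * (x' ^ a * Real.exp (-x') / (x + x'))

/-- `K₁₀(x,y)`. -/
def K10 (a : ℝ) (p q : ℕ → ℝ[X]) (n : ℕ) (x y : ℝ) : ℝ :=
  ∫ x' in Ioi 0, k10Integrand a p q n x y x'

/-- The integrand of the double integral in `K₁₁(x,y)`, a function of `(x',y')`. -/
def k11Integrand (a b : ℝ) (p q : ℕ → ℝ[X]) (n : ℕ) (x y : ℝ) (z : ℝ × ℝ) : ℝ :=
  K00 p q n z.1 z.2 * (z.1 ^ a * Real.exp (-z.1) / (x + z.1)) *
    (z.2 ^ b * Real.exp (-z.2) / (y + z.2))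

/-- `K₁₁(x,y)`. -/
def K11 (a b : ℝ) (p q : ℕ → ℝ[X]) (n : ℕ) (x y : ℝ) : ℝ :=
  (∫ z in Ioi 0 ×ˢ Ioi 0, k11Integrand a b p q n x y z) - 1 / (x + y)

/-- `H₀₀(x,y) = x^a y^b e^{-x-y} K₀₀(x,y)`. -/
def H00 (a b : ℝ) (p q : ℕ → ℝ[X]) (n : ℕ) (x y : ℝ) : ℝ :=
  x ^ a * y ^ b * Real.exp (-x - y) * K00 p q n x y

/-- `H₀₁(x,y) = x^a e^{-x} K₀₁(x,y)`. -/
def H01 (a b : ℝ) (p q : ℕ → ℝ[X]) (n : ℕ) (x y : ℝ) : ℝ :=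
  x ^ a * Real.exp (-x) * K01 b p q n x y

/-- `H₁₀(x,y) = y^b e^{-y} K₁₀(x,y)`. -/
def H10 (a b : ℝ) (p q : ℕ → ℝ[X]) (n : ℕ) (x y : ℝ) : ℝ :=
  y ^ b * Real.exp (-y) * K10 a p q n x y

/-- `H₁₁(x,y) = K₁₁(x,y)`. -/
def H11 (a b : ℝ) (p q : ℕ → ℝ[X]) (n : ℕ) (x y : ℝ) : ℝ :=
  K11 a b p q n x y

end CauchyLaguerre

end

open CauchyLaguerre

/-! Everything reduces to one rational function and the Cauchy matrix attached to it. Put A = α + 1.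
The quotient Γ(u)Γ(n+α+1-u) / (Γ(n+u)Γ(α+1-u)) equals ∏_{i<n} (A+i-u)/(u+i) = (-1)^n + ∑_{k<n}
g_k/(u+k). The same residues give the inverse C_{jk} = g_j g_k/(A+j+k) of the n × n Cauchy matrix
1/(A+j+k) (`sum_cauchyInv_div`), and evaluation at the zeros u = A+j gives ∑_k g_k/(A+j+k) = -(-1)^n
(`sum_cauchyResidue_div`).

Polynomials and kernels. The bimoments are Γ(a+1+j)Γ(b+1+k)/(A+j+k), a Cauchy matrix with rescaled
rows and columns. Hence K₀₀ is the bilinear form of C in the vectors x^j/Γ(a+1+j) and y^k/Γ(b+1+k):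
enlarging n by one changes C by a rank one matrix, and that matrix is the term p_n(x) q_n(y)
(`cauchyInv_succ`, `IsCauchyBiorthonormal.K00_eq`). Integration against the Stieltjes weight
replaces y^k/Γ(b+1+k) by e^y E_{b+k}(y), with E_p(z) = ∫_1^∞ s^{-p-1} e^{-zs} ds, so the other
kernels are the same form in other vectors.

Contour integrals. By partial fractions G_{c,n}(z) = ∑ g_k z^k/Γ(c+1+k) and H̃_{c,n}(z) = (-1)^n
e^{-z} + ∑ g_k E_{c+k}(z). The first is a finite sum of residues, since 1/Γ is entire
(`hasLoopIntegral_div_add`). For the second, Γ(u) z^{-u} is split into the entire ∫_1^∞ s^{u-1}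
e^{-zs} ds and the continuation of ∫_0^1 s^{u-1} e^{-zs} ds; the latter has all the poles but,
divided by u + l, has loop integral zero, because the loop can be pushed to infinity
(`hasLoopIntegral_lowerGamma`).

The integral over [0,1]. The functions (tx)^{c+j}/Γ(c+1+j) and E_{c+j}(tx) solve the Euler equation
t f' = (c+j) f - ε e^{-tx} with ε = 0 and ε = 1. As 1 + (a+j) + (b+k) = A+j+k cancels the
denominator of C_{jk}, the derivative of t ∑ C_{jk} f_j h_k factors into the product of the two
H-type functions, up to an explicit exponential (`cauchyForm_identity`). The fundamental theorem of
calculus then gives all the kernels at once (`EulerFamily.integral_mul`). -/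

namespace CauchyLaguerre

/-! ### Partial fractions and the inverse of the Cauchy matrix -/

section PartialFractions

variable {K : Type*} [Field K]

/-- The residue at `u = -k` of `∏_{i<n} (A + i - u) / (u + i)`. -/
def cauchyResidue (A : K) (n k : ℕ) : K :=
  (∏ i ∈ Finset.range n, (A + i + k)) / ∏ i ∈ (Finset.range n).erase k, ((i : K) - k)

theorem prod_erase_ne_zero [CharZero K] (n k : ℕ) : ∏ i ∈ (Finset.range n).erase k, ((i : K) - k) ≠ 0 := by
  rw [Finset.prod_ne_zero_iff]
  intro i hi
  rw [sub_ne_zero]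
  exact_mod_cast (Finset.mem_erase.1 hi).1

/-- This is Lagrange interpolation of P at the nodes -k, divided by the nodal polynomial. -/
theorem eval_div_prod_add_eq_sum [CharZero K] {n : ℕ} {P : K[X]} (hP : P.degree < n) {u : K}
    (hu : ∀ i ∈ Finset.range n, u + i ≠ 0) :
    P.eval u / ∏ i ∈ Finset.range n, (u + i) =
      ∑ k ∈ Finset.range n,
        P.eval (-(k : K)) / (∏ i ∈ (Finset.range n).erase k, ((i : K) - k)) / (u + k) := by
  have hinj : Set.InjOn (fun i : ℕ => -(i : K)) (Finset.range n : Set ℕ) := by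
    intro i _ j _ h
    simpa using h
  have h1 := Lagrange.eq_interpolate (s := Finset.range n) hinj (by simpa using hP)
  have h2 := Lagrange.eval_interpolate_not_at_node (s := Finset.range n)
    (v := fun i : ℕ => -(i : K)) (r := fun i => P.eval (-(i : K))) (x := u)
    (fun i hi h => hu i hi (by rw [h]; ring))
  rw [← h1, Lagrange.eval_nodal] at h2
  have h3 : ∏ i ∈ Finset.range n, (u + i) ≠ 0 := Finset.prod_ne_zero_iff.2 hu
  simp only [sub_neg_eq_add] at h2
  rw [h2, mul_div_cancel_left₀ _ h3]
  refine Finset.sum_congr rfl fun k _ => ?_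
  have : Lagrange.nodalWeight (Finset.range n) (fun i : ℕ => -(i : K)) k =
      (∏ i ∈ (Finset.range n).erase k, ((i : K) - k))⁻¹ := by
    rw [Lagrange.nodalWeight, Finset.prod_inv_distrib]
    congr 1
    exact Finset.prod_congr rfl fun i _ => by ring
  rw [this]
  ring

theorem natDegree_prod_sub_X (A : K) (s : Finset ℕ) :
    (∏ i ∈ s, (C (A + i) - X)).natDegree = s.card ∧
      (∏ i ∈ s, (C (A + i) - X)).leadingCoeff = (-1) ^ s.card := by
  have h : ∏ i ∈ s, (C (A + (i : K)) - X) = C ((-1) ^ s.card) * ∏ i ∈ s, (X - C (A + (i : K))) := by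
    rw [C_pow, ← Finset.prod_const, ← Finset.prod_mul_distrib]
    exact Finset.prod_congr rfl fun i _ => by rw [C_neg, C_1]; ring
  have hm : (∏ i ∈ s, (X - C (A + (i : K)))).Monic := monic_prod_of_monic _ _ fun i _ => monic_X_sub_C _
  have h0 : ((-1 : K)) ^ s.card ≠ 0 := pow_ne_zero _ (by norm_num)
  rw [h]
  constructor
  · rw [natDegree_C_mul h0, natDegree_prod_of_monic _ _ fun i _ => monic_X_sub_C _]
    simp only [natDegree_X_sub_C, Finset.sum_const, smul_eq_mul, mul_one]
  · rw [leadingCoeff_mul, leadingCoeff_C, hm.leadingCoeff, mul_one]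

/-- Numerator and denominator have the same degree, with leading coefficients (-1)^n and 1.
Subtracting (-1)^n times the denominator leaves a numerator of degree below n, which Lagrange
interpolation covers. -/
theorem prod_div_prod_eq_sum_cauchyResidue [CharZero K] (A : K) (n : ℕ) {u : K}
    (hu : ∀ i ∈ Finset.range n, u + i ≠ 0) :
    (∏ i ∈ Finset.range n, (A + i - u)) / ∏ i ∈ Finset.range n, (u + i) =
      (-1) ^ n + ∑ k ∈ Finset.range n, cauchyResidue A n k / (u + k) := by
  have h3 : ∏ i ∈ Finset.range n, (u + i) ≠ 0 := Finset.prod_ne_zero_iff.2 hu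
  have hm : (∏ i ∈ Finset.range n, (X + C (i : K))).Monic :=
    monic_prod_of_monic _ _ fun i _ => monic_X_add_C _
  have hd : (∏ i ∈ Finset.range n, (X + C (i : K))).natDegree = n := by
    rw [natDegree_prod_of_monic _ _ fun i _ => monic_X_add_C _]
    simp only [natDegree_X_add_C, Finset.sum_const, smul_eq_mul, mul_one, Finset.card_range]
  obtain ⟨hd1, hl1⟩ := natDegree_prod_sub_X A (Finset.range n)
  rw [Finset.card_range] at hd1 hl1
  have h0 : ((-1 : K)) ^ n ≠ 0 := pow_ne_zero _ (by norm_num)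
  have hdeg : (∏ i ∈ Finset.range n, (C (A + i) - X) -
      C ((-1) ^ n) * ∏ i ∈ Finset.range n, (X + C (i : K))).degree < (n : WithBot ℕ) := by
    have hne : ∏ i ∈ Finset.range n, (C (A + (i : K)) - X) ≠ 0 := by
      rw [← leadingCoeff_ne_zero, hl1]; exact h0
    have := degree_sub_lt_left (p := ∏ i ∈ Finset.range n, (C (A + i) - X))
      (q := C ((-1) ^ n) * ∏ i ∈ Finset.range n, (X + C (i : K))) ?_ hne ?_
    · rwa [degree_eq_natDegree hne, hd1] at this
    · rw [degree_C_mul h0, degree_eq_natDegree hne, hd1, degree_eq_natDegree hm.ne_zero, hd]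
    · rw [hl1, leadingCoeff_mul, leadingCoeff_C, hm.leadingCoeff, mul_one]
  have h := eval_div_prod_add_eq_sum hdeg hu
  simp only [eval_sub, eval_mul, eval_C, eval_prod, eval_add, eval_X] at h
  rw [sub_div, mul_div_cancel_right₀ _ h3, sub_eq_iff_eq_add'] at h
  rw [h]
  congr 1
  refine Finset.sum_congr rfl fun k hk => ?_
  -- The subtracted multiple of the denominator vanishes at the nodes, so the residues are those of
  -- the original quotient.
  have hz : ∏ i ∈ Finset.range n, (-(k : K) + i) = 0 := Finset.prod_eq_zero hk (by ring)
  rw [hz, cauchyResidue]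
  simp only [sub_neg_eq_add, mul_zero, sub_zero]

/-- The partial fraction expansion is evaluated at u = A + j, a zero of the numerator. -/
theorem sum_cauchyResidue_div [CharZero K] (A : K) {n j : ℕ} (hj : j < n)
    (hA : ∀ i : ℕ, A + i ≠ 0) :
    ∑ k ∈ Finset.range n, cauchyResidue A n k / (A + j + k) = -(-1) ^ n := by
  have h := prod_div_prod_eq_sum_cauchyResidue A n (u := A + j)
    (fun i _ => by simpa [add_assoc] using hA (j + i))
  rw [Finset.prod_eq_zero (Finset.mem_range.2 hj) (by ring), zero_div] at h
  linear_combination -h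

theorem cauchyResidue_ne_zero [CharZero K] (A : K) (n k : ℕ) (hA : ∀ i : ℕ, A + i ≠ 0) :
    cauchyResidue A n k ≠ 0 := by
  refine div_ne_zero (Finset.prod_ne_zero_iff.2 fun i _ => ?_) (prod_erase_ne_zero n k)
  simpa [add_assoc] using hA (i + k)

/-- The entries `g_j g_k / (A + j + k)` of the inverse of the Cauchy matrix `1 / (A + j + k)`. -/
def cauchyInv (A : K) (n j k : ℕ) : K :=
  cauchyResidue A n j * cauchyResidue A n k / (A + j + k)

/-- Dividing g_k by A + j + k deletes the factor i = j from its numerator. The sum is thus g_j times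
the partial fraction expansion of ∏_{i≠j} (A+i-u) / ∏ (u+i) at u = A + m: the factor i = m kills it
for m ≠ j, and for m = j the quotient is 1/g_j. -/
theorem sum_cauchyInv_div [CharZero K] (A : K) {n j m : ℕ} (hj : j < n) (hm : m < n)
    (hA : ∀ i : ℕ, A + i ≠ 0) :
    ∑ k ∈ Finset.range n, cauchyInv A n j k / (A + k + m) = if j = m then 1 else 0 := by
  have hA2 : ∀ i l : ℕ, A + i + l ≠ 0 := fun i l => by simpa [add_assoc] using hA (i + l)
  have hdeg : (∏ i ∈ (Finset.range n).erase j, (C (A + i) - X)).degree < (n : WithBot ℕ) := by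
    obtain ⟨hd1, hl1⟩ := natDegree_prod_sub_X A ((Finset.range n).erase j)
    have hne : ∏ i ∈ (Finset.range n).erase j, (C (A + (i : K)) - X) ≠ 0 := by
      rw [← leadingCoeff_ne_zero, hl1]; exact pow_ne_zero _ (by norm_num)
    rw [degree_eq_natDegree hne, hd1, Finset.card_erase_of_mem (Finset.mem_range.2 hj),
      Finset.card_range]
    exact_mod_cast Nat.sub_lt (by omega) one_pos
  have h := eval_div_prod_add_eq_sum hdeg (u := A + m) (fun i _ => hA2 m i)
  simp only [eval_sub, eval_C, eval_prod, eval_X] at h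
  have h1 : ∑ k ∈ Finset.range n, cauchyInv A n j k / (A + k + m) = cauchyResidue A n j *
      ((∏ i ∈ (Finset.range n).erase j, (A + i - (A + m))) / ∏ i ∈ Finset.range n, (A + m + i)) := by
    rw [h, Finset.mul_sum]
    refine Finset.sum_congr rfl fun k hk => ?_
    have e1 : ∏ i ∈ Finset.range n, (A + i + k) =
        (A + j + k) * ∏ i ∈ (Finset.range n).erase j, (A + i - -(k : K)) := by
      rw [← Finset.mul_prod_erase _ _ (Finset.mem_range.2 hj)]
      simp
    have e2 : cauchyResidue A n k = (A + j + k) * (∏ i ∈ (Finset.range n).erase j, (A + i - -(k : K))) /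
        ∏ i ∈ (Finset.range n).erase k, ((i : K) - k) := by rw [cauchyResidue, e1]
    rw [cauchyInv, e2, add_right_comm A (k : K)]
    have := hA2 j k
    field_simp
  rw [h1]
  have e3 : ∏ i ∈ (Finset.range n).erase j, (A + (i : K) - (A + m)) =
      ∏ i ∈ (Finset.range n).erase j, ((i : K) - m) := Finset.prod_congr rfl fun i _ => by ring
  rw [e3]
  split_ifs with hjm
  · subst hjm
    have h4 := prod_erase_ne_zero (K := K) n j
    have h5 : ∏ i ∈ Finset.range n, (A + j + i) ≠ 0 := Finset.prod_ne_zero_iff.2 fun i _ => hA2 j i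
    have e6 : ∏ i ∈ Finset.range n, (A + i + j) = ∏ i ∈ Finset.range n, (A + j + i) :=
      Finset.prod_congr rfl fun i _ => by ring
    rw [cauchyResidue, e6]
    field_simp
  · rw [Finset.prod_eq_zero (i := m) (Finset.mem_erase.2 ⟨Ne.symm hjm, Finset.mem_range.2 hm⟩) (by simp)]
    simp

end PartialFractions

theorem cauchyInv_comm {K : Type*} [Field K] (A : K) (n j k : ℕ) : cauchyInv A n j k = cauchyInv A n k j := by
  simp only [cauchyInv]; rw [mul_comm, add_right_comm]

theorem ofReal_cauchyResidue (A : ℝ) (n k : ℕ) :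
    ((cauchyResidue A n k : ℝ) : ℂ) = cauchyResidue (A : ℂ) n k := by
  simp [cauchyResidue]

/-- The Cauchy matrix inverse of size `n + 1` is a rank one update of the one of size `n`. -/
theorem cauchyInv_succ {A : ℝ} (hA : 0 < A) {n j k : ℕ} (hj : j < n) (hk : k < n) :
    cauchyInv A (n + 1) j k = cauchyInv A n j k +
      cauchyInv A (n + 1) n j * cauchyInv A (n + 1) n k / cauchyInv A (n + 1) n n := by
  have key : ∀ i < n, cauchyResidue A (n + 1) i = cauchyResidue A n i * (A + n + i) / (n - i) := by
    intro i hi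
    have hni : ((n : ℝ) - i) ≠ 0 := sub_ne_zero.2 (by exact_mod_cast hi.ne')
    have h0 := prod_erase_ne_zero (K := ℝ) n i
    rw [cauchyResidue, cauchyResidue, Finset.prod_range_succ, Finset.range_add_one,
      Finset.erase_insert_of_ne hi.ne', Finset.prod_insert (by simp)]
    field_simp
  have hnn : cauchyResidue A (n + 1) n ≠ 0 := cauchyResidue_ne_zero A _ _ fun i => by positivity
  have hjn : (0 : ℝ) < n - j := sub_pos.2 (by exact_mod_cast hj)
  have hkn : (0 : ℝ) < n - k := sub_pos.2 (by exact_mod_cast hk)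
  simp only [cauchyInv, key j hj, key k hk]
  have h1 : A + j + k ≠ 0 := by positivity
  have h2 : A + n + j ≠ 0 := by positivity
  have h3 : A + n + k ≠ 0 := by positivity
  have h4 : A + n + n ≠ 0 := by positivity
  -- What remains is (A+n+j)(A+n+k) = (n-j)(n-k) + (A+2n)(A+j+k).
  field_simp
  ring

section ContourIntegrals

open Filter Topology Complex

/-! ### Loop integrals of functions that decay on the left -/

/-- The integral along the part of the contour to the right of `Re u = -N`. -/
noncomputable def Loop.truncated (γ : Loop) (f : ℂ → ℂ) (N : ℝ) : ℂ :=
  (∫ s : ℝ in (-N)..γ.σ, f (s - I * γ.η)) + I * (∫ s : ℝ in (-γ.η)..γ.η, f (γ.σ + I * s)) -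
    ∫ s : ℝ in (-N)..γ.σ, f (s + I * γ.η)

theorem Loop.Converges.tendsto_truncated {γ : Loop} {f : ℂ → ℂ} (h : γ.Converges f) :
    Tendsto (γ.truncated f) atTop (𝓝 (2 * Real.pi * I * γ.integral f)) := by
  have e : 2 * Real.pi * I * γ.integral f = (∫ s : ℝ in Iic γ.σ, f (s - I * γ.η)) +
      I * (∫ s : ℝ in (-γ.η)..γ.η, f (γ.σ + I * s)) - (∫ s : ℝ in Iic γ.σ, f (s + I * γ.η)) := by
    rw [Loop.integral, mul_div_cancel₀]
    exact two_pi_I_ne_zero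
  rw [e]
  exact ((intervalIntegral_tendsto_integral_Iic _ h.1 tendsto_neg_atTop_atBot).add_const _).sub
    (intervalIntegral_tendsto_integral_Iic _ h.2.2 tendsto_neg_atTop_atBot)

/-- `f` is holomorphic off the ray `(-∞, ρ]` and decays quadratically to the left, away from it. -/
structure QuadraticDecay (ρ : ℝ) (f : ℂ → ℂ) : Prop where
  differentiableAt : ∀ u : ℂ, ρ < u.re ∨ u.im ≠ 0 → DifferentiableAt ℂ f u
  decay : ∀ σ η η' : ℝ, 0 < η → ∃ M : ℝ, ∀ u : ℂ, u.re ≤ σ → η ≤ |u.im| → |u.im| ≤ η' →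
    ‖f u‖ ≤ M / (1 + ‖u‖ ^ 2)

theorem integrableOn_leg {f : ℂ → ℂ} {σ η M : ℝ}
    (hd : ∀ s ≤ σ, DifferentiableAt ℂ f (s + I * η))
    (hM : ∀ s ≤ σ, ‖f (s + I * η)‖ ≤ M / (1 + ‖(s + I * η : ℂ)‖ ^ 2)) :
    IntegrableOn (fun s : ℝ => f (s + I * η)) (Iic σ) := by
  refine Integrable.mono' ((integrable_inv_one_add_sq.const_mul |M|).integrableOn) ?_ ?_
  · refine ContinuousOn.aestronglyMeasurable (fun s hs => ?_) measurableSet_Iic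
    refine ContinuousAt.continuousWithinAt ?_
    exact ContinuousAt.comp (f := fun s : ℝ => (s + I * η : ℂ)) (hd s hs).continuousAt (by fun_prop)
  · refine (ae_restrict_iff' measurableSet_Iic).2 (Eventually.of_forall fun s hs => ?_)
    refine (hM s hs).trans ?_
    rw [div_eq_mul_inv]
    have h1 : s ^ 2 ≤ ‖(s + I * η : ℂ)‖ ^ 2 := by
      have := abs_re_le_norm (s + I * η : ℂ)
      simp only [add_re, ofReal_re, mul_re, I_re, zero_mul, I_im, ofReal_im, mul_zero, sub_self,
        add_zero] at this
      rw [← sq_abs s]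
      gcongr
    have : M ≤ |M| := le_abs_self M
    gcongr

theorem QuadraticDecay.converges {ρ : ℝ} {f : ℂ → ℂ} (hf : QuadraticDecay ρ f) {γ : Loop}
    (hγ : ρ < γ.σ) : γ.Converges f := by
  have hη := γ.η_pos
  obtain ⟨M, hM⟩ := hf.decay γ.σ γ.η γ.η hη
  refine ⟨?_, ?_, ?_⟩
  · have := integrableOn_leg (f := f) (σ := γ.σ) (η := -γ.η) (M := M)
      (fun s _ => hf.differentiableAt _ (Or.inr (by simpa using hη.ne')))
      (fun s hs => hM _ (by simpa using hs) (by simp [abs_of_pos hη]) (by simp [abs_of_pos hη]))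
    refine this.congr_fun (fun s _ => ?_) measurableSet_Iic
    simp [sub_eq_add_neg]
  · refine ContinuousOn.intervalIntegrable fun s _ => ContinuousAt.continuousWithinAt ?_
    refine ContinuousAt.comp (f := fun s : ℝ => (γ.σ + I * s : ℂ)) ?_ (by fun_prop)
    exact (hf.differentiableAt _ (Or.inl (by simpa using hγ))).continuousAt
  · exact integrableOn_leg (f := f) (σ := γ.σ) (η := γ.η) (M := M)
      (fun s _ => hf.differentiableAt _ (Or.inr (by simpa using hη.ne')))
      (fun s hs => hM _ (by simpa using hs) (by simp [abs_of_pos hη]) (by simp [abs_of_pos hη]))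

theorem rect_integral_eq_zero {f : ℂ → ℂ} {x₁ x₂ y₁ y₂ : ℝ}
    (hf : ∀ u : ℂ, u.re ∈ uIcc x₁ x₂ → u.im ∈ uIcc y₁ y₂ → DifferentiableAt ℂ f u) :
    (∫ s : ℝ in x₁..x₂, f (s + I * y₁)) - (∫ s : ℝ in x₁..x₂, f (s + I * y₂)) +
      I * (∫ s : ℝ in y₁..y₂, f (x₂ + I * s)) - I * (∫ s : ℝ in y₁..y₂, f (x₁ + I * s)) = 0 := by
  have := Complex.integral_boundary_rect_eq_zero_of_differentiableOn f ⟨x₁, y₁⟩ ⟨x₂, y₂⟩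
    (fun u hu => (hf u hu.1 hu.2).differentiableWithinAt)
  simpa [mul_comm I] using this

theorem intervalIntegrable_horizontal {f : ℂ → ℂ} {x₁ x₂ y : ℝ}
    (hf : ∀ s ∈ uIcc x₁ x₂, DifferentiableAt ℂ f (s + I * y)) :
    IntervalIntegrable (fun s : ℝ => f (s + I * y)) volume x₁ x₂ :=
  ContinuousOn.intervalIntegrable fun s hs => ContinuousAt.continuousWithinAt <|
    ContinuousAt.comp (f := fun s : ℝ => (s + I * y : ℂ)) (hf s hs).continuousAt (by fun_prop)

theorem intervalIntegrable_vertical {f : ℂ → ℂ} {x y₁ y₂ : ℝ}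
    (hf : ∀ s ∈ uIcc y₁ y₂, DifferentiableAt ℂ f (x + I * s)) :
    IntervalIntegrable (fun s : ℝ => f (x + I * s)) volume y₁ y₂ :=
  ContinuousOn.intervalIntegrable fun s hs => ContinuousAt.continuousWithinAt <|
    ContinuousAt.comp (f := fun s : ℝ => (x + I * s : ℂ)) (hf s hs).continuousAt (by fun_prop)

theorem QuadraticDecay.truncated_eq_of_eta_eq {ρ : ℝ} {f : ℂ → ℂ} (hf : QuadraticDecay ρ f)
    {γ γ' : Loop} (hγ : ρ < γ.σ) (hγ' : ρ < γ'.σ) (hη : γ.η = γ'.η) (N : ℝ) :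
    γ.truncated f N = γ'.truncated f N := by
  have h0 := γ.η_pos
  have hd : ∀ s : ℝ, ∀ y : ℝ, y ≠ 0 → DifferentiableAt ℂ f (s + I * y) := fun s y hy =>
    hf.differentiableAt _ (Or.inr (by simpa using hy))
  have h := rect_integral_eq_zero (f := f) (x₁ := γ.σ) (x₂ := γ'.σ) (y₁ := -γ.η) (y₂ := γ.η)
    (fun u hu _ => hf.differentiableAt u (Or.inl (lt_of_lt_of_le (lt_min hγ hγ') hu.1)))
  have h1 := intervalIntegral.integral_add_adjacent_intervals
    (intervalIntegrable_horizontal (x₁ := -N) (x₂ := γ.σ) (fun s _ => hd s (-γ.η) (by linarith)))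
    (intervalIntegrable_horizontal (x₁ := γ.σ) (x₂ := γ'.σ) (fun s _ => hd s (-γ.η) (by linarith)))
  have h2 := intervalIntegral.integral_add_adjacent_intervals
    (intervalIntegrable_horizontal (x₁ := -N) (x₂ := γ.σ) (fun s _ => hd s γ.η h0.ne'))
    (intervalIntegrable_horizontal (x₁ := γ.σ) (x₂ := γ'.σ) (fun s _ => hd s γ.η h0.ne'))
  simp only [Loop.truncated, ← hη]
  simp only [ofReal_neg, mul_neg, ← sub_eq_add_neg] at h h1 h2
  linear_combination -h + h1 - h2

theorem norm_vertical_le {f : ℂ → ℂ} {N y₁ y₂ C : ℝ}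
    (hM : ∀ s ∈ uIoc y₁ y₂, ‖f (-N + I * s)‖ ≤ C) :
    ‖∫ s : ℝ in y₁..y₂, f (((-N : ℝ) : ℂ) + I * s)‖ ≤ C * |y₂ - y₁| :=
  intervalIntegral.norm_integral_le_of_norm_le_const (by simpa using hM)

theorem tendsto_vertical {f : ℂ → ℂ} {y₁ y₂ M : ℝ}
    (hM : ∀ᶠ N : ℝ in atTop, ∀ s ∈ uIoc y₁ y₂, ‖f (-N + I * s)‖ ≤ M / N) :
    Tendsto (fun N : ℝ => ∫ s : ℝ in y₁..y₂, f (((-N : ℝ) : ℂ) + I * s)) atTop (𝓝 0) := by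
  refine squeeze_zero_norm' (a := fun N => M / N * |y₂ - y₁|) ?_ ?_
  · filter_upwards [hM] with N hN using norm_vertical_le hN
  · simpa using (tendsto_const_nhds (x := M)).div_atTop tendsto_id |>.mul_const |y₂ - y₁|

theorem le_norm_neg_add (N s : ℝ) : N ≤ ‖(-N + I * s : ℂ)‖ := by
  have := abs_re_le_norm (-N + I * s : ℂ)
  simp only [add_re, neg_re, ofReal_re, mul_re, I_re, zero_mul, I_im, ofReal_im, mul_zero, sub_self,
    add_zero, abs_neg] at this
  exact (le_abs_self N).trans this

theorem QuadraticDecay.tendsto_vertical {ρ : ℝ} {f : ℂ → ℂ} (hf : QuadraticDecay ρ f)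
    {y₁ y₂ : ℝ} (h : ∀ s ∈ uIcc y₁ y₂, s ≠ 0) :
    Tendsto (fun N : ℝ => ∫ s : ℝ in y₁..y₂, f (((-N : ℝ) : ℂ) + I * s)) atTop (𝓝 0) := by
  obtain ⟨m, hm, hmin⟩ := isCompact_uIcc.exists_isMinOn (nonempty_uIcc (a := y₁) (b := y₂))
    continuous_abs.continuousOn
  obtain ⟨m', hm', hmax⟩ := isCompact_uIcc.exists_isMaxOn (nonempty_uIcc (a := y₁) (b := y₂))
    continuous_abs.continuousOn
  obtain ⟨M, hM⟩ := hf.decay 0 |m| |m'| (abs_pos.2 (h m hm))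
  refine CauchyLaguerre.tendsto_vertical (M := |M|) ?_
  filter_upwards [eventually_gt_atTop 0] with N hN s hs
  have hs' := uIoc_subset_uIcc hs
  refine (hM (-N + I * s) (by simpa using hN.le) (by simpa using hmin hs')
    (by simpa using hmax hs')).trans ?_
  have h1 := le_norm_neg_add N s
  have h2 : M ≤ |M| := le_abs_self M
  gcongr
  nlinarith [sq_nonneg (‖(-N + I * s : ℂ)‖ - 1)]

/-- Loops of equal height differ by a rectangle on which f is holomorphic. Changing the height adds
one rectangle above the ray and one below it; their far sides at Re u = -N contribute nothing in the
limit. -/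
theorem QuadraticDecay.integral_eq {ρ : ℝ} {f : ℂ → ℂ} (hf : QuadraticDecay ρ f)
    {γ γ' : Loop} (hγ : ρ < γ.σ) (hγ' : ρ < γ'.σ) : γ.integral f = γ'.integral f := by
  let δ : Loop := ⟨γ.σ, γ'.η, γ'.η_pos⟩
  have hδ : ρ < δ.σ := hγ
  have hc := hf.converges hγ
  have hc' := hf.converges hγ'
  have t1 := hc.tendsto_truncated
  have t2 := hc'.tendsto_truncated
  have p1 := γ.η_pos
  have p2 := γ'.η_pos
  have hd : ∀ s : ℝ, ∀ y : ℝ, y ≠ 0 → DifferentiableAt ℂ f (s + I * y) := fun s y hy =>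
    hf.differentiableAt _ (Or.inr (by simpa using hy))
  have hσ : ∀ s : ℝ, DifferentiableAt ℂ f (γ.σ + I * s) := fun s =>
    hf.differentiableAt _ (Or.inl (by simpa using hγ))
  have q1 : ∀ y ∈ uIcc γ.η γ'.η, y ≠ 0 := fun y hy =>
    ((lt_min p1 p2).trans_le hy.1).ne'
  have q2 : ∀ y ∈ uIcc (-γ'.η) (-γ.η), y ≠ 0 := fun y hy =>
    (hy.2.trans_lt (max_lt (by linarith) (by linarith))).ne
  have key : ∀ N, γ.truncated f N - γ'.truncated f N =
      I * (∫ s : ℝ in γ.η..γ'.η, f (((-N : ℝ) : ℂ) + I * s)) * (-1) +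
        I * (∫ s : ℝ in (-γ'.η)..(-γ.η), f (((-N : ℝ) : ℂ) + I * s)) * (-1) := by
    intro N
    rw [← hf.truncated_eq_of_eta_eq hδ hγ' rfl N]
    have r1 := rect_integral_eq_zero (f := f) (x₁ := -N) (x₂ := γ.σ) (y₁ := γ.η) (y₂ := γ'.η)
      (fun u _ hu => hf.differentiableAt u (Or.inr (q1 _ hu)))
    have r2 := rect_integral_eq_zero (f := f) (x₁ := -N) (x₂ := γ.σ) (y₁ := -γ'.η) (y₂ := -γ.η)
      (fun u _ hu => hf.differentiableAt u (Or.inr (q2 _ hu)))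
    have h1 := intervalIntegral.integral_add_adjacent_intervals
      (intervalIntegrable_vertical (y₁ := -γ'.η) (y₂ := -γ.η) (fun s _ => hσ s))
      (intervalIntegrable_vertical (y₁ := -γ.η) (y₂ := γ.η) (fun s _ => hσ s))
    have h2 := intervalIntegral.integral_add_adjacent_intervals
      (intervalIntegrable_vertical (y₁ := -γ'.η) (y₂ := γ.η) (fun s _ => hσ s))
      (intervalIntegrable_vertical (y₁ := γ.η) (y₂ := γ'.η) (fun s _ => hσ s))
    have e1 : δ.σ = γ.σ := rfl
    have e2 : δ.η = γ'.η := rfl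
    simp only [Loop.truncated, e1, e2]
    simp only [ofReal_neg, mul_neg, ← sub_eq_add_neg] at r1 r2 h1 h2 ⊢
    linear_combination -r1 - r2 + I * h1 + I * h2
  have t3 : Tendsto (fun N => γ.truncated f N - γ'.truncated f N) atTop (𝓝 0) := by
    simp only [key]
    simpa using (((hf.tendsto_vertical q1).const_mul I).mul_const (-1)).add
      (((hf.tendsto_vertical q2).const_mul I).mul_const (-1))
  have := tendsto_nhds_unique t3 (t1.sub t2)
  have h0 : (2 * Real.pi * I : ℂ) ≠ 0 := two_pi_I_ne_zero
  have h4 : 2 * Real.pi * I * (γ.integral f - γ'.integral f) = 0 := by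
    rw [mul_sub]; exact this.symm
  exact sub_eq_zero.1 ((mul_eq_zero.1 h4).resolve_left h0)

/-- The integral of `f` converges, with value `v`, along each contour that crosses the real axis to
the right of `ρ`. -/
def HasLoopIntegral (ρ : ℝ) (f : ℂ → ℂ) (v : ℂ) : Prop :=
  ∀ γ : Loop, ρ < γ.σ → γ.Converges f ∧ γ.integral f = v

theorem HasLoopIntegral.mono {ρ ρ' : ℝ} {f : ℂ → ℂ} {v : ℂ} (h : HasLoopIntegral ρ f v)
    (hρ : ρ ≤ ρ') : HasLoopIntegral ρ' f v := fun γ hγ => h γ (hρ.trans_lt hγ)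

theorem HasLoopIntegral.add {ρ : ℝ} {f g : ℂ → ℂ} {v w : ℂ} (hf : HasLoopIntegral ρ f v)
    (hg : HasLoopIntegral ρ g w) : HasLoopIntegral ρ (fun u => f u + g u) (v + w) := by
  intro γ hγ
  obtain ⟨⟨f1, f2, f3⟩, fv⟩ := hf γ hγ
  obtain ⟨⟨g1, g2, g3⟩, gv⟩ := hg γ hγ
  refine ⟨⟨f1.add g1, f2.add g2, f3.add g3⟩, ?_⟩
  rw [← fv, ← gv]
  simp only [Loop.integral]
  rw [integral_add f1 g1, integral_add f3 g3, intervalIntegral.integral_add f2 g2]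
  ring

theorem HasLoopIntegral.const_mul {ρ : ℝ} {f : ℂ → ℂ} {v : ℂ} (c : ℂ) (hf : HasLoopIntegral ρ f v) :
    HasLoopIntegral ρ (fun u => c * f u) (c * v) := by
  intro γ hγ
  obtain ⟨⟨f1, f2, f3⟩, fv⟩ := hf γ hγ
  refine ⟨⟨f1.const_mul c, f2.const_mul c, f3.const_mul c⟩, ?_⟩
  rw [← fv]
  simp only [Loop.integral]
  rw [integral_const_mul, integral_const_mul, intervalIntegral.integral_const_mul]
  ring

theorem HasLoopIntegral.sum {ρ : ℝ} {ι : Type*} (s : Finset ι) {f : ι → ℂ → ℂ} {v : ι → ℂ}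
    (h : ∀ i ∈ s, HasLoopIntegral ρ (f i) (v i)) :
    HasLoopIntegral ρ (fun u => ∑ i ∈ s, f i u) (∑ i ∈ s, v i) := by
  classical
  induction s using Finset.induction_on with
  | empty =>
    intro γ _
    simp [Loop.Converges, Loop.integral]
  | insert i s hi ih =>
    simp only [Finset.sum_insert hi]
    exact (h i (Finset.mem_insert_self i s)).add
      (ih fun j hj => h j (Finset.mem_insert_of_mem hj))

theorem integrableOn_integral_Iic_comp_sub (g : ℝ → ℂ) (σ c : ℝ) :
    (IntegrableOn (fun s => g (s - c)) (Iic σ) ↔ IntegrableOn g (Iic (σ - c))) ∧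
      ∫ s in Iic σ, g (s - c) = ∫ s in Iic (σ - c), g s := by
  have hp : (fun s : ℝ => s - c) ⁻¹' Iic (σ - c) = Iic σ := by ext; simp
  have hm := measurePreserving_sub_right volume c
  have he := (MeasurableEquiv.subRight c).measurableEmbedding
  constructor
  · have := hm.integrableOn_comp_preimage he (f := g) (s := Iic (σ - c))
    rwa [hp] at this
  · have := hm.setIntegral_preimage_emb he g (Iic (σ - c))
    rwa [hp] at this

theorem HasLoopIntegral.comp_sub {ρ : ℝ} {f : ℂ → ℂ} {v : ℂ} (hf : HasLoopIntegral ρ f v) (c : ℝ) :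
    HasLoopIntegral (ρ + c) (fun u => f (u - c)) v := by
  intro γ hγ
  obtain ⟨⟨f1, f2, f3⟩, fv⟩ := hf ⟨γ.σ - c, γ.η, γ.η_pos⟩ (by simp only; linarith)
  have a1 := integrableOn_integral_Iic_comp_sub (fun s => f (s - I * γ.η)) γ.σ c
  have a3 := integrableOn_integral_Iic_comp_sub (fun s => f (s + I * γ.η)) γ.σ c
  have e1 : ∀ s : ℝ, f (((s - c : ℝ) : ℂ) - I * γ.η) = f (s - I * γ.η - c) := fun s => by
    push_cast; congr 1; ring
  have e2 : ∀ s : ℝ, f (((γ.σ - c : ℝ) : ℂ) + I * s) = f (γ.σ + I * s - c) := fun s => by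
    push_cast; congr 1; ring
  have e3 : ∀ s : ℝ, f (((s - c : ℝ) : ℂ) + I * γ.η) = f (s + I * γ.η - c) := fun s => by
    push_cast; congr 1; ring
  simp only [e1] at a1
  simp only [e3] at a3
  simp only [e2] at f2
  refine ⟨⟨a1.1.2 f1, f2, a3.1.2 f3⟩, ?_⟩
  rw [← fv]
  simp only [Loop.integral, a1.2, a3.2, e2]

/-- `f` is holomorphic off the ray `(-∞, ρ]` and decays like `1 / u` to the left, away from it. -/
structure LinearDecay (ρ : ℝ) (f : ℂ → ℂ) : Prop where
  differentiableAt : ∀ u : ℂ, ρ < u.re ∨ u.im ≠ 0 → DifferentiableAt ℂ f u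
  decay : ∀ σ η η' : ℝ, 0 < η → ∃ M : ℝ, ∀ u : ℂ, u.re ≤ σ → η ≤ |u.im| → |u.im| ≤ η' →
    ‖f u‖ ≤ M / (1 + ‖u‖)

theorem one_add_norm_le {η : ℝ} (hη : 0 < η) (l : ℝ) {u : ℂ} (hu : η ≤ |u.im|) :
    1 + ‖u‖ ≤ (1 + (1 + |l|) / η) * ‖u + l‖ := by
  have h1 : η ≤ ‖u + l‖ := by
    have := abs_im_le_norm (u + l)
    simp only [add_im, ofReal_im, add_zero] at this
    exact hu.trans this
  have h2 : ‖u‖ ≤ ‖u + l‖ + |l| := by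
    have := norm_sub_le (u + l) l
    rwa [add_sub_cancel_right, norm_real, Real.norm_eq_abs] at this
  have h3 : 1 + |l| ≤ (1 + |l|) / η * ‖u + l‖ := by
    rw [div_mul_eq_mul_div, le_div_iff₀ hη]
    gcongr
  linarith

/-- At distance at least η from the real axis |u + l| is comparable to 1 + |u|, so the division
gains a full power. -/
theorem LinearDecay.div_add {ρ : ℝ} {f : ℂ → ℂ} (hf : LinearDecay ρ f) {l : ℝ} (hl : -l ≤ ρ) :
    QuadraticDecay ρ fun u => f u / (u + l) := by
  constructor
  · intro u hu
    refine (hf.differentiableAt u hu).div (by fun_prop) fun h => ?_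
    have hr : u.re = -l := by simpa [eq_neg_iff_add_eq_zero] using congrArg re h
    have hi : u.im = 0 := by simpa using congrArg im h
    rcases hu with hu | hu
    · linarith
    · exact hu hi
  · intro σ η η' hη
    obtain ⟨M, hM⟩ := hf.decay σ η η' hη
    refine ⟨|M| * (1 + (1 + |l|) / η), fun u h1 h2 h3 => ?_⟩
    have h4 := one_add_norm_le hη l h2
    have h5 : 0 < 1 + ‖u‖ := by positivity
    have h6 : 0 < ‖u + l‖ := by
      by_contra h
      have : ‖u + l‖ = 0 := le_antisymm (not_lt.1 h) (norm_nonneg _)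
      rw [this, mul_zero] at h4
      linarith
    rw [norm_div, div_le_div_iff₀ h6 (by positivity)]
    calc ‖f u‖ * (1 + ‖u‖ ^ 2) ≤ |M| / (1 + ‖u‖) * ((1 + ‖u‖) * (1 + ‖u‖)) := by
          gcongr
          · refine (hM u h1 h2 h3).trans ?_
            gcongr
            exact le_abs_self M
          · nlinarith [norm_nonneg u]
      _ = |M| * (1 + ‖u‖) := by field_simp
      _ ≤ |M| * ((1 + (1 + |l|) / η) * ‖u + l‖) := by gcongr
      _ = _ := by ring

/-- The two points approach the negative axis from above and from below, where the principal
logarithm jumps by 2πi. This limit serves as the winding number of the open loop. -/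
theorem tendsto_log_sub_log {y l : ℝ} (hy : 0 < y) :
    Tendsto (fun N : ℝ => log (-N + l + I * y) - log (-N + l - I * y)) atTop
      (𝓝 (2 * Real.pi * I)) := by
  have key : ∀ N : ℝ, l < N → log (-N + l + I * y) - log (-N + l - I * y) =
      2 * Real.pi * I + (log (1 - I * ((y / (N - l) : ℝ) : ℂ)) -
        log (1 + I * ((y / (N - l) : ℝ) : ℂ))) := by
    intro N hN
    have hX : 0 < N - l := sub_pos.2 hN
    have hX' : ((N - l : ℝ) : ℂ) ≠ 0 := ofReal_ne_zero.2 hX.ne'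
    have ht : 0 < y / (N - l) := by positivity
    have f1 : (-N + l + I * y : ℂ) = -(((N - l : ℝ) : ℂ) * (1 - I * ((y / (N - l) : ℝ) : ℂ))) := by
      push_cast at hX' ⊢
      field_simp
      ring
    have f2 : (-N + l - I * y : ℂ) = -(((N - l : ℝ) : ℂ) * (1 + I * ((y / (N - l) : ℝ) : ℂ))) := by
      push_cast at hX' ⊢
      field_simp
      ring
    rw [f1, f2]
    generalize y / (N - l) = t at ht
    have e1 : (1 - I * (t : ℂ)) ≠ 0 := fun h => by simpa using congrArg re h
    have e2 : (1 + I * (t : ℂ)) ≠ 0 := fun h => by simpa using congrArg re h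
    have i1 : (((N - l : ℝ) : ℂ) * (1 - I * (t : ℂ))).im < 0 := by
      rw [im_ofReal_mul]
      simpa using mul_pos hX ht
    have i2 : 0 < (((N - l : ℝ) : ℂ) * (1 + I * (t : ℂ))).im := by
      rw [im_ofReal_mul]
      simpa using mul_pos hX ht
    have g1 : log (-(((N - l : ℝ) : ℂ) * (1 - I * (t : ℂ)))) =
        log (((N - l : ℝ) : ℂ) * (1 - I * (t : ℂ))) + Real.pi * I := by
      rw [log, log, norm_neg, arg_neg_eq_arg_add_pi_of_im_neg i1]
      push_cast; ring
    have g2 : log (-(((N - l : ℝ) : ℂ) * (1 + I * (t : ℂ)))) =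
        log (((N - l : ℝ) : ℂ) * (1 + I * (t : ℂ))) - Real.pi * I := by
      rw [log, log, norm_neg, arg_neg_eq_arg_sub_pi_of_im_pos i2]
      push_cast; ring
    rw [g1, g2, log_ofReal_mul hX e1, log_ofReal_mul hX e2]
    ring
  have h0 : Tendsto (fun N : ℝ => ((y / (N - l) : ℝ) : ℂ)) atTop (𝓝 ((0 : ℝ) : ℂ)) :=
    (continuous_ofReal.tendsto 0).comp
      (tendsto_const_nhds.div_atTop (tendsto_atTop_add_const_right atTop (-l) tendsto_id))
  have h1 : Tendsto (fun N : ℝ => log (1 - I * ((y / (N - l) : ℝ) : ℂ))) atTop (𝓝 (log 1)) := by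
    refine Tendsto.clog ?_ one_mem_slitPlane
    simpa using (tendsto_const_nhds (x := (1 : ℂ))).sub (h0.const_mul I)
  have h2 : Tendsto (fun N : ℝ => log (1 + I * ((y / (N - l) : ℝ) : ℂ))) atTop (𝓝 (log 1)) := by
    refine Tendsto.clog ?_ one_mem_slitPlane
    simpa using (tendsto_const_nhds (x := (1 : ℂ))).add (h0.const_mul I)
  have h3 := (tendsto_const_nhds (x := (2 * Real.pi * I : ℂ))).add (h1.sub h2)
  rw [sub_self, add_zero] at h3
  refine h3.congr' ?_
  filter_upwards [eventually_gt_atTop l] with N hN using (key N hN).symm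

/-- The three sides stay in the plane slit along (-∞, -l], where log(u + l) is a primitive. -/
theorem Loop.truncated_one_div_add (γ : Loop) {l : ℝ} (hl : -l < γ.σ) (N : ℝ) :
    γ.truncated (fun u => 1 / (u + l)) N = log (-N + l + I * γ.η) - log (-N + l - I * γ.η) := by
  have hη := γ.η_pos
  have hh : ∀ y : ℝ, y ≠ 0 → ∫ s : ℝ in (-N)..γ.σ, (1 : ℂ) / (s + I * y + l) =
      log (γ.σ + I * y + l) - log (((-N : ℝ) : ℂ) + I * y + l) := by
    intro y hy
    refine intervalIntegral.integral_eq_sub_of_hasDerivAt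
      (f := fun s : ℝ => log (s + I * y + l)) (fun s _ => ?_) ?_
    · refine HasDerivAt.clog_real (((hasDerivAt_id s).ofReal_comp.add_const _).add_const _) ?_
      exact mem_slitPlane_iff.2 (Or.inr (by simpa using hy))
    · refine intervalIntegrable_horizontal (f := fun u => 1 / (u + l)) fun s _ => ?_
      refine DifferentiableAt.div (by fun_prop) (by fun_prop) fun h => hy ?_
      simpa using congrArg im h
  have hv : I * ∫ s : ℝ in (-γ.η)..γ.η, (1 : ℂ) / (γ.σ + I * s + l) =
      log (γ.σ + I * γ.η + l) - log (γ.σ + I * ((-γ.η : ℝ) : ℂ) + l) := by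
    rw [← intervalIntegral.integral_const_mul]
    refine intervalIntegral.integral_eq_sub_of_hasDerivAt
      (f := fun s : ℝ => log (γ.σ + I * s + l)) (fun s _ => ?_) ?_
    · have h1 : HasDerivAt (fun s : ℝ => (γ.σ + I * s + l : ℂ)) I s := by
        simpa using (((hasDerivAt_id s).ofReal_comp.const_mul I).const_add (γ.σ : ℂ)).add_const (l : ℂ)
      have := h1.clog_real (mem_slitPlane_iff.2 (Or.inl (by simp; linarith)))
      rwa [div_eq_mul_one_div] at this
    · refine IntervalIntegrable.const_mul ?_ I
      refine intervalIntegrable_vertical (f := fun u => 1 / (u + l)) fun s _ => ?_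
      refine DifferentiableAt.div (by fun_prop) (by fun_prop) fun h => ?_
      have : γ.σ + l = 0 := by simpa using congrArg re h
      linarith
  have h1 := hh γ.η hη.ne'
  have h2 := hh (-γ.η) (neg_ne_zero.2 hη.ne')
  simp only [ofReal_neg, mul_neg, ← sub_eq_add_neg] at h1 h2 hv
  rw [Loop.truncated, h1, h2, hv, add_right_comm (-N : ℂ), sub_add_eq_add_sub (-N : ℂ)]
  ring

/-- The residue theorem for a single pole, by splitting W(u)/(u+l) into the entire difference
quotient of W at -l and W(-l)/(u+l). For the former the truncated loop closes up to a far vertical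
segment that tends to 0; the latter contributes 2πi W(-l). -/
theorem hasLoopIntegral_div_add {W : ℂ → ℂ} (hW : Differentiable ℂ W)
    (hdec : ∀ σ η : ℝ, ∃ M : ℝ, ∀ u : ℂ, u.re ≤ σ → |u.im| ≤ η → ‖W u‖ ≤ M / (1 + ‖u‖)) (l : ℝ) :
    HasLoopIntegral (-l) (fun u => W u / (u + l)) (W (-l)) := by
  intro γ hγ
  have hη := γ.η_pos
  have hlin : LinearDecay (-l) W := ⟨fun u _ => hW u, fun σ _ η' _ => by
    obtain ⟨M, hM⟩ := hdec σ η'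
    exact ⟨M, fun u h1 _ h3 => hM u h1 h3⟩⟩
  have hc := (hlin.div_add le_rfl).converges hγ
  refine ⟨hc, ?_⟩
  have hg : Differentiable ℂ (dslope W (-l)) := by
    have := (differentiableOn_dslope (f := W) (c := (-l : ℂ)) univ_mem).2 hW.differentiableOn
    exact differentiableOn_univ.1 this
  have hne : ∀ u : ℂ, u.im ≠ 0 ∨ u.re = γ.σ → u ≠ -l := by
    rintro u hu rfl
    rcases hu with hu | hu
    · simp at hu
    · simp at hu; linarith
  have hgu : ∀ u : ℂ, u ≠ -l → W u / (u + l) = dslope W (-l) u + W (-l) * (1 / (u + l)) := by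
    intro u hu
    rw [dslope_of_ne _ hu, slope_def_field, sub_neg_eq_add]
    ring
  have hgi : ∀ u : ℂ, u.im ≠ 0 ∨ u.re = γ.σ → DifferentiableAt ℂ (fun u => W (-l) * (1 / (u + l))) u := by
    intro u hu
    refine DifferentiableAt.const_mul (DifferentiableAt.div (by fun_prop) (by fun_prop) fun h => ?_) _
    exact hne u hu (eq_neg_of_add_eq_zero_left h)
  have hsplit : ∀ N, γ.truncated (fun u => W u / (u + l)) N =
      γ.truncated (dslope W (-l)) N + W (-l) * γ.truncated (fun u => 1 / (u + l)) N := by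
    intro N
    have a1 : ∫ s : ℝ in (-N)..γ.σ, W (s - I * γ.η) / (s - I * γ.η + l) =
        (∫ s : ℝ in (-N)..γ.σ, dslope W (-l) (s - I * γ.η)) +
          W (-l) * ∫ s : ℝ in (-N)..γ.σ, 1 / (s - I * γ.η + l) := by
      rw [← intervalIntegral.integral_const_mul, ← intervalIntegral.integral_add]
      · exact intervalIntegral.integral_congr fun s _ => hgu _ (hne _ (Or.inl (by simpa using hη.ne')))
      · exact Continuous.intervalIntegrable (hg.continuous.comp (by fun_prop)) _ _
      · have := intervalIntegrable_horizontal (x₁ := -N) (x₂ := γ.σ) (y := -γ.η)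
          (fun s _ => hgi (s + I * ((-γ.η : ℝ) : ℂ)) (Or.inl (by simpa using hη.ne')))
        simpa [← sub_eq_add_neg] using this
    have a2 : ∫ s : ℝ in (-γ.η)..γ.η, W (γ.σ + I * s) / (γ.σ + I * s + l) =
        (∫ s : ℝ in (-γ.η)..γ.η, dslope W (-l) (γ.σ + I * s)) +
          W (-l) * ∫ s : ℝ in (-γ.η)..γ.η, 1 / (γ.σ + I * s + l) := by
      rw [← intervalIntegral.integral_const_mul, ← intervalIntegral.integral_add]
      · exact intervalIntegral.integral_congr fun s _ => hgu _ (hne _ (Or.inr (by simp)))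
      · exact Continuous.intervalIntegrable (hg.continuous.comp (by fun_prop)) _ _
      · exact intervalIntegrable_vertical (fun s _ => hgi _ (Or.inr (by simp)))
    have a3 : ∫ s : ℝ in (-N)..γ.σ, W (s + I * γ.η) / (s + I * γ.η + l) =
        (∫ s : ℝ in (-N)..γ.σ, dslope W (-l) (s + I * γ.η)) +
          W (-l) * ∫ s : ℝ in (-N)..γ.σ, 1 / (s + I * γ.η + l) := by
      rw [← intervalIntegral.integral_const_mul, ← intervalIntegral.integral_add]
      · exact intervalIntegral.integral_congr fun s _ => hgu _ (hne _ (Or.inl (by simpa using hη.ne')))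
      · exact Continuous.intervalIntegrable (hg.continuous.comp (by fun_prop)) _ _
      · exact intervalIntegrable_horizontal
          (fun s _ => hgi _ (Or.inl (by simpa using hη.ne')))
    simp only [Loop.truncated, a1, a2, a3]
    ring
  have hg0 : Tendsto (γ.truncated (dslope W (-l))) atTop (𝓝 0) := by
    have e : ∀ N, γ.truncated (dslope W (-l)) N =
        I * ∫ s : ℝ in (-γ.η)..γ.η, dslope W (-l) (((-N : ℝ) : ℂ) + I * s) := by
      intro N
      have := rect_integral_eq_zero (f := dslope W (-l)) (x₁ := -N) (x₂ := γ.σ) (y₁ := -γ.η)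
        (y₂ := γ.η) fun u _ _ => hg u
      simp only [Loop.truncated]
      simp only [ofReal_neg, mul_neg, ← sub_eq_add_neg] at this ⊢
      linear_combination this
    rw [funext e]
    obtain ⟨M, hM⟩ := hdec 0 γ.η
    have := tendsto_vertical (f := dslope W (-l)) (y₁ := -γ.η) (y₂ := γ.η)
      (M := (|M| + ‖W (-l)‖) * 2) ?_
    · simpa using this.const_mul I
    filter_upwards [eventually_gt_atTop 0, eventually_gt_atTop (2 * |l|)] with N hN hN2 s hs
    have hs' : |s| ≤ γ.η := by
      have := uIoc_subset_uIcc hs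
      rw [uIcc_of_le (by linarith)] at this
      exact abs_le.2 this
    have h1 : N / 2 ≤ ‖(-N + I * s + l : ℂ)‖ := by
      have := le_norm_neg_add (N - l) s
      have e : (-((N - l : ℝ) : ℂ) + I * s) = -N + I * s + l := by push_cast; ring
      rw [e] at this
      linarith [le_abs_self l]
    have hnl : (-N + I * s : ℂ) ≠ -l := by
      intro h
      rw [h, neg_add_cancel, norm_zero] at h1
      linarith
    have h2 : ‖W (-N + I * s)‖ ≤ |M| := by
      refine (hM (-N + I * s) (by simpa using hN.le) (by simpa using hs')).trans ?_
      rw [div_le_iff₀ (by positivity)]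
      nlinarith [le_abs_self M, abs_nonneg M, norm_nonneg (-N + I * s : ℂ)]
    rw [dslope_of_ne _ hnl, slope_def_field, sub_neg_eq_add, norm_div, div_le_div_iff₀ (by linarith) hN]
    have h3 := norm_sub_le (W (-N + I * s)) (W (-l))
    have h4 : 0 ≤ |M| + ‖W (-l)‖ := by positivity
    calc _ ≤ (|M| + ‖W (-l)‖) * N := by gcongr; linarith
      _ = (|M| + ‖W (-l)‖) * 2 * (N / 2) := by ring
      _ ≤ _ := by gcongr
  have t1 := hc.tendsto_truncated
  have t2 : Tendsto (γ.truncated fun u => W u / (u + l)) atTop (𝓝 (0 + W (-l) * (2 * Real.pi * I))) := by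
    rw [funext hsplit]
    refine hg0.add (Tendsto.const_mul _ ?_)
    exact (tendsto_log_sub_log hη).congr fun N => (γ.truncated_one_div_add hγ N).symm
  have h5 := tendsto_nhds_unique t1 t2
  have h0 : (2 * Real.pi * I : ℂ) ≠ 0 := two_pi_I_ne_zero
  refine mul_left_cancel₀ h0 ?_
  rw [h5]; ring

theorem HasLoopIntegral.congr {ρ : ℝ} {f g : ℂ → ℂ} {v : ℂ} (hf : HasLoopIntegral ρ f v)
    (h : ∀ u : ℂ, ρ < u.re ∨ u.im ≠ 0 → f u = g u) : HasLoopIntegral ρ g v := by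
  intro γ hγ
  have hη := γ.η_pos
  obtain ⟨⟨f1, f2, f3⟩, fv⟩ := hf γ hγ
  have e1 : ∀ s : ℝ, f (s - I * γ.η) = g (s - I * γ.η) := fun s => h _ (Or.inr (by simpa using hη.ne'))
  have e2 : ∀ s : ℝ, f (γ.σ + I * s) = g (γ.σ + I * s) := fun s => h _ (Or.inl (by simpa using hγ))
  have e3 : ∀ s : ℝ, f (s + I * γ.η) = g (s + I * γ.η) := fun s => h _ (Or.inr (by simpa using hη.ne'))
  simp only [e1] at f1
  simp only [e2] at f2
  simp only [e3] at f3
  refine ⟨⟨f1, f2, f3⟩, ?_⟩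
  rw [← fv]
  simp only [Loop.integral, e1, e2, e3]

/-- Gamma-type functions obey a recurrence that makes each unit step to the left shrink them,
eventually by the factor 1/e. Compactness bounds W in a starting box, and induction on the number of
steps gives exponential decay. The set T of imaginary parts allows poles on the real axis to be
avoided. -/
theorem exists_norm_le_mul_exp {W : ℂ → ℂ} {σ ρ : ℝ} {T : Set ℝ} (hT : IsCompact T)
    (hc : ∀ u : ℂ, u.re ≤ σ → u.im ∈ T → ContinuousAt W u)
    (hρ : ∀ u : ℂ, u.re ≤ ρ → u.im ∈ T → ‖W u‖ ≤ Real.exp (-1) * ‖W (u + 1)‖) :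
    ∃ M : ℝ, ∀ u : ℂ, u.re ≤ σ → u.im ∈ T → ‖W u‖ ≤ M * Real.exp u.re := by
  -- With ρ' ≤ σ - 1, the point u + 1 still satisfies Re (u + 1) ≤ σ whenever Re u ≤ ρ'.
  set ρ' := min ρ (σ - 1) with hρ'
  have hK : IsCompact (Icc ρ' σ ×ℂ T) := isCompact_Icc.reProdIm hT
  obtain ⟨M, hM⟩ := hK.exists_bound_of_continuousOn (f := W) fun u hu =>
    (hc u hu.1.2 hu.2).continuousWithinAt
  refine ⟨|M| * Real.exp (-ρ'), ?_⟩
  have key : ∀ n : ℕ, ∀ u : ℂ, ρ' - n ≤ u.re → u.re ≤ σ → u.im ∈ T →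
      ‖W u‖ ≤ |M| * Real.exp (-ρ') * Real.exp u.re := by
    intro n
    induction n with
    | zero =>
      intro u h1 h2 h3
      rw [Nat.cast_zero, sub_zero] at h1
      refine (hM u ⟨⟨h1, h2⟩, h3⟩).trans ((le_abs_self M).trans ?_)
      rw [mul_assoc, ← Real.exp_add]
      exact le_mul_of_one_le_right (abs_nonneg M) (Real.one_le_exp (by linarith))
    | succ n ih =>
      intro u h1 h2 h3
      push_cast at h1
      rcases le_or_gt u.re ρ' with h4 | h4
      · have h5 := ih (u + 1) (by simp; linarith)
          (by simpa using (by linarith [min_le_right ρ (σ - 1)] : u.re + 1 ≤ σ)) (by simpa using h3)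
        refine (hρ u (h4.trans (min_le_left _ _)) h3).trans ?_
        refine (mul_le_mul_of_nonneg_left h5 (Real.exp_pos _).le).trans (le_of_eq ?_)
        rw [add_re, one_re, Real.exp_add, Real.exp_neg 1]
        field_simp
      · exact ih u (by linarith [(Nat.cast_nonneg n : (0 : ℝ) ≤ n)]) h2 h3
  intro u h1 h2
  obtain ⟨n, hn⟩ := exists_nat_ge (ρ' - u.re)
  exact key n u (by linarith) h1 h2

theorem exists_norm_le_div_sq_of_exp {W : ℂ → ℂ} {σ η M : ℝ} {T : Set ℝ} (hT : ∀ y ∈ T, |y| ≤ η)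
    (hM : ∀ u : ℂ, u.re ≤ σ → u.im ∈ T → ‖W u‖ ≤ M * Real.exp u.re) :
    ∃ M' : ℝ, 0 ≤ M' ∧ ∀ u : ℂ, u.re ≤ σ → u.im ∈ T → ‖W u‖ ≤ M' / (1 + ‖u‖) ^ 2 := by
  refine ⟨|M| * (2 * ((1 + η ^ 2 + σ ^ 2) * Real.exp |σ| + 2)), by positivity, fun u h1 h2 => ?_⟩
  rw [le_div_iff₀ (by positivity)]
  have h3 : ‖u‖ ^ 2 ≤ u.re ^ 2 + η ^ 2 := by
    rw [← normSq_eq_norm_sq, normSq_apply]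
    have := hT _ h2
    nlinarith [sq_abs u.im, abs_nonneg u.im]
  have h4 : (1 + ‖u‖) ^ 2 ≤ 2 * (1 + η ^ 2 + u.re ^ 2) := by nlinarith [sq_nonneg (1 - ‖u‖)]
  have h5 : Real.exp u.re ≤ Real.exp |σ| := Real.exp_le_exp.2 (h1.trans (le_abs_self σ))
  have h6 : u.re ^ 2 * Real.exp u.re ≤ σ ^ 2 * Real.exp |σ| + 2 := by
    rcases le_total u.re 0 with h | h
    · have h7 := Real.quadratic_le_exp_of_nonneg (x := -u.re) (by linarith)
      have h8 : Real.exp (-u.re) * Real.exp u.re = 1 := by rw [← Real.exp_add]; simp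
      have h9 := Real.exp_pos u.re
      have : u.re ^ 2 ≤ 2 * Real.exp (-u.re) := by nlinarith
      have h10 := mul_le_mul_of_nonneg_right this h9.le
      have : 0 ≤ σ ^ 2 * Real.exp |σ| := by positivity
      nlinarith
    · have : u.re ^ 2 * Real.exp u.re ≤ σ ^ 2 * Real.exp |σ| := by gcongr
      linarith
  have h7 : Real.exp u.re * (1 + ‖u‖) ^ 2 ≤ 2 * ((1 + η ^ 2 + σ ^ 2) * Real.exp |σ| + 2) := by
    have h8 : Real.exp u.re * (1 + ‖u‖) ^ 2 ≤ Real.exp u.re * (2 * (1 + η ^ 2 + u.re ^ 2)) := by gcongr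
    have h9 : (1 + η ^ 2) * Real.exp u.re ≤ (1 + η ^ 2) * Real.exp |σ| := by gcongr
    nlinarith
  calc ‖W u‖ * (1 + ‖u‖) ^ 2 ≤ (|M| * Real.exp u.re) * (1 + ‖u‖) ^ 2 := by
        gcongr
        refine (hM u h1 h2).trans ?_
        gcongr
        exact le_abs_self M
    _ = |M| * (Real.exp u.re * (1 + ‖u‖) ^ 2) := by ring
    _ ≤ _ := by gcongr

theorem norm_add_ofReal_le (u : ℂ) (l : ℝ) : ‖u + l‖ ≤ (1 + |l|) * (1 + ‖u‖) := by
  have := norm_add_le u l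
  rw [norm_real, Real.norm_eq_abs] at this
  nlinarith [norm_nonneg u, abs_nonneg l]

theorem hasLoopIntegral_of_sq_decay {W : ℂ → ℂ} (hW : Differentiable ℂ W)
    (hdec : ∀ σ η : ℝ, ∃ M : ℝ, 0 ≤ M ∧ ∀ u : ℂ, u.re ≤ σ → |u.im| ≤ η → ‖W u‖ ≤ M / (1 + ‖u‖) ^ 2)
    (l : ℝ) :
    HasLoopIntegral l W 0 ∧ HasLoopIntegral (-l) (fun u => W u / (u + l)) (W (-l)) := by
  constructor
  -- An entire W has loop integral 0: write it as W(u)(u - l)/(u - l), whose residue at the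
  -- artificial pole l vanishes.
  · have h := hasLoopIntegral_div_add (W := fun u => W u * (u + ((-l : ℝ) : ℂ))) (by fun_prop) ?_ (-l)
    · rw [neg_neg] at h
      have hv : W (-((-l : ℝ) : ℂ)) * (-((-l : ℝ) : ℂ) + ((-l : ℝ) : ℂ)) = 0 := by simp
      rw [hv] at h
      refine h.congr fun u hu => mul_div_cancel_right₀ _ fun h0 => ?_
      rcases hu with hu | hu
      · have : u.re + -l = 0 := by simpa using congrArg re h0
        linarith
      · exact hu (by simpa using congrArg im h0)
    · intro σ η
      obtain ⟨M, hM0, hM⟩ := hdec σ η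
      refine ⟨M * (1 + |-l|), fun u h1 h2 => ?_⟩
      rw [norm_mul]
      have h3 := norm_add_ofReal_le u (-l)
      have h4 : 0 < 1 + ‖u‖ := by positivity
      calc _ ≤ M / (1 + ‖u‖) ^ 2 * ((1 + |-l|) * (1 + ‖u‖)) := by gcongr; exact hM u h1 h2
        _ = _ := by field_simp
  · refine hasLoopIntegral_div_add hW (fun σ η => ?_) l
    obtain ⟨M, hM0, hM⟩ := hdec σ η
    refine ⟨M, fun u h1 h2 => (hM u h1 h2).trans ?_⟩
    have : 1 + ‖u‖ ≤ (1 + ‖u‖) ^ 2 := by nlinarith [norm_nonneg u]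
    gcongr

/-! ### The reciprocal Gamma function -/

/-- `z^{-u} / Γ(c + 1 - u)`. -/
noncomputable def recipGammaKernel (c z : ℝ) (u : ℂ) : ℂ := (z : ℂ) ^ (-u) * (Gamma (c + 1 - u))⁻¹

theorem recipGammaKernel_differentiable (c : ℝ) {z : ℝ} (hz : 0 < z) :
    Differentiable ℂ (recipGammaKernel c z) := by
  intro u
  have hz' : (z : ℂ) ≠ 0 := ofReal_ne_zero.2 hz.ne'
  refine DifferentiableAt.mul ?_ ?_
  · exact DifferentiableAt.const_cpow (by fun_prop) (Or.inl hz')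
  · exact (differentiable_one_div_Gamma _).comp (f := fun u : ℂ => (c + 1 - u : ℂ)) u (by fun_prop)

theorem recipGammaKernel_add_one (c : ℝ) {z : ℝ} (hz : 0 < z) (u : ℂ) :
    z * recipGammaKernel c z (u + 1) = (c - u) * recipGammaKernel c z u := by
  have hz' : (z : ℂ) ≠ 0 := ofReal_ne_zero.2 hz.ne'
  have h1 := one_div_Gamma_eq_self_mul_one_div_Gamma_add_one ((c : ℂ) - u)
  rw [recipGammaKernel, recipGammaKernel, show (c : ℂ) + 1 - (u + 1) = c - u by ring, h1,
    show (c : ℂ) - u + 1 = c + 1 - u by ring, neg_add, cpow_add _ _ hz', cpow_neg_one]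
  field_simp

theorem recipGammaKernel_decay (c : ℝ) {z : ℝ} (hz : 0 < z) (σ η : ℝ) :
    ∃ M : ℝ, 0 ≤ M ∧ ∀ u : ℂ, u.re ≤ σ → |u.im| ≤ η → ‖recipGammaKernel c z u‖ ≤ M / (1 + ‖u‖) ^ 2 := by
  have hT : ∀ y ∈ Icc (-η) η, |y| ≤ η := fun y hy => abs_le.2 hy
  have hstep : ∀ u : ℂ, u.re ≤ c - z * Real.exp 1 → u.im ∈ Icc (-η) η →
      ‖recipGammaKernel c z u‖ ≤ Real.exp (-1) * ‖recipGammaKernel c z (u + 1)‖ := by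
    intro u h1 _
    have h2 := congrArg norm (recipGammaKernel_add_one c hz u)
    rw [norm_mul, norm_mul, norm_real, Real.norm_eq_abs, abs_of_pos hz] at h2
    -- Far to the left the factor c - u of the recurrence exceeds z e, which yields the contraction
    -- by 1/e.
    have h3 : z * Real.exp 1 ≤ ‖(c : ℂ) - u‖ := by
      have := re_le_norm ((c : ℂ) - u)
      rw [sub_re, ofReal_re] at this
      linarith
    have h4 : z * Real.exp 1 * ‖recipGammaKernel c z u‖ ≤ z * ‖recipGammaKernel c z (u + 1)‖ := by
      rw [h2]; gcongr
    rw [Real.exp_neg, inv_mul_eq_div, le_div_iff₀ (Real.exp_pos 1)]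
    rw [mul_assoc] at h4
    linarith [le_of_mul_le_mul_left h4 hz]
  obtain ⟨M, hM⟩ := exists_norm_le_mul_exp (W := recipGammaKernel c z) (σ := σ) isCompact_Icc
    (fun u _ _ => (recipGammaKernel_differentiable c hz u).continuousAt) hstep
  obtain ⟨M', h0, hM'⟩ := exists_norm_le_div_sq_of_exp hT hM
  exact ⟨M', h0, fun u h1 h2 => hM' u h1 (abs_le.1 h2)⟩

/-! ### The upper incomplete Gamma function -/

/-- `∫_1^∞ s^{w-1} e^{-zs} ds = z^{-w} Γ(w, z)`. -/
noncomputable def upperGamma (z : ℝ) (w : ℂ) : ℂ :=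
  ∫ s : ℝ in Ioi 1, (s : ℂ) ^ (w - 1) * cexp (-(z * s))

theorem integrableOn_rpow_mul_exp_Ioi_one {z : ℝ} (hz : 0 < z) (p : ℝ) :
    IntegrableOn (fun s : ℝ => s ^ p * Real.exp (-(z * s))) (Ioi 1) := by
  have h := (integrableOn_rpow_mul_exp_neg_mul_rpow (p := 1) (s := |p|) (b := z)
    (by linarith [abs_nonneg p]) one_pos hz).mono_set (Ioi_subset_Ioi zero_le_one)
  refine Integrable.mono' h ?_ ?_
  · refine ContinuousOn.aestronglyMeasurable (fun s hs => ?_) measurableSet_Ioi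
    have : s ≠ 0 := (zero_lt_one.trans hs).ne'
    exact ((Real.continuousAt_rpow_const s p (Or.inl this)).mul (by fun_prop)).continuousWithinAt
  · refine (ae_restrict_iff' measurableSet_Ioi).2 (Eventually.of_forall fun s hs => ?_)
    have hs0 : 0 < s := zero_lt_one.trans hs
    rw [Real.norm_of_nonneg (by positivity), Real.rpow_one, neg_mul]
    gcongr
    · exact le_of_lt hs
    · exact le_abs_self p

theorem norm_cpow_mul_cexp {s : ℝ} (hs : 0 < s) (z : ℝ) (w : ℂ) :
    ‖(s : ℂ) ^ (w - 1) * cexp (-(z * s))‖ = s ^ (w.re - 1) * Real.exp (-(z * s)) := by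
  rw [norm_mul, norm_cpow_eq_rpow_re_of_pos hs, norm_exp]
  simp

theorem integrableOn_cpow_mul_cexp_Ioi_one {z : ℝ} (hz : 0 < z) (w : ℂ) :
    IntegrableOn (fun s : ℝ => (s : ℂ) ^ (w - 1) * cexp (-(z * s))) (Ioi 1) := by
  refine Integrable.mono' (integrableOn_rpow_mul_exp_Ioi_one hz (w.re - 1)) ?_ ?_
  · refine ContinuousOn.aestronglyMeasurable (fun s hs => ?_) measurableSet_Ioi
    have : 0 < s := zero_lt_one.trans hs
    exact ((continuousAt_ofReal_cpow_const s _ (Or.inr this.ne')).mul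
      (by fun_prop)).continuousWithinAt
  · exact (ae_restrict_iff' measurableSet_Ioi).2 (Eventually.of_forall fun s hs =>
      (norm_cpow_mul_cexp (zero_lt_one.trans hs) z w).le)

theorem norm_upperGamma_le {z : ℝ} (hz : 0 < z) {σ : ℝ} {w : ℂ} (hw : w.re ≤ σ) :
    ‖upperGamma z w‖ ≤ ∫ s : ℝ in Ioi 1, s ^ (σ - 1) * Real.exp (-(z * s)) := by
  refine norm_integral_le_of_norm_le (integrableOn_rpow_mul_exp_Ioi_one hz _) ?_
  refine (ae_restrict_iff' measurableSet_Ioi).2 (Eventually.of_forall fun s hs => ?_)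
  rw [norm_cpow_mul_cexp (zero_lt_one.trans hs)]
  have : (1 : ℝ) ≤ s := le_of_lt hs
  gcongr

/-- Integration by parts: s^w e^{-zs} is differentiated and integrated over (1, ∞). -/
theorem upperGamma_add_one {z : ℝ} (hz : 0 < z) (w : ℂ) :
    z * upperGamma z (w + 1) = cexp (-z) + w * upperGamma z w := by
  have hd : ∀ s ∈ Ici (1 : ℝ), HasDerivAt (fun s : ℝ => (s : ℂ) ^ w * cexp (-(z * s)))
      (w * ((s : ℂ) ^ (w - 1) * cexp (-(z * s))) - z * ((s : ℂ) ^ (w + 1 - 1) * cexp (-(z * s)))) s := by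
    intro s hs
    have hs0 : 0 < s := zero_lt_one.trans_le hs
    have h1 : HasDerivAt (fun s : ℝ => (s : ℂ) ^ w) (w * (s : ℂ) ^ (w - 1)) s := by
      have := (hasDerivAt_id (s : ℂ)).cpow_const (c := w) (Or.inl (by simpa using hs0))
      simpa using this.comp_ofReal
    have h2 : HasDerivAt (fun s : ℝ => cexp (-(z * s))) (cexp (-(z * s)) * -(z * 1)) s :=
      (((hasDerivAt_id s).ofReal_comp.const_mul (z : ℂ)).neg).cexp
    have := h1.mul h2
    convert! this using 1
    rw [add_sub_cancel_right]; ring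
  have hint : IntegrableOn (fun s : ℝ => w * ((s : ℂ) ^ (w - 1) * cexp (-(z * s))) -
      z * ((s : ℂ) ^ (w + 1 - 1) * cexp (-(z * s)))) (Ioi 1) :=
    ((integrableOn_cpow_mul_cexp_Ioi_one hz w).const_mul w).sub
      ((integrableOn_cpow_mul_cexp_Ioi_one hz (w + 1)).const_mul (z : ℂ))
  have hlim : Tendsto (fun s : ℝ => (s : ℂ) ^ w * cexp (-(z * s))) atTop (𝓝 0) := by
    rw [tendsto_zero_iff_norm_tendsto_zero]
    refine (tendsto_rpow_mul_exp_neg_mul_atTop_nhds_zero w.re z hz).congr' ?_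
    filter_upwards [eventually_gt_atTop 0] with s hs
    have := norm_cpow_mul_cexp hs z (w + 1)
    rw [add_sub_cancel_right, add_re, one_re, add_sub_cancel_right] at this
    rw [this, neg_mul]
  have := integral_Ioi_of_hasDerivAt_of_tendsto' hd hint hlim
  rw [integral_sub ((integrableOn_cpow_mul_cexp_Ioi_one hz w).const_mul w)
    ((integrableOn_cpow_mul_cexp_Ioi_one hz (w + 1)).const_mul (z : ℂ)), integral_const_mul,
    integral_const_mul] at this
  simp only [ofReal_one, one_cpow, one_mul, mul_one] at this
  rw [upperGamma, upperGamma]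
  linear_combination -this

theorem upperGamma_differentiable {z : ℝ} (hz : 0 < z) : Differentiable ℂ (upperGamma z) := by
  -- As a Mellin transform of a function that vanishes on (0, 1], it is entire: there is no
  -- singularity at the origin to limit the strip of holomorphy.
  have e : upperGamma z = mellin ((Ioi (1 : ℝ)).indicator fun s : ℝ => cexp (-(z * s))) := by
    funext w
    rw [mellin, upperGamma]
    have : ∀ s : ℝ, (s : ℂ) ^ (w - 1) • (Ioi (1 : ℝ)).indicator (fun s : ℝ => cexp (-(z * s))) s =
        (Ioi (1 : ℝ)).indicator (fun s : ℝ => (s : ℂ) ^ (w - 1) * cexp (-(z * s))) s := by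
      intro s
      by_cases hs : s ∈ Ioi (1 : ℝ) <;> simp [hs]
    simp only [this]
    rw [setIntegral_indicator measurableSet_Ioi, Ioi_inter_Ioi, sup_eq_right.2 zero_le_one]
  rw [e]
  intro w
  refine mellin_differentiableAt_of_isBigO_rpow_exp (a := z) (b := w.re - 1) hz ?_ ?_ ?_ (by linarith)
  · exact ((Continuous.locallyIntegrable (by fun_prop)).indicator
      measurableSet_Ioi).locallyIntegrableOn _
  · refine Asymptotics.IsBigO.of_bound 1 (Eventually.of_forall fun s => ?_)
    by_cases hs : s ∈ Ioi (1 : ℝ)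
    · rw [indicator_of_mem hs, norm_exp]; simp
    · rw [indicator_of_notMem hs, norm_zero]; positivity
  · refine Asymptotics.IsBigO.of_bound 1 ?_
    filter_upwards [Ioo_mem_nhdsGT (zero_lt_one' ℝ)] with s hs
    rw [indicator_of_notMem (by simpa using hs.2.le), norm_zero]; positivity

theorem upperGamma_decay {z : ℝ} (hz : 0 < z) (σ : ℝ) :
    ∃ M : ℝ, ∀ w : ℂ, w.re ≤ σ → ‖upperGamma z w‖ ≤ M / (1 + ‖w‖) := by
  refine ⟨(∫ s : ℝ in Ioi 1, s ^ (σ - 1) * Real.exp (-(z * s))) +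
    (z * (∫ s : ℝ in Ioi 1, s ^ (σ + 1 - 1) * Real.exp (-(z * s))) + 1), fun w hw => ?_⟩
  rw [le_div_iff₀ (by positivity), mul_add, mul_one]
  have h1 := norm_upperGamma_le hz hw
  have h2 := norm_upperGamma_le hz (w := w + 1) (σ := σ + 1) (by simpa using hw)
  -- The integral itself gives only boundedness in a left half-plane; solving the recurrence for w
  -- times the function gains the power of w.
  have h3 : w * upperGamma z w = z * upperGamma z (w + 1) - cexp (-z) := by
    rw [upperGamma_add_one hz]; ring
  have h4 := norm_sub_le (z * upperGamma z (w + 1)) (cexp (-z))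
  rw [← h3, norm_mul, norm_mul, norm_exp, norm_real, Real.norm_of_nonneg hz.le] at h4
  have h5 : Real.exp (-(z : ℂ)).re ≤ 1 := by
    rw [neg_re, ofReal_re]; exact Real.exp_le_one_iff.2 (by linarith)
  have h6 := mul_le_mul_of_nonneg_left h2 hz.le
  linarith

/-! ### The Gamma function -/

/-- `Γ(u) z^{-u}`. -/
noncomputable def gammaKernel (z : ℝ) (u : ℂ) : ℂ := Gamma u * (z : ℂ) ^ (-u)

theorem ne_neg_nat_of_pos_or_im {u : ℂ} (hu : 0 < u.re ∨ u.im ≠ 0) (m : ℕ) : u ≠ -m := by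
  rintro rfl
  rcases hu with hu | hu
  · simp at hu; linarith [(Nat.cast_nonneg m : (0 : ℝ) ≤ m)]
  · simp at hu

theorem gammaKernel_differentiableAt {z : ℝ} (hz : 0 < z) (u : ℂ) (hu : 0 < u.re ∨ u.im ≠ 0) :
    DifferentiableAt ℂ (gammaKernel z) u := by
  have hz' : (z : ℂ) ≠ 0 := ofReal_ne_zero.2 hz.ne'
  refine (differentiableAt_Gamma u (ne_neg_nat_of_pos_or_im hu)).mul ?_
  exact DifferentiableAt.const_cpow (by fun_prop) (Or.inl hz')

theorem gammaKernel_add_one {z : ℝ} (hz : 0 < z) {u : ℂ} (hu : u ≠ 0) :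
    z * gammaKernel z (u + 1) = u * gammaKernel z u := by
  have hz' : (z : ℂ) ≠ 0 := ofReal_ne_zero.2 hz.ne'
  rw [gammaKernel, gammaKernel, Gamma_add_one u hu, neg_add, cpow_add _ _ hz', cpow_neg_one]
  field_simp

theorem gammaKernel_decay {z : ℝ} (hz : 0 < z) (σ η η' : ℝ) (hη : 0 < η) :
    ∃ M : ℝ, 0 ≤ M ∧ ∀ u : ℂ, u.re ≤ σ → η ≤ |u.im| → |u.im| ≤ η' →
      ‖gammaKernel z u‖ ≤ M / (1 + ‖u‖) ^ 2 := by
  -- The imaginary parts are kept away from 0, where Γ has its poles.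
  set T : Set ℝ := Icc (-η') η' ∩ {y | η ≤ |y|} with hTdef
  have hT : IsCompact T := isCompact_Icc.inter_right (isClosed_le continuous_const continuous_abs)
  have hT0 : ∀ u : ℂ, u.im ∈ T → u.im ≠ 0 := fun u hu h => by
    have := hu.2
    rw [h] at this
    exact absurd this (by simpa using hη)
  have hstep : ∀ u : ℂ, u.re ≤ -(z * Real.exp 1) → u.im ∈ T →
      ‖gammaKernel z u‖ ≤ Real.exp (-1) * ‖gammaKernel z (u + 1)‖ := by
    intro u h1 hu
    have hu0 : u ≠ 0 := fun h => hT0 u hu (by rw [h, zero_im])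
    have h2 := congrArg norm (gammaKernel_add_one hz hu0)
    rw [norm_mul, norm_mul, norm_real, Real.norm_eq_abs, abs_of_pos hz] at h2
    have h3 : z * Real.exp 1 ≤ ‖u‖ := by
      have := abs_re_le_norm u
      linarith [neg_le_abs u.re]
    have h4 : z * Real.exp 1 * ‖gammaKernel z u‖ ≤ z * ‖gammaKernel z (u + 1)‖ := by
      rw [h2]; gcongr
    rw [Real.exp_neg, inv_mul_eq_div, le_div_iff₀ (Real.exp_pos 1)]
    rw [mul_assoc] at h4
    linarith [le_of_mul_le_mul_left h4 hz]
  obtain ⟨M, hM⟩ := exists_norm_le_mul_exp (W := gammaKernel z) (σ := σ) hT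
    (fun u _ hu => (gammaKernel_differentiableAt hz u (Or.inr (hT0 u hu))).continuousAt) hstep
  obtain ⟨M', h0, hM'⟩ := exists_norm_le_div_sq_of_exp (fun y hy => abs_le.2 hy.1) hM
  exact ⟨M', h0, fun u h1 h2 h3 => hM' u h1 ⟨abs_le.1 h3, h2⟩⟩

/-- `Γ(w) z^{-w} - z^{-w} Γ(w, z)`, the continuation of `∫_0^1 s^{w-1} e^{-zs} ds`. -/
noncomputable def lowerGamma (z : ℝ) (w : ℂ) : ℂ := gammaKernel z w - upperGamma z w

theorem lowerGamma_linearDecay {z : ℝ} (hz : 0 < z) : LinearDecay 0 (lowerGamma z) := by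
  constructor
  · exact fun u hu => (gammaKernel_differentiableAt hz u hu).sub (upperGamma_differentiable hz u)
  · intro σ η η' hη
    obtain ⟨M, hM0, hM⟩ := gammaKernel_decay hz σ η η' hη
    obtain ⟨M', hM'⟩ := upperGamma_decay hz σ
    refine ⟨M + M', fun u h1 h2 h3 => ?_⟩
    have h4 : M / (1 + ‖u‖) ^ 2 ≤ M / (1 + ‖u‖) := by
      have : 1 + ‖u‖ ≤ (1 + ‖u‖) ^ 2 := by nlinarith [norm_nonneg u]
      gcongr
    rw [add_div]
    exact (norm_sub_le _ _).trans (add_le_add ((hM u h1 h2 h3).trans h4) (hM' u h1))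

theorem mul_lowerGamma {z : ℝ} (hz : 0 < z) {w : ℂ} (hw : w ≠ 0) :
    w * lowerGamma z w = z * lowerGamma z (w + 1) + cexp (-z) := by
  rw [lowerGamma, lowerGamma]
  linear_combination -gammaKernel_add_one hz hw + upperGamma_add_one hz w

theorem lowerGamma_eq_integral {z : ℝ} (hz : 0 < z) {w : ℂ} (hw : 0 < w.re) :
    lowerGamma z w = ∫ s : ℝ in Ioc 0 1, (s : ℂ) ^ (w - 1) * cexp (-(z * s)) := by
  have h1 := integral_cpow_mul_exp_neg_mul_Ioi (a := w) (r := z) hw (by simpa using hz)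
  have hint : IntegrableOn (fun s : ℝ => (s : ℂ) ^ (w - 1) * cexp (-(z * s))) (Ioi 0) := by
    have h := (integrableOn_rpow_mul_exp_neg_mul_rpow (p := 1) (s := w.re - 1) (b := z)
      (by linarith) one_pos hz)
    refine Integrable.mono' h ?_ ?_
    · refine ContinuousOn.aestronglyMeasurable (fun s hs => ?_) measurableSet_Ioi
      exact ((continuousAt_ofReal_cpow_const s _ (Or.inr (ne_of_gt hs))).mul
        (by fun_prop)).continuousWithinAt
    · refine (ae_restrict_iff' measurableSet_Ioi).2 (Eventually.of_forall fun s hs => ?_)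
      rw [norm_cpow_mul_cexp hs, Real.rpow_one, neg_mul]
  rw [← Ioc_union_Ioi_eq_Ioi zero_le_one, setIntegral_union Ioc_disjoint_Ioi_same measurableSet_Ioi
    (hint.mono_set Ioc_subset_Ioi_self) (hint.mono_set (Ioi_subset_Ioi zero_le_one))] at h1
  have h2 : (1 / (z : ℂ)) ^ w * Gamma w = gammaKernel z w := by
    rw [gammaKernel, one_div, inv_cpow _ _ (by rw [arg_ofReal_of_nonneg hz.le]; exact Real.pi_pos.ne),
      cpow_neg, mul_comm]
  rw [lowerGamma, ← h2, ← h1, upperGamma]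
  ring

theorem norm_lowerGamma_le_one {z : ℝ} (hz : 0 < z) {w : ℂ} (hw : 1 ≤ w.re) :
    ‖lowerGamma z w‖ ≤ 1 := by
  rw [lowerGamma_eq_integral hz (by linarith)]
  have := norm_setIntegral_le_of_norm_le_const (μ := volume) (s := Ioc (0 : ℝ) 1) (C := 1)
    (f := fun s : ℝ => (s : ℂ) ^ (w - 1) * cexp (-(z * s))) (by simp) ?_
  · simpa using this
  · intro s hs
    rw [norm_cpow_mul_cexp hs.1]
    exact mul_le_one₀ (Real.rpow_le_one hs.1.le hs.2 (by linarith)) (Real.exp_pos _).le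
      (Real.exp_le_one_iff.2 (by nlinarith [hs.1]))

/-- For Re w ≥ 1 the defining integral gives the bound 1. Unit steps to the left use w L(w) = z
L(w+1) + e^{-z}: from |L(w+1)| ≤ 2 follows |L(w)| ≤ (2z + 1)/|w|, which is at most 2 once |w| ≥ 1
and |w| ≥ 2z. That explains the two thresholds on |Im w|. -/
theorem norm_lowerGamma_le_two {z : ℝ} (hz : 0 < z) {w : ℂ}
    (hw : 1 ≤ w.re ∨ (1 ≤ |w.im| ∧ 2 * z ≤ |w.im|)) : ‖lowerGamma z w‖ ≤ 2 := by
  have key : ∀ n : ℕ, ∀ w : ℂ, 1 - n ≤ w.re → 1 ≤ |w.im| → 2 * z ≤ |w.im| →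
      ‖lowerGamma z w‖ ≤ 2 := by
    intro n
    induction n with
    | zero =>
      intro w h _ _
      exact (norm_lowerGamma_le_one hz (by simpa using h)).trans one_le_two
    | succ n ih =>
      intro w h h1 h2
      push_cast at h
      have h3 := ih (w + 1) (by rw [add_re, one_re]; linarith) (by simpa using h1) (by simpa using h2)
      have h4 := abs_im_le_norm w
      have hw0 : w ≠ 0 := by
        rintro rfl
        simp at h1
        linarith
      have h5 := congrArg norm (mul_lowerGamma hz hw0)
      rw [norm_mul] at h5
      have h6 := norm_add_le (z * lowerGamma z (w + 1)) (cexp (-z))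
      rw [← h5, norm_mul, norm_exp, norm_real, Real.norm_of_nonneg hz.le] at h6
      have h7 : Real.exp (-(z : ℂ)).re ≤ 1 := by
        rw [neg_re, ofReal_re]; exact Real.exp_le_one_iff.2 (by linarith)
      have h8 := mul_le_mul_of_nonneg_left h3 hz.le
      by_contra hcon
      have h9 : 2 < ‖lowerGamma z w‖ := not_le.1 hcon
      nlinarith
  rcases hw with hw | hw
  · exact (norm_lowerGamma_le_one hz hw).trans one_le_two
  · obtain ⟨n, hn⟩ := exists_nat_ge (1 - w.re)
    exact key n w (by linarith) hw.1 hw.2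

/-- One more use of the recurrence turns the uniform bound 2 into decay like 1/|w|. -/
theorem norm_lowerGamma_le {z : ℝ} (hz : 0 < z) {w : ℂ}
    (hw : 1 ≤ w.re ∨ (1 ≤ |w.im| ∧ 2 * z ≤ |w.im|)) : ‖lowerGamma z w‖ ≤ (2 * z + 1) / ‖w‖ := by
  have hw0 : w ≠ 0 := by
    rintro rfl
    rcases hw with hw | hw
    · simp at hw; linarith
    · simp at hw; linarith
  have h3 := norm_lowerGamma_le_two hz (w := w + 1) (by
    rw [add_re, add_im, one_re, one_im, add_zero]
    exact hw.imp (fun h => by linarith) id)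
  have h5 := congrArg norm (mul_lowerGamma hz hw0)
  rw [norm_mul] at h5
  have h6 := norm_add_le (z * lowerGamma z (w + 1)) (cexp (-z))
  rw [← h5, norm_mul, norm_exp, norm_real, Real.norm_of_nonneg hz.le] at h6
  have h7 : Real.exp (-(z : ℂ)).re ≤ 1 := by
    rw [neg_re, ofReal_re]; exact Real.exp_le_one_iff.2 (by linarith)
  have h8 := mul_le_mul_of_nonneg_left h3 hz.le
  rw [le_div_iff₀ (norm_pos_iff.2 hw0)]
  linarith

theorem norm_loop_integral_le {f : ℂ → ℂ} {C R : ℝ} (hR : 0 < R) (hC : 0 ≤ C)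
    (hf : ∀ u : ℂ, R ≤ u.re ∨ R ≤ |u.im| → ‖f u‖ ≤ C / ‖u‖ ^ 2) :
    ‖(⟨R, R, hR⟩ : Loop).integral f‖ ≤ 2 * C / R := by
  -- Each horizontal leg is dominated by ∫ C/(s² + R²) ds = Cπ/R over the whole line.
  have hleg : ∀ y : ℝ, |y| = R → ‖∫ s : ℝ in Iic R, f (s + I * y)‖ ≤ C * Real.pi / R := by
    intro y hy
    have hb : ∀ s : ℝ, ‖f (s + I * y)‖ ≤ C / R ^ 2 * (1 + (s / R) ^ 2)⁻¹ := by
      intro s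
      refine (hf _ (Or.inr (by simp [hy]))).trans (le_of_eq ?_)
      have : ‖(s + I * y : ℂ)‖ ^ 2 = s ^ 2 + R ^ 2 := by
        rw [← normSq_eq_norm_sq, normSq_apply, ← hy, sq_abs]
        simp [sq]
      rw [this]
      field_simp
      ring
    have hi : Integrable fun s : ℝ => C / R ^ 2 * (1 + (s / R) ^ 2)⁻¹ :=
      ((integrable_inv_one_add_sq.comp_div hR.ne').const_mul _)
    refine (norm_integral_le_of_norm_le hi.integrableOn (Eventually.of_forall fun s => hb s)).trans ?_
    refine (setIntegral_le_integral hi (Eventually.of_forall fun s => by positivity)).trans ?_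
    rw [integral_const_mul, Measure.integral_comp_div (fun s : ℝ => (1 + s ^ 2)⁻¹) R,
      integral_univ_inv_one_add_sq, abs_of_pos hR, smul_eq_mul]
    apply le_of_eq
    field_simp
  have h1 := hleg (-R) (by rw [abs_neg, abs_of_pos hR])
  have h3 := hleg R (abs_of_pos hR)
  have h2 : ‖∫ s : ℝ in (-R)..R, f (R + I * s)‖ ≤ C / R ^ 2 * |R - -R| := by
    refine intervalIntegral.norm_integral_le_of_norm_le_const fun s _ => ?_
    refine (hf _ (Or.inl (by simp))).trans ?_
    have : R ≤ ‖(R + I * s : ℂ)‖ := by simpa using re_le_norm (R + I * s : ℂ)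
    gcongr
  simp only [ofReal_neg, mul_neg, ← sub_eq_add_neg] at h1
  have e2 : C / R ^ 2 * |R - -R| = 2 * C / R := by
    rw [abs_of_pos (by linarith)]; field_simp; ring
  rw [e2] at h2
  have hpi := Real.pi_gt_three
  simp only [Loop.integral]
  rw [norm_div]
  have e3 : ‖(2 * Real.pi * I : ℂ)‖ = 2 * Real.pi := by
    simp [abs_of_pos Real.pi_pos]
  rw [e3, div_le_iff₀ (by positivity)]
  refine (norm_sub_le _ _).trans ((add_le_add (norm_add_le _ _) le_rfl).trans ?_)
  rw [norm_mul, norm_I, one_mul]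
  have h4 : 2 * C / R ≤ 2 * C / R * Real.pi := by
    exact le_mul_of_one_le_right (by positivity) (by linarith)
  have e5 : 2 * C / R * (2 * Real.pi) = C * Real.pi / R + 2 * C / R * Real.pi + C * Real.pi / R := by
    ring
  rw [e5]
  linarith

/-- By independence of the loop the value is that along the loop with σ = η = R, for every large R.
There the integrand is O(|u|^{-2}), since each factor contributes one power, so the value is O(1/R)
and hence 0. No sum over the infinitely many enclosed poles is needed. -/
theorem hasLoopIntegral_lowerGamma {z : ℝ} (hz : 0 < z) (l : ℝ) :
    HasLoopIntegral (max 0 (-l)) (fun u => lowerGamma z u / (u + l)) 0 := by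
  have hlin : LinearDecay (max 0 (-l)) (lowerGamma z) :=
    ⟨fun u hu => (lowerGamma_linearDecay hz).differentiableAt u
      (hu.imp (fun h => (le_max_left _ _).trans_lt h) id), (lowerGamma_linearDecay hz).decay⟩
  have hq := hlin.div_add (l := l) (le_max_right _ _)
  intro γ hγ
  refine ⟨hq.converges hγ, ?_⟩
  have hb : ∀ᶠ R : ℝ in atTop, ‖γ.integral fun u => lowerGamma z u / (u + l)‖ ≤
      2 * (2 * (2 * z + 1)) / R := by
    filter_upwards [eventually_gt_atTop (max 0 (-l)), eventually_ge_atTop 1,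
      eventually_ge_atTop (2 * z), eventually_ge_atTop (2 * |l|)] with R h1 h2 h3 h4
    have hR : 0 < R := by linarith
    rw [hq.integral_eq hγ (γ' := ⟨R, R, hR⟩) h1]
    refine norm_loop_integral_le hR (by positivity) fun u hu => ?_
    have h5 : R ≤ ‖u‖ := by
      rcases hu with hu | hu
      · exact hu.trans (re_le_norm u)
      · exact hu.trans (abs_im_le_norm u)
    have h6 : ‖u‖ / 2 ≤ ‖u + l‖ := by
      have := norm_sub_le (u + l) l
      rw [add_sub_cancel_right, norm_real, Real.norm_eq_abs] at this
      linarith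
    have h7 := norm_lowerGamma_le hz (w := u) (hu.imp (fun h => by linarith)
      (fun h => ⟨by linarith, by linarith⟩))
    have h8 : 0 < ‖u‖ := by linarith
    rw [norm_div]
    calc _ ≤ (2 * z + 1) / ‖u‖ / (‖u‖ / 2) := by gcongr
      _ = _ := by field_simp
  have h0 : ‖γ.integral fun u => lowerGamma z u / (u + l)‖ ≤ 0 :=
    ge_of_tendsto (tendsto_const_nhds.div_atTop tendsto_id) hb
  exact norm_le_zero_iff.1 h0

/-- Only the entire part of Γ(u) z^{-u} contributes, through its residue at -l. -/
theorem hasLoopIntegral_gammaKernel_div {z : ℝ} (hz : 0 < z) (l : ℝ) :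
    HasLoopIntegral (max 0 (-l)) (fun u => gammaKernel z u / (u + l)) (upperGamma z (-l)) := by
  have h1 := hasLoopIntegral_div_add (upperGamma_differentiable hz) (fun σ _ => by
    obtain ⟨M, hM⟩ := upperGamma_decay hz σ
    exact ⟨M, fun u h _ => hM u h⟩) l
  have h := (h1.mono (le_max_right 0 (-l))).add (hasLoopIntegral_lowerGamma hz l)
  rw [add_zero] at h
  refine h.congr fun u _ => ?_
  rw [lowerGamma]; ring

/-- There is no denominator here, so one is created: by the functional equation the kernel γ
satisfies γ(u) = (z γ(u+1) + γ(u))/(u+1). The two resulting values combine to e^{-z} by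
`upperGamma_add_one` at w = -1. -/
theorem hasLoopIntegral_gammaKernel {z : ℝ} (hz : 0 < z) :
    HasLoopIntegral 0 (gammaKernel z) (cexp (-z)) := by
  have h1 := (hasLoopIntegral_gammaKernel_div hz 1).mono (ρ' := 0) (by norm_num)
  have h2 := (((hasLoopIntegral_gammaKernel_div hz 0).comp_sub (-1)).const_mul (z : ℂ)).mono
    (ρ' := 0) (by norm_num)
  have h3 := h2.add h1
  have hv : (z : ℂ) * upperGamma z (-((0 : ℝ) : ℂ)) + upperGamma z (-((1 : ℝ) : ℂ)) = cexp (-z) := by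
    have := upperGamma_add_one hz (-1)
    rw [neg_add_cancel] at this
    simp only [ofReal_zero, ofReal_one, neg_zero]
    linear_combination this
  rw [hv] at h3
  refine h3.congr fun u hu => ?_
  have hu0 : u ≠ 0 := by simpa using ne_neg_nat_of_pos_or_im hu 0
  have hu1 : u + 1 ≠ 0 := fun h => ne_neg_nat_of_pos_or_im hu 1 (by
    rw [eq_neg_of_add_eq_zero_left h]; simp)
  have := gammaKernel_add_one hz hu0
  simp only [ofReal_neg, ofReal_one, ofReal_zero, sub_neg_eq_add, add_zero]
  rw [mul_div_assoc', this]
  field_simp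

/-! ### Evaluation of the Mellin–Barnes integrals -/

/-- The generalized exponential integral `∫_1^∞ s^{-p-1} e^{-zs} ds`. -/
noncomputable def expInt (p z : ℝ) : ℝ := ∫ s : ℝ in Ioi 1, s ^ (-p - 1) * Real.exp (-(z * s))

theorem upperGamma_neg_ofReal (p z : ℝ) : upperGamma z (-p) = expInt p z := by
  rw [upperGamma, expInt]
  refine Eq.trans ?_ (integral_ofReal (𝕜 := ℂ))
  refine setIntegral_congr_fun measurableSet_Ioi fun s hs => ?_
  have hs0 : (0 : ℝ) ≤ s := zero_le_one.trans (le_of_lt hs)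
  simp only [coe_algebraMap]
  rw [ofReal_mul, ofReal_cpow hs0]
  push_cast
  rfl

/-- The polynomial `∑_{k<n} g_k z^k / Γ(c + 1 + k)`, the value of `G_{c,n}(z)`. -/
noncomputable def gSum (α c : ℝ) (n : ℕ) (z : ℝ) : ℝ :=
  ∑ k ∈ Finset.range n, cauchyResidue (α + 1) n k * (z ^ k / Real.Gamma (c + 1 + k))

/-- `(-1)^n e^{-z} + ∑_{k<n} g_k E_{c+k}(z)`, the value of `H̃_{c,n}(z)`. -/
noncomputable def hTildeSum (α c : ℝ) (n : ℕ) (z : ℝ) : ℝ :=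
  (-1) ^ n * Real.exp (-z) + ∑ k ∈ Finset.range n, cauchyResidue (α + 1) n k * expInt (c + k) z

/-- The rational function `(-1)^n + ∑_{k<n} g_k / (u + k)`, as a function of `u`. -/
noncomputable def gammaRatio (α : ℝ) (n : ℕ) (u : ℂ) : ℂ :=
  (-1) ^ n + ∑ k ∈ Finset.range n, cauchyResidue ((α : ℂ) + 1) n k / (u + k)

/-- Away from the poles of Γ(v) this iterates the functional equation. At a pole v = -m the value
Γ(v) = 0 makes the quotient 0 by the convention for division, in agreement with 1/Γ; the hypothesis
forces m < n, so the product contains a zero factor. -/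
theorem Gamma_add_nat_div_Gamma {v : ℂ} {n : ℕ} (h : ∀ m : ℕ, v + n ≠ -m) :
    Gamma (v + n) / Gamma v = ∏ i ∈ Finset.range n, (v + i) := by
  by_cases hv : ∃ m : ℕ, v = -m
  · obtain ⟨m, rfl⟩ := hv
    rw [Gamma_neg_nat_eq_zero, div_zero]
    have hm : m < n := by
      by_contra hmn
      refine h (m - n) ?_
      rw [Nat.cast_sub (not_lt.1 hmn)]; ring
    exact (Finset.prod_eq_zero (Finset.mem_range.2 hm) (by simp)).symm
  · push Not at hv
    have key : ∀ j : ℕ, Gamma (v + j) = (∏ i ∈ Finset.range j, (v + i)) * Gamma v := by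
      intro j
      induction j with
      | zero => simp
      | succ j ih =>
        have hj : v + j ≠ 0 := fun h0 => hv j (eq_neg_of_add_eq_zero_left h0)
        rw [Nat.cast_succ, ← add_assoc, Gamma_add_one _ hj, ih, Finset.prod_range_succ]
        ring
    rw [key n, mul_div_cancel_right₀ _ (Gamma_ne_zero hv)]

/-- The hypothesis describes the points that separating contours can meet. There Γ(u), Γ(n+u) and
Γ(n+α+1-u) are finite, while Γ(α+1-u) may have a pole. -/
theorem Gamma_quotient_eq_gammaRatio {α : ℝ} {n : ℕ} {u : ℂ}
    (hu : u.im ≠ 0 ∨ (0 < u.re ∧ u.re < n + α + 1)) :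
    Gamma u * Gamma (n + α + 1 - u) / (Gamma (n + u) * Gamma (α - u + 1)) = gammaRatio α n u := by
  have h0 : 0 < u.re ∨ u.im ≠ 0 := hu.symm.imp And.left id
  have hun : ∀ i ∈ Finset.range n, u + i ≠ 0 := fun i _ h =>
    ne_neg_nat_of_pos_or_im h0 i (eq_neg_of_add_eq_zero_left h)
  have h1 : Gamma (n + u) = (∏ i ∈ Finset.range n, (u + i)) * Gamma u := by
    rw [← Gamma_add_nat_div_Gamma, add_comm, div_mul_cancel₀ _ (Gamma_ne_zero (ne_neg_nat_of_pos_or_im h0))]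
    intro m
    refine ne_neg_nat_of_pos_or_im (hu.symm.imp (fun h => ?_) fun h => ?_) m
    · rw [add_re, natCast_re]; linarith [h.1, (Nat.cast_nonneg n : (0 : ℝ) ≤ n)]
    · simpa using h
  have h2 : Gamma (n + α + 1 - u) / Gamma (α - u + 1) =
      ∏ i ∈ Finset.range n, ((α : ℂ) + 1 + i - u) := by
    have e : (n + α + 1 - u : ℂ) = α - u + 1 + n := by ring
    rw [e, Gamma_add_nat_div_Gamma]
    · exact Finset.prod_congr rfl fun i _ => by ring
    · intro m
      refine ne_neg_nat_of_pos_or_im (hu.symm.imp (fun h => ?_) fun h => ?_) m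
      · have : (α - u + 1 + n : ℂ).re = α - u.re + 1 + n := by simp
        rw [this]; linarith [h.2]
      · simpa using h
  rw [gammaRatio, ← prod_div_prod_eq_sum_cauchyResidue _ _ hun, h1, ← h2]
  have := Gamma_ne_zero (ne_neg_nat_of_pos_or_im h0)
  field_simp

theorem hasLoopIntegral_mul_gammaRatio {ρ : ℝ} {W : ℂ → ℂ} {v : ℂ} {w : ℕ → ℂ} (α : ℝ) (n : ℕ)
    (hW : HasLoopIntegral ρ W v)
    (hw : ∀ k : ℕ, HasLoopIntegral ρ (fun u => W u / (u + k)) (w k)) :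
    HasLoopIntegral ρ (fun u => W u * gammaRatio α n u)
      ((-1) ^ n * v + ∑ k ∈ Finset.range n, cauchyResidue ((α : ℂ) + 1) n k * w k) := by
  refine ((hW.const_mul ((-1) ^ n)).add (HasLoopIntegral.sum (Finset.range n) fun k _ =>
    (hw k).const_mul (cauchyResidue ((α : ℂ) + 1) n k))).congr fun u _ => ?_
  rw [gammaRatio, mul_add, Finset.mul_sum]
  congr 1
  · ring
  · exact Finset.sum_congr rfl fun k _ => by ring

theorem hasLoopIntegral_recipGammaKernel (α c : ℝ) (n : ℕ) {z : ℝ} (hz : 0 < z) :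
    HasLoopIntegral 0 (fun u => recipGammaKernel c z u * gammaRatio α n u) (gSum α c n z) := by
  have h1 := fun l => hasLoopIntegral_of_sq_decay (recipGammaKernel_differentiable c hz)
    (recipGammaKernel_decay c hz) l
  have h := hasLoopIntegral_mul_gammaRatio α n (h1 0).1
    (w := fun k => recipGammaKernel c z (-((k : ℝ) : ℂ))) fun k => by
      simpa using ((h1 k).2.mono (by simp))
  convert! h using 1
  rw [gSum, mul_zero, zero_add, ofReal_sum]
  refine Finset.sum_congr rfl fun k _ => ?_
  rw [ofReal_mul, ofReal_cauchyResidue, recipGammaKernel]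
  simp only [ofReal_natCast, neg_neg, sub_neg_eq_add, cpow_natCast]
  push_cast [← Gamma_ofReal]
  rw [div_eq_mul_inv]

theorem hasLoopIntegral_gammaKernel_sub (α c : ℝ) (n : ℕ) {z : ℝ} (hz : 0 < z) :
    HasLoopIntegral (max 0 c) (fun u => gammaKernel z (u - c) * gammaRatio α n u)
      (hTildeSum α c n z) := by
  have h := hasLoopIntegral_mul_gammaRatio α n
    (((hasLoopIntegral_gammaKernel hz).comp_sub c).mono (ρ' := max 0 c) (by simp))
    (w := fun k => upperGamma z (-((c + k : ℝ) : ℂ))) fun k => by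
      -- In the shifted variable u - c the pole of 1/(u + k) sits at -(c + k), which produces the
      -- index c + k of the exponential integral.
      refine (((hasLoopIntegral_gammaKernel_div hz (c + k)).comp_sub c).mono (ρ' := max 0 c) ?_).congr ?_
      · rw [← max_add_add_right]
        refine max_le (by simp) (le_max_of_le_left ?_)
        have : (0 : ℝ) ≤ k := Nat.cast_nonneg k
        linarith
      · intro u _
        push_cast
        rw [show u - c + (c + k : ℂ) = u + k by ring]
  convert! h using 1
  rw [hTildeSum]
  push_cast
  congr 1
  refine Finset.sum_congr rfl fun k _ => ?_
  rw [ofReal_cauchyResidue]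
  have := upperGamma_neg_ofReal (c + k) z
  push_cast at this ⊢
  rw [this]

theorem HasMellinBarnes.mellinBarnes_eq {L R : Set ℝ} {f : ℂ → ℂ} {v : ℂ}
    (h : HasMellinBarnes L R f v) : mellinBarnes L R f = v := by
  have hex : ∃ v, HasMellinBarnes L R f v := ⟨v, h⟩
  obtain ⟨γ, hγ⟩ := h.1
  rw [mellinBarnes, dif_pos hex]
  exact (hex.choose_spec.2 γ hγ).2.symm.trans (h.2 γ hγ).2

/-- A loop separates the poles exactly when ρ < σ < τ, as the rightmost pole of the left family and
the first real pole of the right family already decide. Therefore f and g need to agree only off the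
real axis and for ρ < Re u < τ. -/
theorem HasLoopIntegral.hasMellinBarnes {L : Set ℝ} {ρ τ : ℝ} {f g : ℂ → ℂ} {v : ℂ}
    (hg : HasLoopIntegral ρ g v) (hL : ∀ σ : ℝ, (∀ β ∈ L, -β < σ) ↔ ρ < σ) (hρτ : ρ < τ)
    (hfg : ∀ u : ℂ, u.im ≠ 0 ∨ (ρ < u.re ∧ u.re < τ) → f u = g u) :
    HasMellinBarnes L {τ} f v := by
  constructor
  · refine ⟨⟨(ρ + τ) / 2, 1, one_pos⟩, fun β hβ k => ⟨?_, ?_⟩, fun β hβ k => Or.inl ?_⟩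
    · have h1 := (hL ((ρ + τ) / 2)).2 (by linarith) β hβ
      have h2 : (0 : ℝ) ≤ k := Nat.cast_nonneg k
      simp only [sub_re, neg_re, ofReal_re, natCast_re]
      linarith
    · simp
    · rw [mem_singleton_iff.1 hβ]
      have h2 : (0 : ℝ) ≤ k := Nat.cast_nonneg k
      simp only [add_re, ofReal_re, natCast_re]
      linarith
  · intro γ hγ
    have hη := γ.η_pos
    have h1 : ρ < γ.σ := (hL _).1 fun β hβ => by simpa using (hγ.1 β hβ 0).1
    have h2 : γ.σ < τ := by
      have := hγ.2 τ rfl 0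
      simp only [Loop.outside, mem_ofPred_eq] at this
      rcases this with h | h
      · simpa using h
      · simp at h; linarith
    obtain ⟨⟨f1, f2, f3⟩, fv⟩ := hg γ h1
    have e1 : ∀ s : ℝ, g (s - I * γ.η) = f (s - I * γ.η) := fun s =>
      (hfg _ (Or.inl (by simpa using hη.ne'))).symm
    have e2 : ∀ s : ℝ, g (γ.σ + I * s) = f (γ.σ + I * s) := fun s =>
      (hfg _ (Or.inr ⟨by simpa using h1, by simpa using h2⟩)).symm
    have e3 : ∀ s : ℝ, g (s + I * γ.η) = f (s + I * γ.η) := fun s =>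
      (hfg _ (Or.inl (by simpa using hη.ne'))).symm
    simp only [e1] at f1
    simp only [e2] at f2
    simp only [e3] at f3
    refine ⟨⟨f1, f2, f3⟩, ?_⟩
    rw [← fv]
    simp only [Loop.integral, e1, e2, e3]

theorem gIntegrand_eq {α c : ℝ} {n : ℕ} (z : ℝ) {u : ℂ}
    (hu : u.im ≠ 0 ∨ (0 < u.re ∧ u.re < n + α + 1)) :
    gIntegrand α c n z u = recipGammaKernel c z u * gammaRatio α n u := by
  rw [gIntegrand, Gamma_quotient_eq_gammaRatio hu, recipGammaKernel, div_eq_mul_inv]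

theorem gTildeIntegrand_eq {α c : ℝ} {n : ℕ} {z : ℝ} (hz : 0 < z) {u : ℂ}
    (hu : u.im ≠ 0 ∨ (0 < u.re ∧ u.re < n + α + 1)) :
    gTildeIntegrand α c n z u =
      ((z ^ (-c) : ℝ) : ℂ) * (gammaKernel z (u - c) * gammaRatio α n u) := by
  have hz' : (z : ℂ) ≠ 0 := ofReal_ne_zero.2 hz.ne'
  rw [← Gamma_quotient_eq_gammaRatio hu, gTildeIntegrand, gammaKernel, ofReal_cpow hz.le,
    show -u = ((-c : ℝ) : ℂ) + -(u - c) by push_cast; ring, cpow_add _ _ hz',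
    show (α - u + 1 : ℂ) = α + 1 - u by ring]
  ring

/-- The substitution u → u + c, with z^{-u} = z^c z^{-(u+c)}. It shifts the contour and accounts for
the relation H = z^c G. -/
theorem hIntegrand_eq (α c : ℝ) (n : ℕ) {z : ℝ} (hz : 0 < z) (u : ℂ) :
    hIntegrand α c n z u = ((z ^ c : ℝ) : ℂ) * gIntegrand α c n z (u - (-c : ℝ)) := by
  have hz' : (z : ℂ) ≠ 0 := ofReal_ne_zero.2 hz.ne'
  rw [hIntegrand, gIntegrand, ofReal_cpow hz.le, show -u = (c : ℂ) + -(u - (-c : ℝ)) by push_cast; ring,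
    cpow_add _ _ hz']
  push_cast
  rw [show (c + 1 - (u - -c) : ℂ) = 1 - u by ring, show (u - -c : ℂ) = u + c by ring,
    show (n + α + 1 - (u + c) : ℂ) = n + α - c + 1 - u by ring,
    show (n + (u + c) : ℂ) = c + n + u by ring,
    show (α - (u + c) + 1 : ℂ) = α - c - u + 1 by ring]
  ring

theorem hTildeIntegrand_eq (α c : ℝ) (n : ℕ) {z : ℝ} (hz : 0 < z) (u : ℂ) :
    hTildeIntegrand α c n z u = ((z ^ c : ℝ) : ℂ) * gTildeIntegrand α c n z (u - (-c : ℝ)) := by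
  have hz' : (z : ℂ) ≠ 0 := ofReal_ne_zero.2 hz.ne'
  rw [hTildeIntegrand, gTildeIntegrand, ofReal_cpow hz.le,
    show -u = (c : ℂ) + -(u - (-c : ℝ)) by push_cast; ring, cpow_add _ _ hz']
  push_cast
  rw [show (u - -c : ℂ) = u + c by ring, show (u + c - c : ℂ) = u by ring,
    show (n + α + 1 - (u + c) : ℂ) = n + α - c + 1 - u by ring,
    show (n + (u + c) : ℂ) = c + n + u by ring,
    show (α + 1 - (u + c) : ℂ) = α - c + 1 - u by ring]
  ring

/-! ### Values of the four contour integrals and their Meijer form -/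

section Values

variable {α c z : ℝ} {n : ℕ}

theorem hasMellinBarnes_g (hα : -1 < α) (hz : 0 < z) :
    HasMellinBarnes {0} {n + α + 1} (gIntegrand α c n z) (gSum α c n z) := by
  have hn : (0 : ℝ) ≤ n := Nat.cast_nonneg n
  refine (hasLoopIntegral_recipGammaKernel α c n hz).hasMellinBarnes (by simp) (by linarith)
    fun u hu => gIntegrand_eq z hu

theorem hasMellinBarnes_gTilde (hα : -1 < α) (hc : c < α + 1) (hz : 0 < z) :
    HasMellinBarnes {-c, 0} {n + α + 1} (gTildeIntegrand α c n z)
      ((z ^ (-c) * hTildeSum α c n z : ℝ) : ℂ) := by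
  have hn : (0 : ℝ) ≤ n := Nat.cast_nonneg n
  have h := (hasLoopIntegral_gammaKernel_sub α c n hz).const_mul ((z ^ (-c) : ℝ) : ℂ)
  rw [← ofReal_mul] at h
  refine h.hasMellinBarnes (by simp [and_comm]) (max_lt (by linarith) (by linarith)) fun u hu => ?_
  exact gTildeIntegrand_eq hz (hu.imp id fun h => ⟨(le_max_left _ _).trans_lt h.1, h.2⟩)

theorem hasMellinBarnes_h (hα : -1 < α) (hz : 0 < z) :
    HasMellinBarnes {c} {n + α - c + 1} (hIntegrand α c n z) ((z ^ c * gSum α c n z : ℝ) : ℂ) := by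
  have hn : (0 : ℝ) ≤ n := Nat.cast_nonneg n
  have h := ((hasLoopIntegral_recipGammaKernel α c n hz).comp_sub (-c)).const_mul ((z ^ c : ℝ) : ℂ)
  rw [← ofReal_mul] at h
  refine h.hasMellinBarnes (by simp) (by linarith) fun u hu => ?_
  rw [hIntegrand_eq α c n hz, gIntegrand_eq]
  refine hu.imp (fun h => by simpa using h) fun h => ?_
  simp only [sub_re, ofReal_re]
  constructor <;> linarith [h.1, h.2]

theorem hasMellinBarnes_hTilde (hα : -1 < α) (hc : c < α + 1) (hz : 0 < z) :
    HasMellinBarnes {0, c} {n + α - c + 1} (hTildeIntegrand α c n z) (hTildeSum α c n z) := by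
  have hn : (0 : ℝ) ≤ n := Nat.cast_nonneg n
  have h := (hasLoopIntegral_gammaKernel_sub α c n hz).comp_sub (-c)
  refine h.hasMellinBarnes ?_ ?_ fun u hu => ?_
  · intro σ
    simp only [mem_insert_iff, mem_singleton_iff, forall_eq_or_imp, forall_eq, neg_zero]
    rw [← max_add_add_right, max_lt_iff]
    simp [and_comm]
  · rw [← max_add_add_right, max_lt_iff]
    constructor <;> linarith
  rw [hTildeIntegrand_eq α c n hz, gTildeIntegrand_eq hz]
  · rw [← mul_assoc, ← ofReal_mul, ← Real.rpow_add hz, add_neg_cancel, Real.rpow_zero, ofReal_one,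
      one_mul]
  · refine hu.imp (fun h => by simpa using h) fun h => ?_
    simp only [sub_re, ofReal_re]
    rw [← max_add_add_right, max_lt_iff] at h
    constructor <;> linarith [h.1.1, h.2]

theorem gFun_eq (hα : -1 < α) (hz : 0 < z) : gFun α c n z = gSum α c n z :=
  (hasMellinBarnes_g hα hz).mellinBarnes_eq

theorem gTilde_eq (hα : -1 < α) (hc : c < α + 1) (hz : 0 < z) :
    gTilde α c n z = ((z ^ (-c) * hTildeSum α c n z : ℝ) : ℂ) :=
  (hasMellinBarnes_gTilde hα hc hz).mellinBarnes_eq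

theorem hFun_eq (hα : -1 < α) (hz : 0 < z) :
    hFun α c n z = ((z ^ c * gSum α c n z : ℝ) : ℂ) :=
  (hasMellinBarnes_h hα hz).mellinBarnes_eq

theorem hTilde_eq (hα : -1 < α) (hc : c < α + 1) (hz : 0 < z) :
    hTilde α c n z = hTildeSum α c n z :=
  (hasMellinBarnes_hTilde hα hc hz).mellinBarnes_eq

theorem gFun_eq_meijerG (α c z : ℝ) (n : ℕ) :
    gFun α c n z = meijerG 1 1 ![-α - n, (n : ℝ)] ![0, -c, -α] z := by
  rw [gFun, meijerG]
  congr 1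
  · ext β; simp [eq_comm]
  · ext β
    simp only [mem_ofPred_eq, mem_singleton_iff]
    simp only [Nat.lt_one_iff, Fin.val_eq_zero_iff, exists_eq_left, Matrix.cons_val_zero, eq_comm]
    rw [show 1 - (-α - n) = n + α + 1 by ring]
  · funext u
    simp only [gIntegrand, Nat.lt_one_iff, Finset.prod_filter, Fin.prod_univ_succ]
    simp
    rw [show (1 - (-α - n) - u : ℂ) = n + α + 1 - u by ring, add_comm (1 : ℂ) c,
      show (α - u + 1 : ℂ) = 1 + α - u by ring]
    ring

theorem gTilde_eq_meijerG (α c z : ℝ) (n : ℕ) :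
    gTilde α c n z = meijerG 2 1 ![-α - n, (n : ℝ)] ![0, -c, -α] z := by
  rw [gTilde, meijerG]
  congr 1
  · ext β; simp [Fin.exists_fin_succ, eq_comm, or_comm]
  · ext β
    simp only [mem_ofPred_eq, mem_singleton_iff]
    simp only [Nat.lt_one_iff, Fin.val_eq_zero_iff, exists_eq_left, Matrix.cons_val_zero, eq_comm]
    rw [show 1 - (-α - n) = n + α + 1 by ring]
  · funext u
    simp only [gTildeIntegrand, Finset.prod_filter, Fin.prod_univ_succ]
    simp
    left
    rw [show (1 - (-α - n) - u : ℂ) = n + α + 1 - u by ring, add_comm (1 : ℂ) α, sub_eq_neg_add u]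
    ring

end Values

end ContourIntegrals

section Kernels

open Filter Topology

/-! ### Moments and Stieltjes transforms of the Laguerre weights -/

theorem integral_rpow_mul_exp {p r : ℝ} (hp : -1 < p) (hr : 0 < r) :
    IntegrableOn (fun x : ℝ => x ^ p * Real.exp (-(r * x))) (Ioi 0) ∧
      ∫ x in Ioi 0, x ^ p * Real.exp (-(r * x)) = Real.Gamma (p + 1) * r ^ (-p - 1) := by
  constructor
  · simpa using integrableOn_rpow_mul_exp_neg_mul_rpow (p := 1) (s := p) (b := r) hp one_pos hr
  · have := Real.integral_rpow_mul_exp_neg_mul_Ioi (a := p + 1) (r := r) (by linarith) hr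
    rw [add_sub_cancel_right] at this
    rw [this, one_div, Real.inv_rpow hr.le, ← Real.rpow_neg hr.le, neg_add', mul_comm]

theorem integral_comp_one_add (g : ℝ → ℝ) :
    (IntegrableOn (fun v => g (1 + v)) (Ioi 0) ↔ IntegrableOn g (Ioi 1)) ∧
      ∫ v in Ioi 0, g (1 + v) = ∫ s in Ioi 1, g s := by
  have hp : (fun v : ℝ => 1 + v) ⁻¹' Ioi 1 = Ioi 0 := by ext; simp
  have hm := measurePreserving_add_left volume (1 : ℝ)
  have he := (MeasurableEquiv.addLeft (1 : ℝ)).measurableEmbedding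
  constructor
  · have := hm.integrableOn_comp_preimage he (f := g) (s := Ioi 1)
    rwa [hp] at this
  · have := hm.setIntegral_preimage_emb he g (Ioi 1)
    rwa [hp] at this

theorem integral_exp_neg_one_add_mul {r : ℝ} (hr : 0 < r) :
    ∫ v in Ioi (0 : ℝ), Real.exp (-((1 + v) * r)) = Real.exp (-r) / r := by
  rw [(integral_comp_one_add fun s => Real.exp (-(s * r))).2]
  have := integral_exp_mul_Ioi (a := -r) (by linarith) 1
  simp only [neg_mul, mul_one] at this
  simp only [mul_comm _ r, this]
  field_simp

theorem ae_pos_prod : ∀ᵐ z : ℝ × ℝ ∂((volume.restrict (Ioi 0)).prod (volume.restrict (Ioi 0))),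
    0 < z.1 ∧ 0 < z.2 := by
  rw [Measure.prod_restrict]
  exact (ae_restrict_iff' (measurableSet_Ioi.prod measurableSet_Ioi)).2
    (Eventually.of_forall fun z hz => hz)

theorem volume_restrict_quadrant : (volume : Measure (ℝ × ℝ)).restrict (Ioi 0 ×ˢ Ioi 0) =
    (volume.restrict (Ioi (0 : ℝ))).prod (volume.restrict (Ioi (0 : ℝ))) := by
  rw [Measure.volume_eq_prod, Measure.prod_restrict]

/-- Writing e^{-x-y}/(x+y) = ∫_0^∞ e^{-(1+v)(x+y)} dv decouples x and y. By Fubini the v-integral of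
the two Gamma integrals is ∫ (1+v)^{-p-q-2} dv, which converges because p + q > -1. -/
theorem integral_cauchyLaguerre_moment {p q : ℝ} (hp : -1 < p) (hq : -1 < q) (hpq : -1 < p + q) :
    IntegrableOn (fun z : ℝ × ℝ => z.1 ^ p * z.2 ^ q * Real.exp (-z.1 - z.2) / (z.1 + z.2))
        (Ioi 0 ×ˢ Ioi 0) ∧
      ∫ z : ℝ × ℝ in Ioi 0 ×ˢ Ioi 0, z.1 ^ p * z.2 ^ q * Real.exp (-z.1 - z.2) / (z.1 + z.2) =
        Real.Gamma (p + 1) * Real.Gamma (q + 1) / (p + q + 1) := by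
  set μ : Measure ℝ := volume.restrict (Ioi 0) with hμ
  rw [IntegrableOn, volume_restrict_quadrant, ← hμ]
  let φ : ℝ × (ℝ × ℝ) → ℝ := fun w => (w.2.1 ^ p * Real.exp (-((1 + w.1) * w.2.1))) *
    (w.2.2 ^ q * Real.exp (-((1 + w.1) * w.2.2)))
  have hmeas : Measurable φ := by fun_prop
  have hv : ∀ᵐ v ∂μ, 0 < v := (ae_restrict_iff' measurableSet_Ioi).2 (Eventually.of_forall fun v h => h)
  have hsec : ∀ v : ℝ, 0 < v → Integrable (fun z => φ (v, z)) (μ.prod μ) := fun v h =>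
    (integral_rpow_mul_exp hp (by linarith : 0 < 1 + v)).1.mul_prod
      (integral_rpow_mul_exp hq (by linarith : 0 < 1 + v)).1
  have hsecint : ∀ v : ℝ, 0 < v → ∫ z, φ (v, z) ∂(μ.prod μ) =
      Real.Gamma (p + 1) * Real.Gamma (q + 1) * (1 + v) ^ (-(p + q + 2)) := by
    intro v h
    have h1 : (0 : ℝ) < 1 + v := by linarith
    have := integral_prod_mul (μ := μ) (ν := μ) (fun x : ℝ => x ^ p * Real.exp (-((1 + v) * x)))
      (fun y : ℝ => y ^ q * Real.exp (-((1 + v) * y)))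
    rw [this, (integral_rpow_mul_exp hp h1).2, (integral_rpow_mul_exp hq h1).2,
      show -(p + q + 2) = (-p - 1) + (-q - 1) by ring, Real.rpow_add h1]
    ring
  have hnorm : ∀ v : ℝ, ∫ z, ‖φ (v, z)‖ ∂(μ.prod μ) = ∫ z, φ (v, z) ∂(μ.prod μ) := by
    intro v
    refine integral_congr_ae ?_
    filter_upwards [ae_pos_prod] with z hz
    exact Real.norm_of_nonneg (mul_nonneg (mul_nonneg (Real.rpow_nonneg hz.1.le _) (Real.exp_pos _).le)
      (mul_nonneg (Real.rpow_nonneg hz.2.le _) (Real.exp_pos _).le))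
  have hpow : IntegrableOn (fun v : ℝ => (1 + v) ^ (-(p + q + 2))) (Ioi 0) ∧
      ∫ v in Ioi (0 : ℝ), (1 + v) ^ (-(p + q + 2)) = 1 / (p + q + 1) := by
    obtain ⟨h1, h2⟩ := integral_comp_one_add fun s => s ^ (-(p + q + 2))
    refine ⟨h1.2 (integrableOn_Ioi_rpow_of_lt (by linarith) one_pos), ?_⟩
    rw [h2, integral_Ioi_rpow_of_lt (by linarith) one_pos, Real.one_rpow,
      show -(p + q + 2) + 1 = -(p + q + 1) by ring, neg_div_neg_eq]
  have hint : Integrable φ (μ.prod (μ.prod μ)) := by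
    rw [integrable_prod_iff hmeas.aestronglyMeasurable]
    refine ⟨hv.mono hsec, ?_⟩
    refine (Integrable.congr (hpow.1.const_mul (Real.Gamma (p + 1) * Real.Gamma (q + 1))) ?_)
    filter_upwards [hv] with v h
    rw [hnorm, hsecint v h]
  have hswap : ∀ᵐ z ∂(μ.prod μ), ∫ v, φ (v, z) ∂μ =
      z.1 ^ p * z.2 ^ q * Real.exp (-z.1 - z.2) / (z.1 + z.2) := by
    filter_upwards [ae_pos_prod] with z hz
    have e : ∀ v, φ (v, z) = z.1 ^ p * z.2 ^ q * Real.exp (-((1 + v) * (z.1 + z.2))) := by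
      intro v
      simp only [φ]
      rw [mul_add, neg_add, Real.exp_add]
      ring
    simp only [e]
    rw [integral_const_mul, integral_exp_neg_one_add_mul (add_pos hz.1 hz.2), neg_add']
    ring
  refine ⟨hint.integral_prod_right.congr hswap, ?_⟩
  rw [← integral_congr_ae hswap, ← integral_prod_symm φ hint, integral_prod φ hint]
  rw [integral_congr_ae (hv.mono hsecint), integral_const_mul, hpow.2]
  ring

theorem integrableOn_expInt {z : ℝ} (hz : 0 < z) (p : ℝ) :
    IntegrableOn (fun s : ℝ => s ^ (-p - 1) * Real.exp (-(z * s))) (Ioi 1) :=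
  integrableOn_rpow_mul_exp_Ioi_one hz (-p - 1)

/-- The same device, e^{-x}/(y+x) = e^y ∫_0^∞ e^{-(1+v)(y+x)} dv; after the Gamma integral in x, the
variable s = 1 + v gives the exponential integral. -/
theorem integral_stieltjes {p y : ℝ} (hp : -1 < p) (hy : 0 < y) :
    IntegrableOn (fun x : ℝ => x ^ p * Real.exp (-x) / (y + x)) (Ioi 0) ∧
      ∫ x in Ioi 0, x ^ p * Real.exp (-x) / (y + x) =
        Real.Gamma (p + 1) * (Real.exp y * expInt p y) := by
  set μ : Measure ℝ := volume.restrict (Ioi 0) with hμ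
  let φ : ℝ × ℝ → ℝ := fun w => (w.2 ^ p * Real.exp (-((1 + w.1) * w.2))) * Real.exp (-(w.1 * y))
  have hmeas : Measurable φ := by fun_prop
  have hv : ∀ᵐ v ∂μ, 0 < v := (ae_restrict_iff' measurableSet_Ioi).2 (Eventually.of_forall fun v h => h)
  have hsec : ∀ v : ℝ, 0 < v → Integrable (fun x => φ (v, x)) μ := fun v h =>
    Integrable.mul_const (integral_rpow_mul_exp hp (by linarith : 0 < 1 + v)).1 (Real.exp (-(v * y)))
  have hsecint : ∀ v : ℝ, 0 < v → ∫ x, φ (v, x) ∂μ =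
      Real.Gamma (p + 1) * Real.exp y * ((1 + v) ^ (-p - 1) * Real.exp (-(y * (1 + v)))) := by
    intro v h
    simp only [φ]
    rw [integral_mul_const, (integral_rpow_mul_exp hp (by linarith : 0 < 1 + v)).2,
      show -(v * y) = y + -(y * (1 + v)) by ring, Real.exp_add]
    ring
  have hnorm : ∀ v : ℝ, ∫ x, ‖φ (v, x)‖ ∂μ = ∫ x, φ (v, x) ∂μ := by
    intro v
    refine integral_congr_ae ?_
    filter_upwards [hv] with x hx
    exact Real.norm_of_nonneg (mul_nonneg (mul_nonneg (Real.rpow_nonneg hx.le _) (Real.exp_pos _).le)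
      (Real.exp_pos _).le)
  obtain ⟨h1, h2⟩ := integral_comp_one_add fun s => s ^ (-p - 1) * Real.exp (-(y * s))
  have hint : Integrable φ (μ.prod μ) := by
    rw [integrable_prod_iff hmeas.aestronglyMeasurable]
    refine ⟨hv.mono hsec, ?_⟩
    refine (Integrable.congr ((h1.2 (integrableOn_expInt hy p)).const_mul
      (Real.Gamma (p + 1) * Real.exp y)) ?_)
    filter_upwards [hv] with v h
    rw [hnorm, hsecint v h]
  have hswap : ∀ᵐ x ∂μ, ∫ v, φ (v, x) ∂μ = x ^ p * Real.exp (-x) / (y + x) := by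
    filter_upwards [hv] with x hx
    have e : ∀ v, φ (v, x) = x ^ p * Real.exp y * Real.exp (-((1 + v) * (y + x))) := by
      intro v
      simp only [φ]
      rw [mul_assoc, mul_assoc, ← Real.exp_add, ← Real.exp_add]
      ring_nf
    simp only [e]
    rw [integral_const_mul, integral_exp_neg_one_add_mul (add_pos hy hx), neg_add, Real.exp_add,
      Real.exp_neg y]
    field_simp
  refine ⟨hint.integral_prod_right.congr hswap, ?_⟩
  rw [← integral_congr_ae hswap, ← integral_prod_symm φ hint, integral_prod φ hint]
  rw [integral_congr_ae (hv.mono hsecint), integral_const_mul, h2, expInt]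
  ring

/-! ### The generalized exponential integral -/

/-- Rescaling moves z from the integrand to the lower limit, so that the derivative in z follows
from the fundamental theorem of calculus without differentiating under the integral. -/
theorem expInt_eq_rpow_mul {z : ℝ} (hz : 0 < z) (p : ℝ) :
    expInt p z = z ^ p * ∫ v in Ioi z, v ^ (-p - 1) * Real.exp (-v) := by
  have h := integral_comp_mul_left_Ioi (fun v : ℝ => v ^ (-p - 1) * Real.exp (-v)) 1 hz
  rw [mul_one, smul_eq_mul] at h
  have e : ∫ s in Ioi 1, (z * s) ^ (-p - 1) * Real.exp (-(z * s)) =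
      z ^ (-p - 1) * expInt p z := by
    rw [expInt, ← integral_const_mul]
    refine setIntegral_congr_fun measurableSet_Ioi fun s hs => ?_
    have hs0 : (0 : ℝ) ≤ s := zero_le_one.trans (le_of_lt hs)
    rw [Real.mul_rpow hz.le hs0, mul_assoc]
  rw [e] at h
  have e2 : z ^ (-p - 1) * (z ^ p * z) = 1 := by
    rw [← Real.rpow_add_one hz.ne', ← Real.rpow_add hz]
    ring_nf
    exact Real.rpow_zero z
  calc expInt p z = (z ^ (-p - 1) * (z ^ p * z)) * expInt p z := by rw [e2, one_mul]
    _ = (z ^ p * z) * (z ^ (-p - 1) * expInt p z) := by ring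
    _ = _ := by rw [h]; field_simp

theorem hasDerivAt_expInt {z : ℝ} (hz : 0 < z) (p : ℝ) :
    HasDerivAt (expInt p) ((p * expInt p z - Real.exp (-z)) / z) z := by
  set f : ℝ → ℝ := fun v => v ^ (-p - 1) * Real.exp (-v) with hf
  have hfi : IntegrableOn f (Ioi 1) := by simpa using integrableOn_expInt one_pos p
  have hfc : ∀ v, 0 < v → ContinuousAt f v := fun v hv =>
    (Real.continuousAt_rpow_const v _ (Or.inl hv.ne')).mul (by fun_prop)
  have hii : ∀ w, 0 < w → IntervalIntegrable f volume 1 w := fun w hw =>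
    ContinuousOn.intervalIntegrable fun v hv =>
      (hfc v ((lt_min one_pos hw).trans_le hv.1)).continuousWithinAt
  have hG : HasDerivAt (fun w => (∫ v in Ioi 1, f v) - ∫ v in (1 : ℝ)..w, f v) (-f z) z := by
    have := intervalIntegral.integral_hasDerivAt_right (hii z hz) ?_ (hfc z hz)
    · simpa using this.const_sub (∫ v in Ioi 1, f v)
    · exact ContinuousOn.stronglyMeasurableAtFilter isOpen_Ioi
        (fun v hv => (hfc v hv).continuousWithinAt) z hz
  have hev : expInt p =ᶠ[𝓝 z] fun w => w ^ p * ((∫ v in Ioi 1, f v) - ∫ v in (1 : ℝ)..w, f v) := by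
    filter_upwards [lt_mem_nhds hz] with w hw
    have hfw : IntegrableOn f (Ioi w) := ((hii w hw).symm.1.union hfi).mono_set fun v hv =>
      (le_or_gt v 1).imp (fun h => ⟨hv, h⟩) id
    rw [expInt_eq_rpow_mul hw, ← intervalIntegral.integral_interval_add_Ioi' (hii w hw) hfw,
      add_sub_cancel_left]
  have h := ((Real.hasDerivAt_rpow_const (p := p) (Or.inl hz.ne')).mul hG).congr_of_eventuallyEq hev
  refine h.congr_deriv ?_
  have e := hev.self_of_nhds
  rw [e]
  simp only [hf]
  rw [Real.rpow_sub_one hz.ne']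
  have e2 : z ^ p * z ^ (-p - 1) = z⁻¹ := by
    rw [← Real.rpow_add hz, show p + (-p - 1) = -1 by ring, Real.rpow_neg_one]
  have e3 : z ^ p * -(z ^ (-p - 1) * Real.exp (-z)) = -(z⁻¹ * Real.exp (-z)) := by
    rw [← e2]; ring
  rw [e3]
  field_simp
  ring

theorem rpow_le_exp {t δ : ℝ} (ht : 0 < t) (h0 : 0 ≤ δ) (h1 : δ ≤ 1) : t ^ δ ≤ Real.exp t := by
  refine le_trans ?_ (Real.add_one_le_exp t)
  rcases le_total t 1 with h | h
  · exact (Real.rpow_le_one ht.le h h0).trans (by linarith)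
  · refine (Real.rpow_le_rpow_of_exponent_le h h1).trans ?_
    rw [Real.rpow_one]; linarith

/-- From (zs)^δ ≤ e^{zs} the integrand is at most z^{-δ} s^{-p-1-δ}, integrable on (1, ∞) as p + δ >
0. This controls the singularity at z = 0. -/
theorem abs_expInt_le {p z δ : ℝ} (hz : 0 < z) (h0 : 0 ≤ δ) (h1 : δ ≤ 1) (hp : 0 < p + δ) :
    |expInt p z| ≤ (p + δ)⁻¹ * z ^ (-δ) := by
  have hi := (integrableOn_Ioi_rpow_of_lt (show -p - 1 - δ < -1 by linarith) one_pos).mul_const (z ^ (-δ))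
  have h := norm_integral_le_of_norm_le (f := fun s : ℝ => s ^ (-p - 1) * Real.exp (-(z * s))) hi ?_
  · rw [integral_mul_const, integral_Ioi_rpow_of_lt (by linarith) one_pos, Real.one_rpow,
      show -p - 1 - δ + 1 = -(p + δ) by ring, neg_div_neg_eq, one_div] at h
    exact h
  · refine (ae_restrict_iff' measurableSet_Ioi).2 (Eventually.of_forall fun s hs => ?_)
    have hs0 : 0 < s := zero_lt_one.trans hs
    rw [Real.norm_of_nonneg (by positivity), Real.rpow_sub hs0 _ δ, Real.exp_neg, div_mul_eq_mul_div,
      mul_div_assoc, Real.rpow_neg hz.le, inv_div_left, ← Real.mul_rpow hs0.le hz.le, mul_comm s z]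
    have h3 := rpow_le_exp (mul_pos hz hs0) h0 h1
    have h4 : 0 < (z * s) ^ δ := Real.rpow_pos_of_pos (mul_pos hz hs0) _
    gcongr

/-! ### Integration of the products over `[0, 1]` -/

/-- Solutions `f_j` of `t f_j'(t) = (c + j) f_j(t) - ε e^{-tx}` that are `O(t^{-δ})` at `0`. -/
structure EulerFamily (c x ε δ : ℝ) (f : ℕ → ℝ → ℝ) : Prop where
  hasDerivAt : ∀ j : ℕ, ∀ t : ℝ, 0 < t →
    HasDerivAt (f j) (((c + j) * f j t - ε * Real.exp (-(t * x))) / t) t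
  bound : ∀ j : ℕ, ∃ M : ℝ, ∀ t ∈ Ioc (0 : ℝ) 1, |f j t| ≤ M * t ^ (-δ)

theorem eulerFamily_rpow {c x δ : ℝ} (hx : 0 < x) (hc : -c < δ) :
    EulerFamily c x 0 δ fun j t => (t * x) ^ (c + j) / Real.Gamma (c + 1 + j) := by
  constructor
  · intro j t ht
    have h := (((hasDerivAt_id t).mul_const x).rpow_const (p := c + j)
      (Or.inl (mul_pos ht hx).ne')).div_const (Real.Gamma (c + 1 + j))
    refine h.congr_deriv ?_
    simp only [id]
    rw [Real.rpow_sub_one (mul_pos ht hx).ne']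
    field_simp
    ring
  · intro j
    refine ⟨|x ^ (c + j) / Real.Gamma (c + 1 + j)|, fun t ht => ?_⟩
    rw [Real.mul_rpow ht.1.le hx.le, mul_div_assoc, abs_mul, mul_comm,
      abs_of_nonneg (Real.rpow_nonneg ht.1.le _)]
    refine mul_le_mul_of_nonneg_left ?_ (abs_nonneg _)
    exact Real.rpow_le_rpow_of_exponent_ge ht.1 ht.2 (by
      have : (0 : ℝ) ≤ j := Nat.cast_nonneg j
      linarith)

theorem eulerFamily_expInt {c x δ : ℝ} (hx : 0 < x) (hc : -c < δ) (h0 : 0 ≤ δ) (h1 : δ ≤ 1) :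
    EulerFamily c x 1 δ fun j t => expInt (c + j) (t * x) := by
  constructor
  · intro j t ht
    have h := (hasDerivAt_expInt (mul_pos ht hx) (c + j)).comp t ((hasDerivAt_id t).mul_const x)
    refine h.congr_deriv ?_
    field_simp
  · intro j
    have hj : 0 < c + j + δ := by
      have : (0 : ℝ) ≤ j := Nat.cast_nonneg j
      linarith
    refine ⟨(c + j + δ)⁻¹ * x ^ (-δ), fun t ht => ?_⟩
    refine (abs_expInt_le (mul_pos ht.1 hx) h0 h1 hj).trans (le_of_eq ?_)
    rw [Real.mul_rpow ht.1.le hx.le]; ring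

/-- `ε (-1)^n e^{-tx} + ∑_{k<n} g_k f_k(t)`. -/
noncomputable def eulerSum (α x ε : ℝ) (f : ℕ → ℝ → ℝ) (n : ℕ) (t : ℝ) : ℝ :=
  ε * ((-1) ^ n * Real.exp (-(t * x))) + ∑ k ∈ Finset.range n, cauchyResidue (α + 1) n k * f k t

section

variable {α a b x y ε ε' δ δ' : ℝ} {f h : ℕ → ℝ → ℝ} {n : ℕ}

theorem EulerFamily.continuousOn_eulerSum (hf : EulerFamily a x ε δ f) :
    ContinuousOn (eulerSum α x ε f n) (Ioi 0) := by
  refine ContinuousOn.add (by fun_prop) (continuousOn_finsetSum _ fun k _ => ?_)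
  exact continuousOn_const.mul fun t ht => (hf.hasDerivAt k t ht).continuousAt.continuousWithinAt

theorem EulerFamily.eulerSum_bound (hf : EulerFamily a x ε δ f) (hx : 0 < x) (hδ : 0 ≤ δ) :
    ∃ M : ℝ, 0 ≤ M ∧ ∀ t ∈ Ioc (0 : ℝ) 1, |eulerSum α x ε f n t| ≤ M * t ^ (-δ) := by
  choose M hM using hf.bound
  refine ⟨|ε| + ∑ k ∈ Finset.range n, |cauchyResidue (α + 1) n k| * |M k|, by positivity,
    fun t ht => ?_⟩
  have h1 : 1 ≤ t ^ (-δ) := Real.one_le_rpow_of_pos_of_le_one_of_nonpos ht.1 ht.2 (by linarith)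
  have h0 : 0 ≤ t ^ (-δ) := zero_le_one.trans h1
  rw [eulerSum, add_mul, Finset.sum_mul]
  refine (abs_add_le _ _).trans (add_le_add ?_ ((Finset.abs_sum_le_sum_abs _ _).trans
    (Finset.sum_le_sum fun k _ => ?_)))
  · rw [abs_mul, abs_mul, abs_pow, abs_neg, abs_one, one_pow, one_mul, Real.abs_exp]
    refine mul_le_mul_of_nonneg_left ?_ (abs_nonneg _)
    refine le_trans (Real.exp_le_one_iff.2 ?_) h1
    nlinarith [ht.1]
  · rw [abs_mul, mul_assoc]
    refine mul_le_mul_of_nonneg_left ((hM k t ht).trans ?_) (abs_nonneg _)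
    exact mul_le_mul_of_nonneg_right (le_abs_self _) h0

theorem EulerFamily.intervalIntegrable (hf : EulerFamily a x ε δ f) (hh : EulerFamily b y ε' δ' h)
    (hx : 0 < x) (hy : 0 < y) (hδ : 0 ≤ δ) (hδ' : 0 ≤ δ') (hδδ : δ + δ' < 1) :
    IntervalIntegrable (fun t => eulerSum α x ε f n t * eulerSum α y ε' h n t) volume 0 1 := by
  obtain ⟨M, hM0, hM⟩ := hf.eulerSum_bound (α := α) (n := n) hx hδ
  obtain ⟨M', hM0', hM'⟩ := hh.eulerSum_bound (α := α) (n := n) hy hδ'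
  rw [intervalIntegrable_iff_integrableOn_Ioc_of_le zero_le_one]
  have hi : IntegrableOn (fun t : ℝ => M * M' * t ^ (-(δ + δ'))) (Ioc 0 1) := by
    rw [← intervalIntegrable_iff_integrableOn_Ioc_of_le zero_le_one]
    exact (intervalIntegral.intervalIntegrable_rpow' (by linarith)).const_mul _
  refine Integrable.mono' hi ?_ ?_
  · refine ContinuousOn.aestronglyMeasurable ?_ measurableSet_Ioc
    exact (hf.continuousOn_eulerSum.mul hh.continuousOn_eulerSum).mono Ioc_subset_Ioi_self
  · refine (ae_restrict_iff' measurableSet_Ioc).2 (Eventually.of_forall fun t ht => ?_)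
    rw [norm_mul, neg_add, Real.rpow_add ht.1]
    have h1 := hM t ht
    have h2 := hM' t ht
    have h0 : 0 ≤ t ^ (-δ) := Real.rpow_nonneg ht.1.le _
    calc _ ≤ (M * t ^ (-δ)) * (M' * t ^ (-δ')) :=
          mul_le_mul h1 h2 (abs_nonneg _) (mul_nonneg hM0 h0)
      _ = _ := by ring

/-- `∑_{j,k<n} C_{jk} u_j v_k` for the inverse `C` of the Cauchy matrix. -/
noncomputable def cauchyForm (α : ℝ) (n : ℕ) (u v : ℕ → ℝ) : ℝ :=
  ∑ j ∈ Finset.range n, ∑ k ∈ Finset.range n, cauchyInv (α + 1) n j k * (u j * v k)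

/-- The column sums of C are g_k ∑_j g_j/(A+j+k) = -(-1)^n g_k. -/
theorem sum_sum_cauchyInv_mul (hα : -1 < α) (v : ℕ → ℝ) :
    ∑ j ∈ Finset.range n, ∑ k ∈ Finset.range n, cauchyInv (α + 1) n j k * v k =
      -(-1) ^ n * ∑ k ∈ Finset.range n, cauchyResidue (α + 1) n k * v k := by
  rw [Finset.sum_comm, Finset.mul_sum]
  refine Finset.sum_congr rfl fun k hk => ?_
  have h := sum_cauchyResidue_div (α + 1) (Finset.mem_range.1 hk) fun i => by
    have : (0 : ℝ) ≤ i := Nat.cast_nonneg i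
    linarith
  rw [← h, Finset.sum_mul]
  refine Finset.sum_congr rfl fun j _ => ?_
  rw [cauchyInv, add_right_comm]; ring

/-- The algebraic core. The terms without e, e' carry the factor 1 + (a+j) + (b+k) = α+1+j+k, which
cancels the denominator of C_{jk} and leaves (∑ g_j u_j)(∑ g_k v_k). The terms with one of e, e' are
evaluated by the column sums, and their sign (-1)^n completes the product. -/
theorem cauchyForm_identity (hα : -1 < α) (hab : α = a + b) (u v : ℕ → ℝ) (e e' : ℝ) :
    cauchyForm α n u v + ∑ j ∈ Finset.range n, ∑ k ∈ Finset.range n, cauchyInv (α + 1) n j k *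
        (((a + j) * u j - e) * v k + u j * ((b + k) * v k - e')) =
      (e * (-1) ^ n + ∑ k ∈ Finset.range n, cauchyResidue (α + 1) n k * u k) *
        (e' * (-1) ^ n + ∑ k ∈ Finset.range n, cauchyResidue (α + 1) n k * v k) - e * e' := by
  have h1 := sum_sum_cauchyInv_mul (n := n) hα v
  have h2 := sum_sum_cauchyInv_mul (n := n) hα u
  rw [Finset.sum_comm] at h2
  have h3 : (∑ k ∈ Finset.range n, cauchyResidue (α + 1) n k * u k) *
      (∑ k ∈ Finset.range n, cauchyResidue (α + 1) n k * v k) =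
      ∑ j ∈ Finset.range n, ∑ k ∈ Finset.range n,
        cauchyInv (α + 1) n j k * ((α + 1 + j + k) * (u j * v k)) := by
    rw [Finset.sum_mul_sum]
    refine Finset.sum_congr rfl fun j _ => Finset.sum_congr rfl fun k _ => ?_
    have : α + 1 + j + k ≠ 0 := by
      have h1 : (0 : ℝ) ≤ j := Nat.cast_nonneg j
      have h2 : (0 : ℝ) ≤ k := Nat.cast_nonneg k
      linarith
    rw [cauchyInv]
    field_simp
  have h4 : cauchyForm α n u v + ∑ j ∈ Finset.range n, ∑ k ∈ Finset.range n,
      cauchyInv (α + 1) n j k * (((a + j) * u j - e) * v k + u j * ((b + k) * v k - e')) =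
      (∑ j ∈ Finset.range n, ∑ k ∈ Finset.range n,
        cauchyInv (α + 1) n j k * ((α + 1 + j + k) * (u j * v k))) -
      e * (∑ j ∈ Finset.range n, ∑ k ∈ Finset.range n, cauchyInv (α + 1) n j k * v k) -
      e' * (∑ j ∈ Finset.range n, ∑ k ∈ Finset.range n, cauchyInv (α + 1) n k j * u j) := by
    rw [cauchyForm, Finset.mul_sum, Finset.mul_sum, ← Finset.sum_add_distrib, ← Finset.sum_sub_distrib,
      ← Finset.sum_sub_distrib]
    refine Finset.sum_congr rfl fun j _ => ?_
    rw [Finset.mul_sum, Finset.mul_sum, ← Finset.sum_add_distrib, ← Finset.sum_sub_distrib,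
      ← Finset.sum_sub_distrib]
    refine Finset.sum_congr rfl fun k _ => ?_
    rw [cauchyInv_comm _ _ k j, hab]
    ring
  rw [h4, ← h3, h1, h2]
  have h5 : ((-1 : ℝ) ^ n) * (-1) ^ n = 1 := by rw [← mul_pow]; norm_num
  linear_combination (-e * e') * h5

theorem EulerFamily.integral_mul (hf : EulerFamily a x ε δ f) (hh : EulerFamily b y ε' δ' h)
    (hα : -1 < α) (hab : α = a + b) (hx : 0 < x) (hy : 0 < y) (hδ : 0 ≤ δ) (hδ' : 0 ≤ δ')
    (hδδ : δ + δ' < 1) :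
    ∫ t in (0 : ℝ)..1, eulerSum α x ε f n t * eulerSum α y ε' h n t =
      cauchyForm α n (fun j => f j 1) (fun k => h k 1) +
        ε * ε' * ((1 - Real.exp (-(x + y))) / (x + y)) := by
  have hxy : 0 < x + y := add_pos hx hy
  -- A primitive of the product; the exponential term absorbs the leftover e e' of
  -- `cauchyForm_identity`.
  set Φ : ℝ → ℝ := fun t => t * cauchyForm α n (fun j => f j t) (fun k => h k t) -
    ε * ε' * (Real.exp (-(t * (x + y))) / (x + y)) with hΦ
  have hder : ∀ t : ℝ, 0 < t →
      HasDerivAt Φ (eulerSum α x ε f n t * eulerSum α y ε' h n t) t := by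
    intro t ht
    have h1 : HasDerivAt (fun t => cauchyForm α n (fun j => f j t) (fun k => h k t))
        (∑ j ∈ Finset.range n, ∑ k ∈ Finset.range n, cauchyInv (α + 1) n j k *
          (((a + j) * f j t - ε * Real.exp (-(t * x))) / t * h k t +
            f j t * (((b + k) * h k t - ε' * Real.exp (-(t * y))) / t))) t := by
      refine HasDerivAt.fun_sum fun j _ => HasDerivAt.fun_sum fun k _ => ?_
      exact ((hf.hasDerivAt j t ht).mul (hh.hasDerivAt k t ht)).const_mul _
    have h2 : HasDerivAt (fun t => Real.exp (-(t * (x + y))) / (x + y))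
        (Real.exp (-(t * (x + y))) * -(1 * (x + y)) / (x + y)) t :=
      ((((hasDerivAt_id t).mul_const (x + y)).neg).exp).div_const _
    have h3 := ((hasDerivAt_id t).mul h1).sub (h2.const_mul (ε * ε'))
    refine h3.congr_deriv ?_
    have h4 := cauchyForm_identity (n := n) hα hab (fun j => f j t) (fun k => h k t)
      (ε * Real.exp (-(t * x))) (ε' * Real.exp (-(t * y)))
    have h5 : t * ∑ j ∈ Finset.range n, ∑ k ∈ Finset.range n, cauchyInv (α + 1) n j k *
          (((a + j) * f j t - ε * Real.exp (-(t * x))) / t * h k t +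
            f j t * (((b + k) * h k t - ε' * Real.exp (-(t * y))) / t)) =
        ∑ j ∈ Finset.range n, ∑ k ∈ Finset.range n, cauchyInv (α + 1) n j k *
        (((a + j) * f j t - ε * Real.exp (-(t * x))) * h k t +
          f j t * ((b + k) * h k t - ε' * Real.exp (-(t * y)))) := by
      rw [Finset.mul_sum]
      refine Finset.sum_congr rfl fun j _ => ?_
      rw [Finset.mul_sum]
      refine Finset.sum_congr rfl fun k _ => ?_
      field_simp
    have h6 : Real.exp (-(t * (x + y))) = Real.exp (-(t * x)) * Real.exp (-(t * y)) := by
      rw [← Real.exp_add]; ring_nf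
    have h7 : Real.exp (-(t * (x + y))) * -(1 * (x + y)) / (x + y) = -Real.exp (-(t * (x + y))) := by
      field_simp
    simp only [id]
    rw [h5, h7, h6, eulerSum, eulerSum]
    linear_combination h4
  have hint := hf.intervalIntegrable hh (α := α) (n := n) hx hy hδ hδ' hδδ
  -- At 0 the form is O(t^{-δ-δ'}) with δ + δ' < 1, so the factor t makes it vanish and only the
  -- exponential term survives.
  have h0 : Tendsto Φ (𝓝[>] 0) (𝓝 (0 - ε * ε' * (1 / (x + y)))) := by
    refine Tendsto.sub ?_ ?_
    · have e : ∀ t : ℝ, t * cauchyForm α n (fun j => f j t) (fun k => h k t) =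
          ∑ j ∈ Finset.range n, ∑ k ∈ Finset.range n,
            cauchyInv (α + 1) n j k * (t * (f j t * h k t)) := by
        intro t
        rw [cauchyForm, Finset.mul_sum]
        refine Finset.sum_congr rfl fun j _ => ?_
        rw [Finset.mul_sum]
        exact Finset.sum_congr rfl fun k _ => by ring
      simp only [e]
      have hz : ∀ j k : ℕ, Tendsto (fun t => t * (f j t * h k t)) (𝓝[>] 0) (𝓝 0) := by
        intro j k
        obtain ⟨M, hM⟩ := hf.bound j
        obtain ⟨M', hM'⟩ := hh.bound k
        refine squeeze_zero_norm' (a := fun t => |M| * |M'| * t ^ (1 - (δ + δ'))) ?_ ?_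
        · filter_upwards [Ioc_mem_nhdsGT (zero_lt_one' ℝ)] with t ht
          have e1 : t ^ (1 - (δ + δ')) = t * (t ^ (-δ) * t ^ (-δ')) := by
            rw [← Real.rpow_add ht.1, sub_eq_add_neg, neg_add, Real.rpow_add ht.1 1, Real.rpow_one]
          have hp := Real.rpow_nonneg ht.1.le (-δ)
          have hp' := Real.rpow_nonneg ht.1.le (-δ')
          rw [norm_mul, norm_mul, Real.norm_of_nonneg ht.1.le, e1]
          have h1 : ‖f j t‖ ≤ |M| * t ^ (-δ) :=
            (hM t ht).trans (mul_le_mul_of_nonneg_right (le_abs_self _) hp)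
          have h2 : ‖h k t‖ ≤ |M'| * t ^ (-δ') :=
            (hM' t ht).trans (mul_le_mul_of_nonneg_right (le_abs_self _) hp')
          calc t * (‖f j t‖ * ‖h k t‖) ≤ t * ((|M| * t ^ (-δ)) * (|M'| * t ^ (-δ'))) := by
                have := ht.1.le
                gcongr
            _ = _ := by ring
        · have : ContinuousAt (fun t : ℝ => |M| * |M'| * t ^ (1 - (δ + δ'))) 0 :=
            continuousAt_const.mul (Real.continuousAt_rpow_const _ _ (Or.inr (by linarith)))
          have h1 := this.tendsto.mono_left (nhdsWithin_le_nhds (s := Ioi 0))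
          rwa [Real.zero_rpow (by linarith), mul_zero] at h1
      have := tendsto_finsetSum (Finset.range n) fun j _ => tendsto_finsetSum (Finset.range n)
        fun k _ => (hz j k).const_mul (cauchyInv (α + 1) n j k)
      simpa using this
    · refine Tendsto.const_mul _ ?_
      have : Continuous fun t : ℝ => Real.exp (-(t * (x + y))) / (x + y) := by fun_prop
      simpa using (this.tendsto 0).mono_left nhdsWithin_le_nhds
  have h1 : Tendsto Φ (𝓝[<] 1) (𝓝 (Φ 1)) :=
    (hder 1 one_pos).continuousAt.tendsto.mono_left nhdsWithin_le_nhds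
  rw [intervalIntegral.integral_eq_sub_of_hasDerivAt_of_tendsto zero_lt_one
    (fun t ht => hder t ht.1) hint h0 h1, hΦ]
  simp only [one_mul]
  ring

end

/-! ### The biorthogonal polynomials -/

/-- The bimoment `∬ x^{a+j} y^{b+k} e^{-x-y} / (x+y) dx dy`. -/
noncomputable def bimoment (a b : ℝ) (j k : ℕ) : ℝ :=
  Real.Gamma (a + 1 + j) * Real.Gamma (b + 1 + k) / (a + b + 1 + j + k)

theorem bimoment_comm (a b : ℝ) (j k : ℕ) : bimoment a b j k = bimoment b a k j := by
  rw [bimoment, bimoment, mul_comm (Real.Gamma _), add_right_comm (a + b + 1), add_comm a b]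

/-- `∬ x^a y^b e^{-x-y} / (x+y) P(x) Q(y) dx dy`, in terms of the coefficients. -/
noncomputable def bimomentForm (a b : ℝ) (P Q : ℝ[X]) : ℝ :=
  ∑ j ∈ Finset.range (P.natDegree + 1), ∑ k ∈ Finset.range (Q.natDegree + 1),
    P.coeff j * Q.coeff k * bimoment a b j k

theorem bimomentForm_comm (a b : ℝ) (P Q : ℝ[X]) : bimomentForm a b P Q = bimomentForm b a Q P := by
  rw [bimomentForm, bimomentForm, Finset.sum_comm]
  refine Finset.sum_congr rfl fun k _ => Finset.sum_congr rfl fun j _ => ?_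
  rw [bimoment_comm, mul_comm (P.coeff j)]

section

variable {a b : ℝ}

theorem integral_eq_bimomentForm (ha : -1 < a) (hb : -1 < b) (hab : -1 < a + b) (P Q : ℝ[X]) :
    IntegrableOn (fun z : ℝ × ℝ => z.1 ^ a * z.2 ^ b * Real.exp (-z.1 - z.2) / (z.1 + z.2) *
        P.eval z.1 * Q.eval z.2) (Ioi 0 ×ˢ Ioi 0) ∧
      ∫ z : ℝ × ℝ in Ioi 0 ×ˢ Ioi 0, z.1 ^ a * z.2 ^ b * Real.exp (-z.1 - z.2) / (z.1 + z.2) *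
        P.eval z.1 * Q.eval z.2 = bimomentForm a b P Q := by
  have hm : MeasurableSet (Ioi (0 : ℝ) ×ˢ Ioi (0 : ℝ)) := measurableSet_Ioi.prod measurableSet_Ioi
  have key := fun j k : ℕ => integral_cauchyLaguerre_moment (p := a + j) (q := b + k)
    (by linarith [(Nat.cast_nonneg j : (0 : ℝ) ≤ j)]) (by linarith [(Nat.cast_nonneg k : (0 : ℝ) ≤ k)])
    (by linarith [(Nat.cast_nonneg j : (0 : ℝ) ≤ j), (Nat.cast_nonneg k : (0 : ℝ) ≤ k)])
  have e : EqOn (fun z : ℝ × ℝ => ∑ j ∈ Finset.range (P.natDegree + 1),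
      ∑ k ∈ Finset.range (Q.natDegree + 1), P.coeff j * Q.coeff k *
        (z.1 ^ (a + j) * z.2 ^ (b + k) * Real.exp (-z.1 - z.2) / (z.1 + z.2)))
      (fun z : ℝ × ℝ => z.1 ^ a * z.2 ^ b * Real.exp (-z.1 - z.2) / (z.1 + z.2) *
        P.eval z.1 * Q.eval z.2) (Ioi 0 ×ˢ Ioi 0) := by
    intro z hz
    simp only []
    rw [eval_eq_sum_range, eval_eq_sum_range, mul_assoc, Finset.sum_mul_sum, Finset.mul_sum]
    refine Finset.sum_congr rfl fun j _ => ?_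
    rw [Finset.mul_sum]
    refine Finset.sum_congr rfl fun k _ => ?_
    rw [Real.rpow_add_natCast (ne_of_gt hz.1), Real.rpow_add_natCast (ne_of_gt hz.2)]
    ring
  have hi : ∀ j ∈ Finset.range (P.natDegree + 1), IntegrableOn (fun z : ℝ × ℝ =>
      ∑ k ∈ Finset.range (Q.natDegree + 1), P.coeff j * Q.coeff k *
        (z.1 ^ (a + j) * z.2 ^ (b + k) * Real.exp (-z.1 - z.2) / (z.1 + z.2))) (Ioi 0 ×ˢ Ioi 0) :=
    fun j _ => integrable_finsetSum _ fun k _ => (key j k).1.const_mul _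
  refine ⟨IntegrableOn.congr_fun (integrable_finsetSum _ hi) e hm, ?_⟩
  rw [← setIntegral_congr_fun hm e, integral_finsetSum _ hi, bimomentForm]
  refine Finset.sum_congr rfl fun j _ => ?_
  rw [integral_finsetSum _ fun k _ => (key j k).1.const_mul _]
  refine Finset.sum_congr rfl fun k _ => ?_
  rw [integral_const_mul, (key j k).2, bimoment]
  ring_nf

theorem isCauchyBiorthonormal_iff (ha : -1 < a) (hb : -1 < b) (hab : -1 < a + b) (p q : ℕ → ℝ[X]) :
    IsCauchyBiorthonormal a b p q ↔
      (∀ n, (p n).natDegree = n ∧ (q n).natDegree = n ∧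
        (p n).leadingCoeff = (q n).leadingCoeff ∧ 0 < (p n).leadingCoeff) ∧
      ∀ l m, bimomentForm a b (p l) (q m) = if l = m then 1 else 0 := by
  refine and_congr_right fun _ => forall_congr' fun l => forall_congr' fun m => ?_
  obtain ⟨h1, h2⟩ := integral_eq_bimomentForm ha hb hab (p l) (q m)
  rw [h2]
  exact and_iff_right h1

theorem IsCauchyBiorthonormal.symm (ha : -1 < a) (hb : -1 < b) (hab : -1 < a + b) {p q : ℕ → ℝ[X]}
    (h : IsCauchyBiorthonormal a b p q) : IsCauchyBiorthonormal b a q p := by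
  rw [isCauchyBiorthonormal_iff ha hb hab] at h
  rw [isCauchyBiorthonormal_iff hb ha (by linarith)]
  refine ⟨fun n => ?_, fun l m => ?_⟩
  · obtain ⟨h1, h2, h3, h4⟩ := h.1 n
    exact ⟨h2, h1, h3.symm, h3 ▸ h4⟩
  · rw [bimomentForm_comm, h.2]
    simp only [eq_comm]

/-- The Cauchy–Laguerre polynomial, a multiple of `∑_{k≤n} C_{nk} x^k / Γ(a + 1 + k)` with `C` the
inverse of the Cauchy matrix of size `n + 1`. -/
noncomputable def cauchyLaguerre (a b : ℝ) (n : ℕ) : ℝ[X] :=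
  ∑ k ∈ Finset.range (n + 1), monomial k
    (√(Real.Gamma (a + 1 + n) / (Real.Gamma (b + 1 + n) * cauchyInv (a + b + 1) (n + 1) n n)) *
      (cauchyInv (a + b + 1) (n + 1) n k / Real.Gamma (a + 1 + k)))

theorem Gamma_add_nat_pos (ha : -1 < a) (k : ℕ) : 0 < Real.Gamma (a + 1 + k) :=
  Real.Gamma_pos_of_pos (by linarith [(Nat.cast_nonneg k : (0 : ℝ) ≤ k)])

theorem cauchyInv_self_pos {A : ℝ} (hA : 0 < A) (n j : ℕ) : 0 < cauchyInv A n j j := by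
  have := mul_self_pos.2 (cauchyResidue_ne_zero A n j fun i => by positivity)
  rw [cauchyInv]
  positivity

theorem coeff_cauchyLaguerre {n k : ℕ} (hk : k ∈ Finset.range (n + 1)) :
    (cauchyLaguerre a b n).coeff k =
      √(Real.Gamma (a + 1 + n) / (Real.Gamma (b + 1 + n) * cauchyInv (a + b + 1) (n + 1) n n)) *
      (cauchyInv (a + b + 1) (n + 1) n k / Real.Gamma (a + 1 + k)) := by
  rw [cauchyLaguerre, finsetSum_coeff]
  simp only [coeff_monomial]
  rw [Finset.sum_ite_eq' _ k, if_pos hk]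

theorem natDegree_cauchyLaguerre (ha : -1 < a) (hb : -1 < b) (hab : -1 < a + b) (n : ℕ) :
    (cauchyLaguerre a b n).natDegree = n ∧ 0 < (cauchyLaguerre a b n).leadingCoeff := by
  have h1 := Gamma_add_nat_pos ha n
  have h2 := Gamma_add_nat_pos hb n
  have h3 := cauchyInv_self_pos (by linarith : 0 < a + b + 1) (n + 1) n
  have hpos : 0 < (cauchyLaguerre a b n).coeff n := by
    rw [coeff_cauchyLaguerre (Finset.self_mem_range_succ n)]
    positivity
  have hle : (cauchyLaguerre a b n).natDegree ≤ n := by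
    refine natDegree_sum_le_of_forall_le _ _ fun k hk => (natDegree_monomial_le _).trans ?_
    exact Nat.lt_succ_iff.1 (Finset.mem_range.1 hk)
  have hd := natDegree_eq_of_le_of_coeff_ne_zero hle hpos.ne'
  exact ⟨hd, by rwa [leadingCoeff, hd]⟩

/-- The coefficients are row n of the inverse Cauchy matrix up to row scaling, so the pairing with
y^m vanishes for all m < n. -/
theorem sum_bimoment_cauchyLaguerre (ha : -1 < a) (hab : -1 < a + b) {n m : ℕ} (hm : m < n + 1) :
    ∑ j ∈ Finset.range (n + 1), (cauchyLaguerre a b n).coeff j * bimoment a b j m =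
      if n = m then
        √(Real.Gamma (a + 1 + n) / (Real.Gamma (b + 1 + n) * cauchyInv (a + b + 1) (n + 1) n n)) *
          Real.Gamma (b + 1 + m) else 0 := by
  have h := sum_cauchyInv_div (a + b + 1) (Nat.lt_succ_self n) hm fun i => by
    have : (0 : ℝ) ≤ i := Nat.cast_nonneg i
    linarith
  have e : ∑ j ∈ Finset.range (n + 1), (cauchyLaguerre a b n).coeff j * bimoment a b j m =
      √(Real.Gamma (a + 1 + n) / (Real.Gamma (b + 1 + n) * cauchyInv (a + b + 1) (n + 1) n n)) *
          Real.Gamma (b + 1 + m) *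
        ∑ k ∈ Finset.range (n + 1), cauchyInv (a + b + 1) (n + 1) n k / (a + b + 1 + k + m) := by
    rw [Finset.mul_sum]
    refine Finset.sum_congr rfl fun j hj => ?_
    have := (Gamma_add_nat_pos ha j).ne'
    rw [coeff_cauchyLaguerre hj, bimoment]
    field_simp
  rw [e, h]
  split_ifs <;> simp

/-- The Gamma factors cancel in the product of the two constants, leaving 1/C_{nn} with C of size n
+ 1. -/
theorem normalization_mul (ha : -1 < a) (hb : -1 < b) (hab : -1 < a + b) (n : ℕ) :
    √(Real.Gamma (a + 1 + n) / (Real.Gamma (b + 1 + n) * cauchyInv (a + b + 1) (n + 1) n n)) *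
      √(Real.Gamma (b + 1 + n) / (Real.Gamma (a + 1 + n) * cauchyInv (b + a + 1) (n + 1) n n)) *
      cauchyInv (a + b + 1) (n + 1) n n = 1 := by
  have h1 := Gamma_add_nat_pos ha n
  have h2 := Gamma_add_nat_pos hb n
  have h3 := cauchyInv_self_pos (by linarith : 0 < a + b + 1) (n + 1) n
  rw [add_comm b a, ← Real.sqrt_mul (by positivity)]
  have : Real.Gamma (a + 1 + n) / (Real.Gamma (b + 1 + n) * cauchyInv (a + b + 1) (n + 1) n n) *
      (Real.Gamma (b + 1 + n) / (Real.Gamma (a + 1 + n) * cauchyInv (a + b + 1) (n + 1) n n)) =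
      (cauchyInv (a + b + 1) (n + 1) n n)⁻¹ ^ 2 := by
    field_simp
  rw [this, Real.sqrt_sq (by positivity), inv_mul_cancel₀ h3.ne']

theorem bimomentForm_cauchyLaguerre_of_le (ha : -1 < a) (hb : -1 < b) (hab : -1 < a + b) {l m : ℕ}
    (hml : m ≤ l) :
    bimomentForm a b (cauchyLaguerre a b l) (cauchyLaguerre b a m) = if l = m then 1 else 0 := by
  rw [bimomentForm, (natDegree_cauchyLaguerre ha hb hab l).1,
    (natDegree_cauchyLaguerre hb ha (by linarith) m).1, Finset.sum_comm]
  have e : ∀ k ∈ Finset.range (m + 1), ∑ j ∈ Finset.range (l + 1),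
      (cauchyLaguerre a b l).coeff j * (cauchyLaguerre b a m).coeff k * bimoment a b j k =
      (cauchyLaguerre b a m).coeff k * if l = k then
        √(Real.Gamma (a + 1 + l) / (Real.Gamma (b + 1 + l) * cauchyInv (a + b + 1) (l + 1) l l)) *
          Real.Gamma (b + 1 + k) else 0 := by
    intro k hk
    rw [← sum_bimoment_cauchyLaguerre ha hab (by have := Finset.mem_range.1 hk; omega),
      Finset.mul_sum]
    exact Finset.sum_congr rfl fun j _ => by ring
  rw [Finset.sum_congr rfl e]
  rcases hml.eq_or_lt with rfl | hlt
  · rw [Finset.sum_eq_single_of_mem m (Finset.self_mem_range_succ m)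
      (fun k _ hk => by rw [if_neg hk.symm, mul_zero]), if_pos rfl, if_pos rfl,
      coeff_cauchyLaguerre (Finset.self_mem_range_succ m)]
    have := (Gamma_add_nat_pos hb m).ne'
    have hN := normalization_mul ha hb hab m
    rw [add_comm b a] at hN ⊢
    refine Eq.trans ?_ hN
    field_simp
  · rw [if_neg hlt.ne']
    refine Finset.sum_eq_zero fun k hk => ?_
    rw [if_neg (by have := Finset.mem_range.1 hk; omega), mul_zero]

theorem isCauchyBiorthonormal_cauchyLaguerre (ha : -1 < a) (hb : -1 < b) (hab : -1 < a + b) :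
    IsCauchyBiorthonormal a b (cauchyLaguerre a b) (cauchyLaguerre b a) := by
  rw [isCauchyBiorthonormal_iff ha hb hab]
  refine ⟨fun n => ?_, fun l m => ?_⟩
  · obtain ⟨h1, h2⟩ := natDegree_cauchyLaguerre ha hb hab n
    obtain ⟨h3, h4⟩ := natDegree_cauchyLaguerre hb ha (by linarith) n
    refine ⟨h1, h3, ?_, h2⟩
    have g1 := Gamma_add_nat_pos ha n
    have g2 := Gamma_add_nat_pos hb n
    have g3 := cauchyInv_self_pos (by linarith : 0 < a + b + 1) (n + 1) n
    -- Both squared leading coefficients are C_{nn} / (Γ(a+1+n)Γ(b+1+n)), which is symmetric in a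
    -- and b.
    refine (sq_eq_sq₀ h2.le h4.le).1 ?_
    rw [leadingCoeff, leadingCoeff, h1, h3, coeff_cauchyLaguerre (Finset.self_mem_range_succ n),
      coeff_cauchyLaguerre (Finset.self_mem_range_succ n), add_comm b a, mul_pow, mul_pow,
      Real.sq_sqrt (by positivity), Real.sq_sqrt (by positivity)]
    field_simp
  · rcases le_total m l with h | h
    · exact bimomentForm_cauchyLaguerre_of_le ha hb hab h
    · rw [bimomentForm_comm, bimomentForm_cauchyLaguerre_of_le hb ha (by linarith) h]
      simp only [eq_comm]

/-- Let u_m be the pairing of p_n with y^m. Orthogonality to q_0, …, q_{n-1} is a triangular system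
that forces u_m = 0 for m < n. Inverting the Cauchy matrix makes the coefficients of p_n a multiple
of row n of the inverse, and the equal positive leading coefficients fix the multiple. -/
theorem IsCauchyBiorthonormal.fst_eq (ha : -1 < a) (hb : -1 < b) (hab : -1 < a + b) {p q : ℕ → ℝ[X]}
    (h : IsCauchyBiorthonormal a b p q) (n : ℕ) : p n = cauchyLaguerre a b n := by
  rw [isCauchyBiorthonormal_iff ha hb hab] at h
  obtain ⟨hdeg, horth⟩ := h
  set u : ℕ → ℝ := fun m => ∑ j ∈ Finset.range (n + 1), (p n).coeff j * bimoment a b j m with hu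
  have hqu : ∀ m, ∑ k ∈ Finset.range (m + 1), (q m).coeff k * u k = if n = m then 1 else 0 := by
    intro m
    rw [← horth n m, bimomentForm, (hdeg n).1, (hdeg m).2.1, Finset.sum_comm]
    refine Finset.sum_congr rfl fun k _ => ?_
    rw [hu, Finset.mul_sum]
    exact Finset.sum_congr rfl fun j _ => by ring
  have hlead : ∀ m, (q m).coeff m ≠ 0 := fun m => by
    have h1 := (hdeg m).2.2.2
    rw [(hdeg m).2.2.1, leadingCoeff, (hdeg m).2.1] at h1
    exact h1.ne'
  have hu0 : ∀ m < n, u m = 0 := by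
    intro m
    induction m using Nat.strong_induction_on with
    | _ m ih =>
      intro hm
      have h1 := hqu m
      rw [if_neg hm.ne', Finset.sum_range_succ, Finset.sum_eq_zero fun k hk => by
        rw [ih k (Finset.mem_range.1 hk) ((Finset.mem_range.1 hk).trans hm), mul_zero], zero_add] at h1
      exact (mul_eq_zero.1 h1).resolve_left (hlead m)
  have hun : (q n).coeff n * u n = 1 := by
    have h1 := hqu n
    rwa [if_pos rfl, Finset.sum_range_succ, Finset.sum_eq_zero fun k hk => by
      rw [hu0 k (Finset.mem_range.1 hk), mul_zero], zero_add] at h1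
  have g1 := Gamma_add_nat_pos ha n
  have g2 := Gamma_add_nat_pos hb n
  have g3 := cauchyInv_self_pos (by linarith : 0 < a + b + 1) (n + 1) n
  have hcoef : ∀ i ∈ Finset.range (n + 1), (p n).coeff i =
      u n / Real.Gamma (b + 1 + n) * (cauchyInv (a + b + 1) (n + 1) n i / Real.Gamma (a + 1 + i)) := by
    intro i hi
    have gi := Gamma_add_nat_pos ha i
    -- The inverse Cauchy matrix applied to the definition of u recovers the coefficients of p_n.
    have e1 : ∑ m ∈ Finset.range (n + 1), cauchyInv (a + b + 1) (n + 1) i m *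
        (u m / Real.Gamma (b + 1 + m)) = (p n).coeff i * Real.Gamma (a + 1 + i) := by
      have e2 : ∀ m ∈ Finset.range (n + 1), cauchyInv (a + b + 1) (n + 1) i m *
          (u m / Real.Gamma (b + 1 + m)) = ∑ j ∈ Finset.range (n + 1),
            (p n).coeff j * Real.Gamma (a + 1 + j) *
              (cauchyInv (a + b + 1) (n + 1) i m / (a + b + 1 + m + j)) := by
        intro m _
        have := (Gamma_add_nat_pos hb m).ne'
        rw [hu, Finset.sum_div, Finset.mul_sum]
        refine Finset.sum_congr rfl fun j _ => ?_
        rw [bimoment, add_right_comm (a + b + 1)]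
        field_simp
      rw [Finset.sum_congr rfl e2, Finset.sum_comm]
      have e3 : ∀ j ∈ Finset.range (n + 1), ∑ m ∈ Finset.range (n + 1),
          (p n).coeff j * Real.Gamma (a + 1 + j) *
              (cauchyInv (a + b + 1) (n + 1) i m / (a + b + 1 + m + j)) =
          if i = j then (p n).coeff j * Real.Gamma (a + 1 + j) else 0 := by
        intro j hj
        rw [← Finset.mul_sum, sum_cauchyInv_div (a + b + 1) (Finset.mem_range.1 hi)
          (Finset.mem_range.1 hj) fun i => by
            have : (0 : ℝ) ≤ i := Nat.cast_nonneg i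
            linarith]
        split_ifs <;> simp
      rw [Finset.sum_congr rfl e3, Finset.sum_ite_eq, if_pos hi]
    rw [Finset.sum_range_succ, Finset.sum_eq_zero fun k hk => by
      rw [hu0 k (Finset.mem_range.1 hk), zero_div, mul_zero], zero_add] at e1
    rw [cauchyInv_comm _ _ n i, mul_div_assoc', mul_comm (u n / _), e1]
    field_simp
  have hκ : (q n).coeff n = (p n).coeff n := by
    have h1 := (hdeg n).2.2.1
    rw [leadingCoeff, leadingCoeff, (hdeg n).1, (hdeg n).2.1] at h1
    exact h1.symm
  have hκpos : 0 < (p n).coeff n := by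
    have h1 := (hdeg n).2.2.2
    rwa [leadingCoeff, (hdeg n).1] at h1
  rw [hκ] at hun
  have hupos : 0 < u n := pos_of_mul_pos_right (hun ▸ one_pos) hκpos.le
  have hs : u n / Real.Gamma (b + 1 + n) =
      √(Real.Gamma (a + 1 + n) / (Real.Gamma (b + 1 + n) * cauchyInv (a + b + 1) (n + 1) n n)) := by
    -- The common leading coefficient κ satisfies κ u_n = 1 and is itself proportional to u_n, so
    -- u_n² is known and positivity selects the root.
    rw [eq_comm, Real.sqrt_eq_iff_eq_sq (by positivity) (by positivity)]
    have h1 := hcoef n (Finset.self_mem_range_succ n)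
    rw [h1] at hun
    field_simp at hun ⊢
    linear_combination -hun
  ext i
  by_cases hi : i ∈ Finset.range (n + 1)
  · rw [hcoef i hi, coeff_cauchyLaguerre hi, hs]
  · have hi' : n < i := by simpa using hi
    rw [coeff_eq_zero_of_natDegree_lt (by rwa [(hdeg n).1]),
      coeff_eq_zero_of_natDegree_lt (by rwa [(natDegree_cauchyLaguerre ha hb hab n).1])]

theorem existsUnique_isCauchyBiorthonormal (ha : -1 < a) (hb : -1 < b) (hab : -1 < a + b) :
    ∃! P : (ℕ → ℝ[X]) × (ℕ → ℝ[X]), IsCauchyBiorthonormal a b P.1 P.2 := by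
  refine ⟨(cauchyLaguerre a b, cauchyLaguerre b a),
    isCauchyBiorthonormal_cauchyLaguerre ha hb hab, fun P hP => ?_⟩
  exact Prod.ext (funext (hP.fst_eq ha hb hab))
    (funext ((hP.symm ha hb hab).fst_eq hb ha (by linarith)))

/-! ### The kernels -/

theorem eval_cauchyLaguerre (a b : ℝ) (n : ℕ) (x : ℝ) : (cauchyLaguerre a b n).eval x =
    √(Real.Gamma (a + 1 + n) / (Real.Gamma (b + 1 + n) * cauchyInv (a + b + 1) (n + 1) n n)) *
      ∑ k ∈ Finset.range (n + 1),
        cauchyInv (a + b + 1) (n + 1) n k * (x ^ k / Real.Gamma (a + 1 + k)) := by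
  rw [cauchyLaguerre, eval_finsetSum, Finset.mul_sum]
  refine Finset.sum_congr rfl fun k _ => ?_
  rw [eval_monomial]; ring

theorem cauchyForm_succ {α : ℝ} (hα : -1 < α) (n : ℕ) (u v : ℕ → ℝ) :
    cauchyForm α (n + 1) u v = cauchyForm α n u v +
      (∑ j ∈ Finset.range (n + 1), cauchyInv (α + 1) (n + 1) n j * u j) *
        (∑ k ∈ Finset.range (n + 1), cauchyInv (α + 1) (n + 1) n k * v k) /
          cauchyInv (α + 1) (n + 1) n n := by
  have hA : 0 < α + 1 := by linarith
  have g3 := (cauchyInv_self_pos hA (n + 1) n).ne'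
  have e : cauchyForm α (n + 1) u v - (∑ j ∈ Finset.range (n + 1), cauchyInv (α + 1) (n + 1) n j * u j) *
        (∑ k ∈ Finset.range (n + 1), cauchyInv (α + 1) (n + 1) n k * v k) /
          cauchyInv (α + 1) (n + 1) n n =
      ∑ j ∈ Finset.range (n + 1), ∑ k ∈ Finset.range (n + 1), (cauchyInv (α + 1) (n + 1) j k -
        cauchyInv (α + 1) (n + 1) n j * cauchyInv (α + 1) (n + 1) n k /
          cauchyInv (α + 1) (n + 1) n n) * (u j * v k) := by
    rw [cauchyForm, Finset.sum_mul_sum, Finset.sum_div, ← Finset.sum_sub_distrib]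
    refine Finset.sum_congr rfl fun j _ => ?_
    rw [Finset.sum_div, ← Finset.sum_sub_distrib]
    exact Finset.sum_congr rfl fun k _ => by ring
  -- After subtraction of the rank one matrix, row n and column n vanish; by `cauchyInv_succ` the
  -- remaining block is the inverse of size n.
  rw [← sub_eq_iff_eq_add, e, Finset.sum_range_succ, Finset.sum_eq_zero (s := Finset.range (n + 1)),
    add_zero, cauchyForm]
  · refine Finset.sum_congr rfl fun j hj => ?_
    rw [Finset.sum_range_succ, cauchyInv_comm _ _ j n, mul_div_cancel_right₀ _ g3, sub_self, zero_mul,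
      add_zero]
    refine Finset.sum_congr rfl fun k hk => ?_
    rw [cauchyInv_succ hA (Finset.mem_range.1 hj) (Finset.mem_range.1 hk), add_sub_cancel_right]
  · intro k _
    rw [mul_div_cancel_left₀ _ g3, sub_self, zero_mul]

theorem cauchyForm_comm (α : ℝ) (n : ℕ) (u v : ℕ → ℝ) : cauchyForm α n u v = cauchyForm α n v u := by
  rw [cauchyForm, cauchyForm, Finset.sum_comm]
  refine Finset.sum_congr rfl fun j _ => Finset.sum_congr rfl fun k _ => ?_
  rw [cauchyInv_comm, mul_comm (u k)]

theorem K00_comm (p q : ℕ → ℝ[X]) (n : ℕ) (x y : ℝ) : K00 p q n x y = K00 q p n y x :=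
  Finset.sum_congr rfl fun _ _ => mul_comm _ _

variable {p q : ℕ → ℝ[X]}

theorem IsCauchyBiorthonormal.K00_eq (h : IsCauchyBiorthonormal a b p q) (ha : -1 < a) (hb : -1 < b)
    (hab : -1 < a + b) (n : ℕ) (x y : ℝ) :
    K00 p q n x y = cauchyForm (a + b) n (fun j => x ^ j / Real.Gamma (a + 1 + j))
      (fun k => y ^ k / Real.Gamma (b + 1 + k)) := by
  induction n with
  | zero => simp [K00, cauchyForm]
  | succ n ih =>
    have g3 := (cauchyInv_self_pos (by linarith : 0 < a + b + 1) (n + 1) n).ne'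
    have hN := normalization_mul ha hb hab n
    rw [K00, Finset.sum_range_succ, ← K00, ih, cauchyForm_succ hab, h.fst_eq ha hb hab,
      (h.symm ha hb hab).fst_eq hb ha (by linarith), eval_cauchyLaguerre, eval_cauchyLaguerre]
    rw [add_comm b a] at hN ⊢
    congr 1
    -- The new summand p_n(x) q_n(y) is the rank one term, as its two constants multiply to
    -- 1/C_{nn}.
    rw [eq_div_iff g3]
    linear_combination ((∑ k ∈ Finset.range (n + 1),
        cauchyInv (a + b + 1) (n + 1) n k * (x ^ k / Real.Gamma (a + 1 + k))) *
      ∑ k ∈ Finset.range (n + 1),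
        cauchyInv (a + b + 1) (n + 1) n k * (y ^ k / Real.Gamma (b + 1 + k))) * hN

/-- The function `y^{c+k} e^{-y} / Γ(c+1+k) / (w+y)`, whose integral is `e^w E_{c+k}(w)`. -/
noncomputable def stieltjesIntegrand (c w : ℝ) (k : ℕ) (y : ℝ) : ℝ :=
  y ^ (c + k) * Real.exp (-y) / (w + y) / Real.Gamma (c + 1 + k)

theorem integral_stieltjesIntegrand {c w : ℝ} (hc : -1 < c) (hw : 0 < w) (k : ℕ) :
    IntegrableOn (stieltjesIntegrand c w k) (Ioi 0) ∧
      ∫ y in Ioi 0, stieltjesIntegrand c w k y = Real.exp w * expInt (c + k) w := by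
  obtain ⟨h1, h2⟩ := integral_stieltjes (p := c + k) (y := w)
    (by linarith [(Nat.cast_nonneg k : (0 : ℝ) ≤ k)]) hw
  refine ⟨h1.div_const _, ?_⟩
  simp only [stieltjesIntegrand]
  rw [integral_div, h2, add_right_comm, mul_div_cancel_left₀ _ (Gamma_add_nat_pos hc k).ne']

theorem stieltjesIntegrand_eq {c w y : ℝ} (hy : 0 < y) (k : ℕ) : stieltjesIntegrand c w k y =
    y ^ k / Real.Gamma (c + 1 + k) * (y ^ c * Real.exp (-y) / (w + y)) := by
  rw [stieltjesIntegrand, Real.rpow_add_natCast hy.ne']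
  ring

theorem IsCauchyBiorthonormal.K01_eq (h : IsCauchyBiorthonormal a b p q) (ha : -1 < a) (hb : -1 < b)
    (hab : -1 < a + b) (n : ℕ) (x : ℝ) {y : ℝ} (hy : 0 < y) :
    IntegrableOn (k01Integrand b p q n x y) (Ioi 0) ∧
      K01 b p q n x y = Real.exp y * cauchyForm (a + b) n (fun j => x ^ j / Real.Gamma (a + 1 + j))
        (fun k => expInt (b + k) y) := by
  have key := fun k => integral_stieltjesIntegrand hb hy k
  have e : EqOn (fun y' => ∑ j ∈ Finset.range n, ∑ k ∈ Finset.range n,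
      cauchyInv (a + b + 1) n j k * (x ^ j / Real.Gamma (a + 1 + j)) * stieltjesIntegrand b y k y')
      (k01Integrand b p q n x y) (Ioi 0) := by
    intro y' hy'
    rw [k01Integrand, h.K00_eq ha hb hab, cauchyForm, Finset.sum_mul]
    refine Finset.sum_congr rfl fun j _ => ?_
    rw [Finset.sum_mul]
    refine Finset.sum_congr rfl fun k _ => ?_
    rw [stieltjesIntegrand_eq hy']
    ring
  have hi : ∀ j ∈ Finset.range n, IntegrableOn (fun y' => ∑ k ∈ Finset.range n,
      cauchyInv (a + b + 1) n j k * (x ^ j / Real.Gamma (a + 1 + j)) * stieltjesIntegrand b y k y')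
      (Ioi 0) := fun j _ => integrable_finsetSum _ fun k _ => (key k).1.const_mul _
  refine ⟨IntegrableOn.congr_fun (integrable_finsetSum _ hi) e measurableSet_Ioi, ?_⟩
  rw [K01, ← setIntegral_congr_fun measurableSet_Ioi e, integral_finsetSum _ hi, cauchyForm,
    Finset.mul_sum]
  refine Finset.sum_congr rfl fun j _ => ?_
  rw [integral_finsetSum _ fun k _ => (key k).1.const_mul _, Finset.mul_sum]
  refine Finset.sum_congr rfl fun k _ => ?_
  rw [integral_const_mul, (key k).2]
  ring

theorem k10Integrand_eq (p q : ℕ → ℝ[X]) (n : ℕ) (x y : ℝ) :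
    k10Integrand a p q n x y = k01Integrand a q p n y x := by
  funext x'
  rw [k10Integrand, k01Integrand, K00_comm]

theorem K10_eq (p q : ℕ → ℝ[X]) (n : ℕ) (x y : ℝ) : K10 a p q n x y = K01 a q p n y x := by
  rw [K10, K01, k10Integrand_eq]

theorem IsCauchyBiorthonormal.K11_eq (h : IsCauchyBiorthonormal a b p q) (ha : -1 < a) (hb : -1 < b)
    (hab : -1 < a + b) (n : ℕ) {x y : ℝ} (hx : 0 < x) (hy : 0 < y) :
    IntegrableOn (k11Integrand a b p q n x y) (Ioi 0 ×ˢ Ioi 0) ∧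
      K11 a b p q n x y = Real.exp (x + y) * cauchyForm (a + b) n (fun j => expInt (a + j) x)
        (fun k => expInt (b + k) y) - 1 / (x + y) := by
  have hm : MeasurableSet (Ioi (0 : ℝ) ×ˢ Ioi (0 : ℝ)) := measurableSet_Ioi.prod measurableSet_Ioi
  have kx := fun j => integral_stieltjesIntegrand ha hx j
  have ky := fun k => integral_stieltjesIntegrand hb hy k
  have kxy : ∀ j k, IntegrableOn (fun z : ℝ × ℝ => stieltjesIntegrand a x j z.1 *
      stieltjesIntegrand b y k z.2) (Ioi 0 ×ˢ Ioi 0) := fun j k => by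
    rw [IntegrableOn, volume_restrict_quadrant]
    exact (kx j).1.mul_prod (ky k).1
  have ixy : ∀ j k, ∫ z in Ioi (0 : ℝ) ×ˢ Ioi (0 : ℝ), stieltjesIntegrand a x j z.1 *
      stieltjesIntegrand b y k z.2 =
        (Real.exp x * expInt (a + j) x) * (Real.exp y * expInt (b + k) y) := fun j k => by
    rw [volume_restrict_quadrant, integral_prod_mul, (kx j).2, (ky k).2]
  have e : EqOn (fun z : ℝ × ℝ => ∑ j ∈ Finset.range n, ∑ k ∈ Finset.range n,
      cauchyInv (a + b + 1) n j k * (stieltjesIntegrand a x j z.1 * stieltjesIntegrand b y k z.2))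
      (k11Integrand a b p q n x y) (Ioi 0 ×ˢ Ioi 0) := by
    intro z hz
    rw [k11Integrand, h.K00_eq ha hb hab, cauchyForm, Finset.sum_mul, Finset.sum_mul]
    refine Finset.sum_congr rfl fun j _ => ?_
    rw [Finset.sum_mul, Finset.sum_mul]
    refine Finset.sum_congr rfl fun k _ => ?_
    rw [stieltjesIntegrand_eq hz.1, stieltjesIntegrand_eq hz.2]
    ring
  have hi : ∀ j ∈ Finset.range n, IntegrableOn (fun z : ℝ × ℝ => ∑ k ∈ Finset.range n,
      cauchyInv (a + b + 1) n j k * (stieltjesIntegrand a x j z.1 * stieltjesIntegrand b y k z.2))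
      (Ioi 0 ×ˢ Ioi 0) := fun j _ => integrable_finsetSum _ fun k _ => (kxy j k).const_mul _
  refine ⟨IntegrableOn.congr_fun (integrable_finsetSum _ hi) e hm, ?_⟩
  rw [K11, ← setIntegral_congr_fun hm e, integral_finsetSum _ hi, cauchyForm, Finset.mul_sum]
  congr 1
  refine Finset.sum_congr rfl fun j _ => ?_
  rw [integral_finsetSum _ fun k _ => (kxy j k).const_mul _, Finset.mul_sum]
  refine Finset.sum_congr rfl fun k _ => ?_
  rw [integral_const_mul, ixy, Real.exp_add]
  ring

end

end Kernels

/-! ### The integral representations of the kernels -/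

/-- The three assumptions say that max(-a,0) + max(-b,0) < 1. A third of the slack is added to each
maximum, which makes the inequalities strict and keeps the sum below 1. -/
theorem exists_exponents {a b : ℝ} (ha : -1 < a) (hb : -1 < b) (hab : -1 < a + b) :
    ∃ δ δ' : ℝ, 0 ≤ δ ∧ 0 ≤ δ' ∧ -a < δ ∧ -b < δ' ∧ δ + δ' < 1 := by
  have h : max (-a) 0 + max (-b) 0 < 1 := by
    rcases max_cases (-a) 0 with h1 | h1 <;> rcases max_cases (-b) 0 with h2 | h2 <;>
      rw [h1.1, h2.1] <;> linarith
  refine ⟨max (-a) 0 + (1 - (max (-a) 0 + max (-b) 0)) / 3,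
    max (-b) 0 + (1 - (max (-a) 0 + max (-b) 0)) / 3, ?_, ?_, ?_, ?_, ?_⟩ <;>
  linarith [le_max_left (-a) 0, le_max_right (-a) 0, le_max_left (-b) 0, le_max_right (-b) 0]

theorem eulerSum_rpow {α c x t : ℝ} (n : ℕ) (hx : 0 < x) (ht : 0 < t) :
    eulerSum α x 0 (fun j t => (t * x) ^ (c + j) / Real.Gamma (c + 1 + j)) n t =
      (t * x) ^ c * gSum α c n (t * x) := by
  rw [eulerSum, gSum, zero_mul, zero_add, Finset.mul_sum]
  refine Finset.sum_congr rfl fun k _ => ?_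
  rw [Real.rpow_add_natCast (mul_pos ht hx).ne']
  ring

theorem eulerSum_expInt (α c x t : ℝ) (n : ℕ) :
    eulerSum α x 1 (fun j t => expInt (c + j) (t * x)) n t = hTildeSum α c n (t * x) := by
  rw [eulerSum, hTildeSum, one_mul]

theorem cauchyForm_mul_mul (α : ℝ) (n : ℕ) (s s' : ℝ) (u v : ℕ → ℝ) :
    cauchyForm α n (fun j => s * u j) (fun k => s' * v k) = s * s' * cauchyForm α n u v := by
  rw [cauchyForm, cauchyForm, Finset.mul_sum]
  refine Finset.sum_congr rfl fun j _ => ?_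
  rw [Finset.mul_sum]
  exact Finset.sum_congr rfl fun k _ => by ring

/-- `F(t) = (tx)^c G(t)` is the combination `eulerSum` of an `EulerFamily` with values `s u_j` at
`t = 1`. -/
structure IsEulerSum (α c x ε δ : ℝ) (n : ℕ) (s : ℝ) (u : ℕ → ℝ) (F G : ℝ → ℂ) : Prop where
  exists_family : ∃ f : ℕ → ℝ → ℝ, EulerFamily c x ε δ f ∧ (∀ j, f j 1 = s * u j) ∧
    ∀ t : ℝ, 0 < t → F t = eulerSum α x ε f n t
  eq_mul : ∀ t : ℝ, 0 < t → F t = (((t * x) ^ c : ℝ) : ℂ) * G t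

theorem isEulerSum_h {α c x δ : ℝ} (n : ℕ) (hα : -1 < α) (hx : 0 < x) (hc : -c < δ) :
    IsEulerSum α c x 0 δ n (x ^ c) (fun j => x ^ j / Real.Gamma (c + 1 + j))
      (fun t => hFun α c n ↑(t * x)) (fun t => gFun α c n ↑(t * x)) := by
  refine ⟨⟨_, eulerFamily_rpow hx hc, fun j => ?_, fun t ht => ?_⟩, fun t ht => ?_⟩
  · rw [one_mul, Real.rpow_add_natCast hx.ne']; ring
  · rw [hFun_eq hα (mul_pos ht hx), eulerSum_rpow n hx ht]
  · rw [hFun_eq hα (mul_pos ht hx), gFun_eq hα (mul_pos ht hx), Complex.ofReal_mul]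

theorem isEulerSum_hTilde {α c x δ : ℝ} (n : ℕ) (hα : -1 < α) (hcα : c < α + 1) (hx : 0 < x)
    (hc : -c < δ) (h0 : 0 ≤ δ) (h1 : δ ≤ 1) :
    IsEulerSum α c x 1 δ n 1 (fun j => expInt (c + j) x)
      (fun t => hTilde α c n ↑(t * x)) (fun t => gTilde α c n ↑(t * x)) := by
  refine ⟨⟨_, eulerFamily_expInt hx hc h0 h1, fun j => ?_, fun t ht => ?_⟩, fun t ht => ?_⟩
  · rw [one_mul, one_mul]
  · rw [hTilde_eq hα hcα (mul_pos ht hx), eulerSum_expInt]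
  · rw [hTilde_eq hα hcα (mul_pos ht hx), gTilde_eq hα hcα (mul_pos ht hx), ← Complex.ofReal_mul,
      ← mul_assoc, ← Real.rpow_add (mul_pos ht hx), add_neg_cancel, Real.rpow_zero, one_mul]

theorem IsEulerSum.integral {α a b x y ε ε' δ δ' s s' : ℝ} {n : ℕ} {u u' : ℕ → ℝ} {F G F' G' : ℝ → ℂ}
    (h : IsEulerSum α a x ε δ n s u F G) (h' : IsEulerSum α b y ε' δ' n s' u' F' G')
    (hα : -1 < α) (hab : α = a + b) (hx : 0 < x) (hy : 0 < y) (hδ : 0 ≤ δ) (hδ' : 0 ≤ δ')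
    (hδδ : δ + δ' < 1) :
    (IntervalIntegrable (fun t => F t * F' t) volume 0 1 ∧
      IntervalIntegrable (fun t : ℝ => ((t ^ α : ℝ) : ℂ) * G t * G' t) volume 0 1) ∧
    ∫ t in (0 : ℝ)..1, F t * F' t = ((s * s' * cauchyForm α n u u' +
        ε * ε' * ((1 - Real.exp (-(x + y))) / (x + y)) : ℝ) : ℂ) ∧
    ∫ t in (0 : ℝ)..1, ((t ^ α : ℝ) : ℂ) * G t * G' t = ((x ^ (-a) * y ^ (-b) *
      (s * s' * cauchyForm α n u u' + ε * ε' * ((1 - Real.exp (-(x + y))) / (x + y))) : ℝ) : ℂ) := by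
  obtain ⟨⟨f, hf, hfu, hF⟩, hFG⟩ := h
  obtain ⟨⟨f', hf', hfu', hF'⟩, hFG'⟩ := h'
  have hi := hf.intervalIntegrable hf' (α := α) (n := n) hx hy hδ hδ' hδδ
  have hv := hf.integral_mul hf' (n := n) hα hab hx hy hδ hδ' hδδ
  simp only [hfu, hfu', cauchyForm_mul_mul] at hv
  have e : EqOn (fun t => ((eulerSum α x ε f n t * eulerSum α y ε' f' n t : ℝ) : ℂ))
      (fun t => F t * F' t) (Ioc 0 1) := fun t ht => by
    simp only [hF t ht.1, hF' t ht.1, Complex.ofReal_mul]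
  have e2 : EqOn (fun t => ((x ^ (-a) * y ^ (-b) : ℝ) : ℂ) * (F t * F' t))
      (fun t : ℝ => ((t ^ α : ℝ) : ℂ) * G t * G' t) (Ioc 0 1) := fun t ht => by
    -- The powers (tx)^a and (ty)^b that turn the G-type functions into the H-type ones multiply to
    -- t^α up to constants, as α = a + b.
    have h1 : x ^ (-a) * y ^ (-b) * ((t * x) ^ a * (t * y) ^ b) = t ^ α := by
      rw [Real.mul_rpow ht.1.le hx.le, Real.mul_rpow ht.1.le hy.le, Real.rpow_neg hx.le,
        Real.rpow_neg hy.le, hab, Real.rpow_add ht.1]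
      have := (Real.rpow_pos_of_pos hx a).ne'
      have := (Real.rpow_pos_of_pos hy b).ne'
      field_simp
    simp only [hFG t ht.1, hFG' t ht.1, ← h1]
    push_cast
    ring
  have hi1 : IntervalIntegrable (fun t => F t * F' t) volume 0 1 := by
    rw [intervalIntegrable_iff_integrableOn_Ioc_of_le zero_le_one] at hi ⊢
    exact IntegrableOn.congr_fun hi.ofReal e measurableSet_Ioc
  have hi2 : IntervalIntegrable (fun t : ℝ => ((t ^ α : ℝ) : ℂ) * G t * G' t) volume 0 1 := by
    have h1 := hi1.const_mul ((x ^ (-a) * y ^ (-b) : ℝ) : ℂ)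
    rw [intervalIntegrable_iff_integrableOn_Ioc_of_le zero_le_one] at h1 ⊢
    exact IntegrableOn.congr_fun h1 e2 measurableSet_Ioc
  have hv1 : ∫ t in (0 : ℝ)..1, F t * F' t = ((s * s' * cauchyForm α n u u' +
      ε * ε' * ((1 - Real.exp (-(x + y))) / (x + y)) : ℝ) : ℂ) := by
    rw [← hv, ← intervalIntegral.integral_ofReal, intervalIntegral.integral_of_le zero_le_one,
      intervalIntegral.integral_of_le zero_le_one, setIntegral_congr_fun measurableSet_Ioc e]
  refine ⟨⟨hi1, hi2⟩, hv1, ?_⟩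
  rw [intervalIntegral.integral_of_le zero_le_one, ← setIntegral_congr_fun measurableSet_Ioc e2,
    integral_const_mul, ← intervalIntegral.integral_of_le zero_le_one, hv1, ← Complex.ofReal_mul]

end CauchyLaguerre

theorem mainTheorem2 (a b α : ℝ) (ha : -1 < a) (hb : -1 < b) (hab : -1 < a + b) (hα : α = a + b) :
    -- the Cauchy biorthogonal polynomials exist and are unique
    (∃! P : (ℕ → ℝ[X]) × (ℕ → ℝ[X]), IsCauchyBiorthonormal a b P.1 P.2) ∧
    ∀ (p q : ℕ → ℝ[X]), IsCauchyBiorthonormal a b p q → ∀ n : ℕ,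
      -- the contour integrals converge and do not depend on the contour; Meijer-G identification
      (∀ c : ℝ, c = a ∨ c = b → ∀ z : ℝ, 0 < z →
        HasMellinBarnes {0} {n + α + 1} (gIntegrand α c n z) (gFun α c n z) ∧
        HasMellinBarnes {-c, 0} {n + α + 1} (gTildeIntegrand α c n z) (gTilde α c n z) ∧
        HasMellinBarnes {c} {n + α - c + 1} (hIntegrand α c n z) (hFun α c n z) ∧
        HasMellinBarnes {0, c} {n + α - c + 1} (hTildeIntegrand α c n z) (hTilde α c n z) ∧
        gFun α c n z = meijerG 1 1 ![-α - n, (n : ℝ)] ![0, -c, -α] z ∧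
        gTilde α c n z = meijerG 2 1 ![-α - n, (n : ℝ)] ![0, -c, -α] z ∧
        hFun α c n z = ((z ^ c : ℝ) : ℂ) * gFun α c n z ∧
        hTilde α c n z = ((z ^ c : ℝ) : ℂ) * gTilde α c n z) ∧
      ∀ x y : ℝ, 0 < x → 0 < y →
        -- the integrals that define the kernels converge
        (IntegrableOn (k01Integrand b p q n x y) (Ioi 0) ∧
          IntegrableOn (k10Integrand a p q n x y) (Ioi 0) ∧
          IntegrableOn (k11Integrand a b p q n x y) (Ioi 0 ×ˢ Ioi 0)) ∧
        -- the integrals over `[0, 1]` converge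
        (IntervalIntegrable (fun t : ℝ => ((t ^ α : ℝ) : ℂ) *
            gFun α a n ↑(t * x) * gFun α b n ↑(t * y)) volume 0 1 ∧
          IntervalIntegrable (fun t : ℝ => ((t ^ α : ℝ) : ℂ) *
            gFun α a n ↑(t * x) * gTilde α b n ↑(t * y)) volume 0 1 ∧
          IntervalIntegrable (fun t : ℝ => ((t ^ α : ℝ) : ℂ) *
            gTilde α a n ↑(t * x) * gFun α b n ↑(t * y)) volume 0 1 ∧
          IntervalIntegrable (fun t : ℝ => ((t ^ α : ℝ) : ℂ) *
            gTilde α a n ↑(t * x) * gTilde α b n ↑(t * y)) volume 0 1 ∧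
          IntervalIntegrable (fun t : ℝ => hFun α a n ↑(t * x) * hFun α b n ↑(t * y)) volume 0 1 ∧
          IntervalIntegrable (fun t : ℝ => hFun α a n ↑(t * x) * hTilde α b n ↑(t * y)) volume 0 1 ∧
          IntervalIntegrable (fun t : ℝ => hTilde α a n ↑(t * x) * hFun α b n ↑(t * y)) volume 0 1 ∧
          IntervalIntegrable (fun t : ℝ => hTilde α a n ↑(t * x) * hTilde α b n ↑(t * y))
            volume 0 1) ∧
        -- the kernels `K`
        ((K00 p q n x y : ℂ) =
            ∫ t in (0 : ℝ)..1, ((t ^ α : ℝ) : ℂ) * gFun α a n ↑(t * x) * gFun α b n ↑(t * y)) ∧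
        ((K01 b p q n x y : ℂ) = ((y ^ b * Real.exp y : ℝ) : ℂ) *
            ∫ t in (0 : ℝ)..1, ((t ^ α : ℝ) : ℂ) * gFun α a n ↑(t * x) * gTilde α b n ↑(t * y)) ∧
        ((K10 a p q n x y : ℂ) = ((x ^ a * Real.exp x : ℝ) : ℂ) *
            ∫ t in (0 : ℝ)..1, ((t ^ α : ℝ) : ℂ) * gTilde α a n ↑(t * x) * gFun α b n ↑(t * y)) ∧
        ((K11 a b p q n x y : ℂ) = ((x ^ a * y ^ b * Real.exp (x + y) : ℝ) : ℂ) *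
            (∫ t in (0 : ℝ)..1, ((t ^ α : ℝ) : ℂ) * gTilde α a n ↑(t * x) * gTilde α b n ↑(t * y)) -
            ((Real.exp (x + y) / (x + y) : ℝ) : ℂ)) ∧
        -- the kernels `H`
        ((H01 a b p q n x y : ℂ) = ((Real.exp (-x + y) : ℝ) : ℂ) *
            ∫ t in (0 : ℝ)..1, hFun α a n ↑(t * x) * hTilde α b n ↑(t * y)) ∧
        ((H00 a b p q n x y : ℂ) = ((Real.exp (-x - y) : ℝ) : ℂ) *
            ∫ t in (0 : ℝ)..1, hFun α a n ↑(t * x) * hFun α b n ↑(t * y)) ∧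
        ((H11 a b p q n x y : ℂ) = ((Real.exp (x + y) : ℝ) : ℂ) *
            (∫ t in (0 : ℝ)..1, hTilde α a n ↑(t * x) * hTilde α b n ↑(t * y)) -
            ((Real.exp (x + y) / (x + y) : ℝ) : ℂ)) ∧
        ((H10 a b p q n x y : ℂ) = ((Real.exp (x - y) : ℝ) : ℂ) *
            ∫ t in (0 : ℝ)..1, hTilde α a n ↑(t * x) * hFun α b n ↑(t * y)) := by
  subst hα
  refine ⟨existsUnique_isCauchyBiorthonormal ha hb hab, fun p q hpq n => ⟨fun c hc z hz => ?_,
    fun x y hx hy => ?_⟩⟩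
  · have hcα : c < a + b + 1 := by rcases hc with rfl | rfl <;> linarith
    rw [← gFun_eq_meijerG, ← gTilde_eq_meijerG, gFun_eq hab hz, gTilde_eq hab hcα hz, hFun_eq hab hz,
      hTilde_eq hab hcα hz]
    refine ⟨hasMellinBarnes_g hab hz, hasMellinBarnes_gTilde hab hcα hz, hasMellinBarnes_h hab hz,
      hasMellinBarnes_hTilde hab hcα hz, rfl, rfl, by rw [Complex.ofReal_mul], ?_⟩
    rw [← Complex.ofReal_mul, ← mul_assoc, ← Real.rpow_add hz, add_neg_cancel, Real.rpow_zero,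
      one_mul]
  obtain ⟨δ, δ', hδ, hδ', hδa, hδb, hδδ⟩ := exists_exponents ha hb hab
  have Ha := isEulerSum_h (α := a + b) n hab hx hδa
  have Hb := isEulerSum_h (α := a + b) n hab hy hδb
  have Ta := isEulerSum_hTilde (α := a + b) n hab (by linarith) hx hδa hδ (by linarith)
  have Tb := isEulerSum_hTilde (α := a + b) n hab (by linarith) hy hδb hδ' (by linarith)
  obtain ⟨⟨i00, j00⟩, v00, w00⟩ := Ha.integral Hb hab rfl hx hy hδ hδ' hδδ
  obtain ⟨⟨i01, j01⟩, v01, w01⟩ := Ha.integral Tb hab rfl hx hy hδ hδ' hδδ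
  obtain ⟨⟨i10, j10⟩, v10, w10⟩ := Ta.integral Hb hab rfl hx hy hδ hδ' hδδ
  obtain ⟨⟨i11, j11⟩, v11, w11⟩ := Ta.integral Tb hab rfl hx hy hδ hδ' hδδ
  have k00 := hpq.K00_eq ha hb hab n x y
  obtain ⟨c01, k01⟩ := hpq.K01_eq ha hb hab n x hy
  -- K₁₀ is K₀₁ for the problem with the roles of (a, p, x) and (b, q, y) exchanged.
  obtain ⟨c10, k10⟩ := (hpq.symm ha hb hab).K01_eq hb ha (by linarith) n y hx
  obtain ⟨c11, k11⟩ := hpq.K11_eq ha hb hab n hx hy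
  rw [← k10Integrand_eq] at c10
  rw [← K10_eq, add_comm b a, cauchyForm_comm] at k10
  have hxa := (Real.rpow_pos_of_pos hx a).ne'
  have hyb := (Real.rpow_pos_of_pos hy b).ne'
  have hxy := (add_pos hx hy).ne'
  have ex := (Real.exp_pos x).ne'
  have ey := (Real.exp_pos y).ne'
  refine ⟨⟨c01, c10, c11⟩, ⟨j00, j01, j10, j11, i00, i01, i10, i11⟩, ?_⟩
  rw [v00, v01, v10, v11, w00, w01, w10, w11, H00, H01, H10, H11, k00, k01, k10, k11]
  simp only [← Complex.ofReal_mul, ← Complex.ofReal_sub, Complex.ofReal_inj]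
  -- All eight identities now compare the same values of the bilinear form. In those for K₁₁ and
  -- H₁₁, e^{x+y}(1 - e^{-x-y})/(x+y) - e^{x+y}/(x+y) = -1/(x+y).
  simp only [Real.rpow_neg hx.le, Real.rpow_neg hy.le, neg_add, sub_eq_add_neg (-x) y, Real.exp_add,
    Real.exp_neg, sub_eq_add_neg x y]
  refine ⟨?_, ?_, ?_, ?_, ?_, ?_, ?_, ?_⟩ <;> field_simp <;> ring
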